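/- Write $\mathbb R_+=[0,\infty)$. Let $C^m(\mathbb R_+)$ be the space of functions whose derivatives up to order $m$ are continuous and bounded on $\mathbb R_+$, and let $W^{4,1}(\mathbb R_+)$ be the space of functions in $L^1(\mathbb R_+)$ whose derivatives up to order $4$ are in $L^1(\mathbb R_+)$. Put $$E(f)=\int_0^\infty\Big(\tfrac12 f_{yy}^2-\tfrac1{12}f^3\Big)\,dy,\qquad \|f\|_X=\|f\|_{L^\infty}+\|f_y\|_{L^\infty}+\sum_{k=0}^4\|\partial_y^kf\|_{L^1}.$$ Let $a_0\in C^6(\mathbb R_+)\cap W^{4,1}(\mathbb R_+)$ with $\partial_y^ma_0(0)=0$ for $m=0,1,4,5$. For $0<T\le\infty$, a solution on $[0,T)$ with initial datum $a_0$ is a function $a$ on $[0,T)\times\mathbb R_+$ with $$a_t=-a_{yyyy}+a^2-a_y\int_0^y a\,dz\quad(0<t<T,\ y>0),\qquad a(0,\cdot)=a_0,$$ $$a(t,0)=a_y(t,0)=0,\qquad \lim_{y\to\infty}\partial_y^ma(t,y)=0\quad(0\le m\le 3,\ 0\le t<T),$$ such that $a(t,\cdot)\in C^6(\mathbb R_+)\cap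 W^{4,1}(\mathbb R_+)$ for all $t$, $a\in C([0,T);W^{4,1}(\mathbb R_+))\cap C([0,T);C^5(\mathbb R_+))\cap C((0,T);C^6(\mathbb R_+))$, and $\partial_y^6a$ is continuous on $[0,T)\times\mathbb R_+$ and bounded on $[0,S]\times\mathbb R_+$ for every $S<T$. If $E(a_0)<0$, then the solution blows up in finite time: there are a finite time $T^*>0$ and a solution $a$ on $[0,T^*)$ with initial datum $a_0$ such that every solution with initial datum $a_0$ on an interval $[0,S)$ satisfies $S\le T^*$ and agrees with $a$ on $[0,S)\times\mathbb R_+$, and $$\lim_{t\uparrow T^*}\|a(t,\cdot)\|_X=+\infty .$$ -/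

import Mathlib

open Set Filter Topology MeasureTheory
open scoped ENNReal

namespace Prandtl4

noncomputable section

/-- The `k`-th derivative of `f` on the closed half-line `[0, ∞)` (one-sided at `0`). -/
def D (k : ℕ) (f : ℝ → ℝ) : ℝ → ℝ := iteratedDerivWithin k f (Ici 0)

/-- `f ∈ C^m(ℝ₊)`: the derivatives up to order `m` are continuous and bounded on `[0, ∞)`. -/
def MemC (m : ℕ) (f : ℝ → ℝ) : Prop :=
  ContDiffOn ℝ m f (Ici 0) ∧ ∀ k ≤ m, ∃ C : ℝ, ∀ y, 0 ≤ y → |D k f y| ≤ C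

/-- For `f ∈ C^m(ℝ₊)`: `f ∈ W^{m,1}(ℝ₊)`, the derivatives up to order `m` are integrable.
It is only used for functions of class `C^m`, whose weak derivatives are the classical ones. -/
def MemW (m : ℕ) (f : ℝ → ℝ) : Prop :=
  ∀ k ≤ m, IntegrableOn (D k f) (Ici 0)

/-- Conditions on the initial datum: `a₀ ∈ C⁶ ∩ W^{4,1}` and
`∂_y^m a₀(0) = 0` for `m = 0, 1, 4, 5`. -/
structure IsDatum (a₀ : ℝ → ℝ) : Prop where
  memC : MemC 6 a₀
  memW : MemW 4 a₀
  compat0 : a₀ 0 = 0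
  compat1 : D 1 a₀ 0 = 0
  compat4 : D 4 a₀ 0 = 0
  compat5 : D 5 a₀ 0 = 0

/-- The energy `E(f) = ∫₀^∞ (f_yy² / 2 - f³ / 12) dy`. -/
def energy (f : ℝ → ℝ) : ℝ :=
  ∫ y in Ici (0 : ℝ), ((1 / 2) * (D 2 f y) ^ 2 - (1 / 12) * (f y) ^ 3)

/-- The norm `‖f‖_{L^∞} + ‖f_y‖_{L^∞} + ∑_{k ≤ 4} ‖∂_y^k f‖_{L¹}` on `ℝ₊`, with values
in `[0, ∞]`. -/
def xNorm (f : ℝ → ℝ) : ℝ≥0∞ :=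
  eLpNorm f ∞ (volume.restrict (Ici 0)) + eLpNorm (D 1 f) ∞ (volume.restrict (Ici 0))
    + ∑ k ∈ Finset.range 5, eLpNorm (D k f) 1 (volume.restrict (Ici 0))

/-- `a` is a solution on `[0, T) × ℝ₊` with initial datum `a₀` of
`a_t = -a_yyyy + a² - a_y ∫₀^y a`, `a(t, 0) = a_y(t, 0) = 0`, with decay as `y → ∞`.

Regularity: `a(t) ∈ C⁶ ∩ W^{4,1}`, and `t ↦ a(t)` is continuous into `W^{4,1}` and into `C⁵` on
`[0, T)` and into `C⁶` on `(0, T)`. At `t = 0` the sixth derivative, which is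
bounded on `[0, S] × ℝ₊` for all `S < T`, is attained in the sense of joint continuity, because
the convergence to a sixth derivative of `a₀` that is not uniformly continuous cannot be
uniform. -/
structure IsSolution (a₀ : ℝ → ℝ) (T : ℝ) (a : ℝ → ℝ → ℝ) : Prop where
  memC : ∀ t ∈ Ico 0 T, MemC 6 (a t)
  memW : ∀ t ∈ Ico 0 T, MemW 4 (a t)
  continuous_W : ∀ k ≤ 4, ∀ t ∈ Ico 0 T,
    Tendsto (fun s => eLpNorm (fun y => D k (a s) y - D k (a t) y) 1 (volume.restrict (Ici 0)))
      (𝓝[Ico 0 T] t) (𝓝 0)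
  continuous_C5 : ∀ k ≤ 5, ∀ t ∈ Ico 0 T,
    TendstoUniformlyOn (fun s => D k (a s)) (D k (a t)) (𝓝[Ico 0 T] t) (Ici 0)
  continuous_C6 : ∀ t ∈ Ioo 0 T,
    TendstoUniformlyOn (fun s => D 6 (a s)) (D 6 (a t)) (𝓝[Ioo 0 T] t) (Ici 0)
  continuousOn_D6 : ContinuousOn (fun p : ℝ × ℝ => D 6 (a p.1) p.2) (Ico 0 T ×ˢ Ici 0)
  bounded_D6 : ∀ S < T, ∃ C : ℝ, ∀ t ∈ Icc 0 S, ∀ y, 0 ≤ y → |D 6 (a t) y| ≤ C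
  equation : ∀ t ∈ Ioo 0 T, ∀ y, 0 < y →
    HasDerivAt (fun s => a s y)
      (-D 4 (a t) y + (a t y) ^ 2 - D 1 (a t) y * ∫ z in (0 : ℝ)..y, a t z) t
  initial : ∀ y, 0 ≤ y → a 0 y = a₀ y
  boundary0 : ∀ t ∈ Ico 0 T, a t 0 = 0
  boundary1 : ∀ t ∈ Ico 0 T, D 1 (a t) 0 = 0
  decay : ∀ m ≤ 3, ∀ t ∈ Ico 0 T, Tendsto (D m (a t)) atTop (𝓝 0)

end

end Prandtl4

/-! Blow-up is a concavity argument of Levine type. Write `b = ∫₀^y a`, `M = ∫ a²` and `F = -E(a)`.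
The boundary values and the decay at infinity remove the nonlocal transport term through three
identities: `∫ a a_y b = -½ ∫ a³`, `∫ a² a_y b = -⅓ ∫ a⁴` and `∫ b a_y a_yyyy = ¾ ∫ a² a_yyyy`. They
give `M' = ∫ a (3a² - 2a_yyyy) = 36 F + 16 ‖a_yy‖²` and `F' = ‖a_yyyy‖² - ½ ∫ a² a_yyyy + ⅓ ‖a²‖²`,
norms being those of L². The equation is not a gradient flow of `E`, but this quadratic form is
positive definite, so `F` stays positive, and it is large enough for Cauchy–Schwarz to yield `M'² ≤
28 M F'`. Since `36 F M' ≤ M'²`, it follows that `F'/F ≥ (9/7) M'/M`, hence `F ≥ c M^(9/7)` and `M'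
≥ 36 c M^(9/7)`, which bounds the lifespan of every solution by a number depending on the datum
alone (`energy_inequalities`, `lifespan_le`, `exists_lifespan_bound`).

The rest is well-posedness in the stated class. The clamped operator `∂_y⁴` on the half-line has the
explicit generalized eigenfunctions `mode 0 (k y)`, so its semigroup has the kernel `ker 0 0 0`. An
oscillatory cancellation bounds this kernel by a Cauchy weight of width `t^(1/4)`, with a further
factor `t^(-1/4)` for each derivative (`abs_ker_le`). By Schur's test the semigroup acts on bounded
continuous functions, integrable or not, and Duhamel's equation for the pair `(a, a_y)` is a
Volterra equation with integrable singularity. A contraction solves it on a time controlled by the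
size of `(a₀, a₀')` (`exists_local`).

Smoothness up to order six is obtained by moving derivatives from the kernel to the datum and to the
nonlinearity (`toC_T_succ`, `exists_solCurve`). The boundary terms vanish because of the
compatibility conditions at orders 0, 1, 4, 5 and because of the trace of the kernel at orders 2, 3.
Conversely a classical solution is mild, hence unique (`IsSolution.mild`, `IsSolution.unique`), and
its values at positive times are again admissible data (`IsSolution.isDatum`). So there is a maximal
solution, of finite lifespan. If its X-norm stayed bounded along a sequence of times tending to the
end, restarting close enough to the end would continue it (`tendsto_xNorm_of_maximal`). -/

namespace Prandtl4

noncomputable section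

/-! ### Eigenfunctions of the clamped fourth-order operator -/

/-- The `l`-th derivative of `z ↦ cos z - sin z - exp (-z)`, the generalized eigenfunction of the
clamped biharmonic operator on the half-line. -/
def mode (l : ℕ) (z : ℝ) : ℝ :=
  ((1 + Complex.I) * Complex.I ^ l * Complex.exp (z * Complex.I)).re - (-1) ^ l * Real.exp (-z)

theorem hasDerivAt_mode (l : ℕ) (z : ℝ) : HasDerivAt (mode l) (mode (l + 1) z) z := by
  have h1 : HasDerivAt (fun z : ℂ => (1 + Complex.I) * Complex.I ^ l * Complex.exp (z * Complex.I))
      ((1 + Complex.I) * Complex.I ^ l * (Complex.exp (z * Complex.I) * (1 * Complex.I))) (z : ℂ) :=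
    (((hasDerivAt_id (z : ℂ)).mul_const Complex.I).cexp).const_mul _
  have h2 : HasDerivAt (fun z : ℝ => (-1 : ℝ) ^ l * Real.exp (-z))
      ((-1 : ℝ) ^ l * (Real.exp (-z) * (-1))) z :=
    ((hasDerivAt_neg z).exp).const_mul _
  refine (h1.real_of_complex.sub h2).congr_deriv ?_
  simp only [mode]
  congr 1
  · congr 1; ring
  · ring

theorem continuous_mode (l : ℕ) : Continuous (mode l) :=
  continuous_iff_continuousAt.2 fun z => (hasDerivAt_mode l z).continuousAt

theorem abs_mode_le (l : ℕ) {z : ℝ} (hz : 0 ≤ z) : |mode l z| ≤ 3 := by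
  have h1 : |((1 + Complex.I) * Complex.I ^ l * Complex.exp (z * Complex.I)).re| ≤ 2 := by
    refine (Complex.abs_re_le_norm _).trans ?_
    rw [norm_mul, norm_mul, norm_pow, Complex.norm_I, Complex.norm_exp_ofReal_mul_I]
    have := norm_add_le (1 : ℂ) Complex.I
    simp at this ⊢
    linarith
  have h2 : |(-1 : ℝ) ^ l * Real.exp (-z)| ≤ 1 := by
    rw [abs_mul, abs_pow, abs_neg, abs_one, one_pow, one_mul, abs_of_pos (Real.exp_pos _)]
    exact Real.exp_le_one_iff.2 (by linarith)
  rw [abs_le] at *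
  rw [mode]
  constructor <;> linarith [h1.1, h1.2, h2.1, h2.2]

theorem mode_eq (l : ℕ) (z : ℝ) : mode l z = (Complex.I ^ l).re * (Real.cos z - Real.sin z)
    - (Complex.I ^ l).im * (Real.cos z + Real.sin z) - (-1) ^ l * Real.exp (-z) := by
  simp only [mode, Complex.exp_mul_I, ← Complex.ofReal_cos, ← Complex.ofReal_sin]
  simp only [Complex.mul_re, Complex.mul_im, Complex.add_re, Complex.add_im, Complex.ofReal_re,
    Complex.ofReal_im, Complex.I_re, Complex.I_im, Complex.one_re, Complex.one_im]
  ring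

/-- This is the eigenvalue equation: four derivatives reproduce the function. -/
theorem mode_add_four (l : ℕ) (z : ℝ) : mode (l + 4) z = mode l z := by
  simp [mode, pow_add, show (-1 : ℝ) ^ 4 = 1 by norm_num]

theorem mode_zero_zero : mode 0 0 = 0 := by simp [mode_eq]

theorem mode_one_zero : mode 1 0 = 0 := by simp [mode_eq]

/-! ### The Laplace-type integrals of `k ^ m * exp (-k ^ 4)` -/

theorem integrableOn_pow_mul_exp (m : ℕ) {t : ℝ} (ht : 0 < t) :
    IntegrableOn (fun k : ℝ => k ^ m * Real.exp (-(k ^ 4 * t))) (Ioi 0) := by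
  have := integrableOn_rpow_mul_exp_neg_mul_rpow (p := 4) (s := m) (b := t)
    (by have : (0 : ℝ) ≤ m := m.cast_nonneg
        linarith) (by norm_num) ht
  refine this.congr_fun (fun k hk => ?_) measurableSet_Ioi
  have h4 : k ^ (4 : ℝ) = k ^ 4 := by exact_mod_cast Real.rpow_natCast k 4
  simp only [Real.rpow_natCast, h4]
  congr 2; ring

/-- Expanding the modes in complex exponentials turns the kernel at time one into values of this
transform in the closed right half-plane. -/
def lap (m : ℕ) (w : ℂ) : ℂ :=
  ∫ k in Ioi (0 : ℝ), (k : ℂ) ^ m * Complex.exp (-(k : ℂ) ^ 4) * Complex.exp (-(k * w))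

theorem norm_lap_integrand_le (m : ℕ) {w : ℂ} (hw : 0 ≤ w.re) {k : ℝ} (hk : 0 < k) :
    ‖(k : ℂ) ^ m * Complex.exp (-(k : ℂ) ^ 4) * Complex.exp (-(k * w))‖ ≤
      k ^ m * Real.exp (-(k ^ 4 * 1)) := by
  rw [norm_mul, norm_mul, norm_pow, Complex.norm_exp, Complex.norm_exp, Complex.norm_real,
    Real.norm_of_nonneg hk.le]
  have h1 : (-(k : ℂ) ^ 4).re = -(k ^ 4 * 1) := by
    rw [← Complex.ofReal_pow, ← Complex.ofReal_neg, Complex.ofReal_re, mul_one]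
  have h2 : Real.exp (-(k * w)).re ≤ 1 := by
    rw [Real.exp_le_one_iff]
    simp
    positivity
  rw [h1]
  exact mul_le_of_le_one_right (by positivity) h2

theorem integrableOn_lap (m : ℕ) {w : ℂ} (hw : 0 ≤ w.re) :
    IntegrableOn (fun k : ℝ => (k : ℂ) ^ m * Complex.exp (-(k : ℂ) ^ 4) * Complex.exp (-(k * w)))
      (Ioi 0) := by
  refine Integrable.mono' (integrableOn_pow_mul_exp m one_pos) ?_ ?_
  · exact Continuous.aestronglyMeasurable (by fun_prop)
  · exact (ae_restrict_iff' measurableSet_Ioi).2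
      (Eventually.of_forall fun k hk => norm_lap_integrand_le m hw hk)

theorem norm_lap_le (m : ℕ) : ∃ C : ℝ, ∀ w : ℂ, 0 ≤ w.re → ‖lap m w‖ ≤ C :=
  ⟨∫ k in Ioi (0 : ℝ), k ^ m * Real.exp (-(k ^ 4 * 1)), fun _ hw =>
    norm_integral_le_of_norm_le (integrableOn_pow_mul_exp m one_pos)
      ((ae_restrict_iff' measurableSet_Ioi).2
        (Eventually.of_forall fun _ hk => norm_lap_integrand_le m hw hk))⟩

/-- Integration by parts in `k`. The boundary value at `k = 0` survives only for `m = 0`. -/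
theorem mul_lap (m : ℕ) {w : ℂ} (hw : 0 ≤ w.re) :
    w * lap m w = (if m = 0 then 1 else 0) + m * lap (m - 1) w - 4 * lap (m + 3) w := by
  have hd : ∀ k : ℝ, HasDerivAt
      (fun k : ℝ => (k : ℂ) ^ m * Complex.exp (-(k : ℂ) ^ 4) * Complex.exp (-(k * w)))
      (m * ((k : ℂ) ^ (m - 1) * Complex.exp (-(k : ℂ) ^ 4) * Complex.exp (-(k * w)))
        - 4 * ((k : ℂ) ^ (m + 3) * Complex.exp (-(k : ℂ) ^ 4) * Complex.exp (-(k * w)))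
        - w * ((k : ℂ) ^ m * Complex.exp (-(k : ℂ) ^ 4) * Complex.exp (-(k * w)))) k := by
    intro k
    have e1 := hasDerivAt_pow m (k : ℂ)
    have e2 := ((hasDerivAt_pow 4 (k : ℂ)).neg).cexp
    have e3 := (((hasDerivAt_id (k : ℂ)).mul_const w).neg).cexp
    refine ((e1.mul e2).mul e3).comp_ofReal.congr_deriv ?_
    simp
    ring
  have i0 := integrableOn_lap m hw
  have i1 := (integrableOn_lap (m - 1) hw).const_mul (m : ℂ)
  have i2 := (integrableOn_lap (m + 3) hw).const_mul 4
  have i3 := i0.const_mul w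
  have hint := (i1.sub i2).sub i3
  have hlim := tendsto_zero_of_hasDerivAt_of_integrableOn_Ioi (fun k _ => hd k) hint i0
  have key := integral_Ioi_of_hasDerivAt_of_tendsto (hd 0).continuousAt.continuousWithinAt
    (fun k _ => hd k) hint hlim
  have s1 := integral_sub (i1.sub i2) i3
  simp only [Pi.sub_apply] at s1
  rw [s1, integral_sub i1 i2, integral_const_mul, integral_const_mul,
    integral_const_mul] at key
  change (m : ℂ) * lap (m - 1) w - 4 * lap (m + 3) w - w * lap m w = _ at key
  rcases Nat.eq_zero_or_pos m with rfl | hm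
  · simp at key ⊢
    linear_combination -key
  · simp [hm.ne'] at key ⊢
    linear_combination -key

/-- Each factor `w` is exchanged through `mul_lap` for the moments `m - 1` and `m + 3`. After `m +
1` exchanges the boundary value at `k = 0` is reached and no further decay is available. -/
theorem norm_pow_mul_lap_le (j m : ℕ) (hj : j ≤ m + 1) :
    ∃ C : ℝ, ∀ w : ℂ, 0 ≤ w.re → ‖w ^ j * lap m w‖ ≤ C := by
  induction j generalizing m with
  | zero => simpa using norm_lap_le m
  | succ j ih =>
    obtain ⟨C3, h3⟩ := ih (m + 3) (by omega)
    rcases Nat.eq_zero_or_pos m with rfl | hm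
    · obtain rfl : j = 0 := by omega
      refine ⟨1 + 4 * C3, fun w hw => ?_⟩
      have := h3 w hw
      rw [zero_add, pow_one, mul_lap 0 hw]
      simp at this ⊢
      refine (norm_sub_le _ _).trans ?_
      simp
      linarith
    · obtain ⟨C1, h1⟩ := ih (m - 1) (by omega)
      refine ⟨m * C1 + 4 * C3, fun w hw => ?_⟩
      rw [pow_succ, mul_assoc, mul_lap m hw, if_neg hm.ne', zero_add,
        show w ^ j * (m * lap (m - 1) w - 4 * lap (m + 3) w) =
          m * (w ^ j * lap (m - 1) w) - 4 * (w ^ j * lap (m + 3) w) by ring]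
      refine (norm_sub_le _ _).trans ?_
      rw [norm_mul (m : ℂ), norm_mul 4, Complex.norm_natCast, Complex.norm_ofNat]
      have := h1 w hw
      have := h3 w hw
      gcongr

/-- Watson's lemma: `lap m w` behaves like `m! / w ^ (m + 1)`. Two powers of `w` gained in the
remainder suffice for kernels bounded by `1 / (1 + z ^ 2)`. -/
theorem norm_lap_asymptotic (m : ℕ) :
    ∃ C : ℝ, ∀ w : ℂ, 0 ≤ w.re → ‖w ^ 2 * (w ^ (m + 1) * lap m w - m.factorial)‖ ≤ C := by
  induction m with
  | zero =>
    obtain ⟨C, hC⟩ := norm_pow_mul_lap_le 2 3 (by norm_num)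
    refine ⟨4 * C, fun w hw => ?_⟩
    have := mul_lap 0 hw
    simp at this
    rw [zero_add, pow_one, this]
    have := hC w hw
    simp only [Nat.factorial_zero, Nat.cast_one]
    rw [show w ^ 2 * (1 - 4 * lap 3 w - 1) = -4 * (w ^ 2 * lap 3 w) by ring, norm_mul]
    simp only [norm_neg, Complex.norm_ofNat]
    linarith
  | succ m ih =>
    obtain ⟨C, hC⟩ := ih
    obtain ⟨C', hC'⟩ := norm_pow_mul_lap_le (m + 3) (m + 4) (by omega)
    refine ⟨(m + 1) * C + 4 * C', fun w hw => ?_⟩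
    have e := mul_lap (m + 1) hw
    simp at e
    have e2 : w ^ 2 * (w ^ (m + 1 + 1) * lap (m + 1) w - (m + 1).factorial) =
        (m + 1 : ℕ) * (w ^ 2 * (w ^ (m + 1) * lap m w - m.factorial))
          - 4 * (w ^ (m + 3) * lap (m + 4) w) := by
      rw [pow_succ w (m + 1), mul_assoc, e, Nat.factorial_succ]
      push_cast
      ring
    rw [e2]
    refine (norm_sub_le _ _).trans ?_
    rw [norm_mul ((m + 1 : ℕ) : ℂ), norm_mul 4, Complex.norm_natCast, Complex.norm_ofNat]
    have := hC w hw
    have := hC' w hw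
    push_cast
    gcongr

theorem norm_lap_sub_le (m : ℕ) : ∃ C : ℝ, ∀ w : ℂ, 0 ≤ w.re → 1 ≤ ‖w‖ →
    ‖lap m w - m.factorial / w ^ (m + 1)‖ ≤ C / ‖w‖ ^ 2 := by
  obtain ⟨C, hC⟩ := norm_lap_asymptotic m
  refine ⟨C, fun w hw h1 => ?_⟩
  have hw0 : w ≠ 0 := by rintro rfl; simp at h1; linarith
  have hn : 0 < ‖w‖ := by linarith
  have := hC w hw
  rw [norm_mul, norm_pow] at this
  rw [le_div_iff₀ (by positivity)]
  have e : lap m w - m.factorial / w ^ (m + 1) =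
      (w ^ (m + 1) * lap m w - m.factorial) / w ^ (m + 1) := by field_simp
  rw [e, norm_div, norm_pow]
  have h2 : ‖w ^ (m + 1) * lap m w - m.factorial‖ / ‖w‖ ^ (m + 1) ≤
      ‖w ^ (m + 1) * lap m w - m.factorial‖ :=
    div_le_self (norm_nonneg _) (one_le_pow₀ h1)
  calc _ ≤ ‖w ^ (m + 1) * lap m w - m.factorial‖ * ‖w‖ ^ 2 := by gcongr
    _ ≤ C := by linarith

/-! ### The kernels -/

/-- The kernel `π⁻¹ ∫₀^∞ k ^ m * exp (-k ^ 4 * t) * mode l (k * x) * mode r (k * y) dk`. -/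
def ker (m l r : ℕ) (t x y : ℝ) : ℝ :=
  Real.pi⁻¹ * ∫ k in Ioi (0 : ℝ),
    k ^ m * Real.exp (-(k ^ 4 * t)) * (mode l (k * x) * mode r (k * y))

theorem abs_ker_integrand_le (m l r : ℕ) (t : ℝ) {x y k : ℝ} (hx : 0 ≤ x) (hy : 0 ≤ y)
    (hk : 0 < k) : |k ^ m * Real.exp (-(k ^ 4 * t)) * (mode l (k * x) * mode r (k * y))| ≤
      9 * (k ^ m * Real.exp (-(k ^ 4 * t))) := by
  have h1 := abs_mode_le l (mul_nonneg hk.le hx)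
  have h2 := abs_mode_le r (mul_nonneg hk.le hy)
  rw [abs_mul, abs_mul (mode l _), abs_of_nonneg (by positivity : 0 ≤ k ^ m * _), mul_comm 9]
  have : |mode l (k * x)| * |mode r (k * y)| ≤ 3 * 3 := by gcongr
  gcongr
  linarith

theorem integrableOn_ker (m l r : ℕ) {t x y : ℝ} (ht : 0 < t) (hx : 0 ≤ x) (hy : 0 ≤ y) :
    IntegrableOn (fun k : ℝ => k ^ m * Real.exp (-(k ^ 4 * t)) * (mode l (k * x) * mode r (k * y)))
      (Ioi 0) := by
  refine Integrable.mono' ((integrableOn_pow_mul_exp m ht).const_mul 9) ?_ ?_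
  · have := continuous_mode l
    have := continuous_mode r
    exact Continuous.aestronglyMeasurable (by fun_prop)
  · exact (ae_restrict_iff' measurableSet_Ioi).2
      (Eventually.of_forall fun k hk => abs_ker_integrand_le m l r t hx hy hk)

/-- The substitution `k ↦ q * k` reduces every time to time one. Writing the time as `q ^ 4` keeps
fractional powers out of the estimates. -/
theorem ker_scale (m l r : ℕ) {q : ℝ} (hq : 0 < q) (x y : ℝ) :
    ker m l r (q ^ 4) x y = q⁻¹ ^ (m + 1) * ker m l r 1 (x / q) (y / q) := by
  have h := integral_comp_mul_left_Ioi
    (fun k : ℝ => k ^ m * Real.exp (-(k ^ 4 * 1)) * (mode l (k * (x / q)) * mode r (k * (y / q))))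
    0 hq
  rw [mul_zero, smul_eq_mul] at h
  have h2 : ∫ k in Ioi (0 : ℝ), k ^ m * Real.exp (-(k ^ 4 * 1)) *
      (mode l (k * (x / q)) * mode r (k * (y / q))) = q * ∫ k in Ioi (0 : ℝ),
      (q * k) ^ m * Real.exp (-((q * k) ^ 4 * 1)) *
        (mode l ((q * k) * (x / q)) * mode r ((q * k) * (y / q))) := by
    rw [h, ← mul_assoc, mul_inv_cancel₀ hq.ne', one_mul]
  rw [ker, ker, h2, ← integral_const_mul, ← integral_const_mul, ← integral_const_mul,
    ← integral_const_mul]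
  congr 1
  ext k
  have e1 : q * k * (x / q) = k * x := by field_simp
  have e2 : q * k * (y / q) = k * y := by field_simp
  have e3 : (q * k) ^ 4 * 1 = k ^ 4 * q ^ 4 := by ring
  have e4 : q⁻¹ ^ (m + 1) * q * q ^ m = 1 := by
    rw [mul_assoc, ← pow_succ', inv_pow, inv_mul_cancel₀ (by positivity)]
  rw [e1, e2, e3, mul_pow]
  linear_combination (-Real.pi⁻¹ * k ^ m * Real.exp (-(k ^ 4 * q ^ 4)) *
    (mode l (k * x) * mode r (k * y))) * e4

/-- The translation invariant part of the kernel at time `1`. -/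
def kerMain (m l r : ℕ) (z : ℝ) : ℝ :=
  (Complex.I ^ l * (-Complex.I) ^ r * lap m (-(z * Complex.I))).re

/-- The boundary correction of the kernel at time `1`. -/
def kerCorr (m l r : ℕ) (x y : ℝ) : ℝ :=
  (Complex.I ^ (l + r + 1) * lap m (-((x + y : ℝ) * Complex.I))
    - (-1) ^ r * (1 + Complex.I) * Complex.I ^ l * lap m (y - x * Complex.I)
    - (-1) ^ l * (1 + Complex.I) * Complex.I ^ r * lap m (x - y * Complex.I)
    + (-1) ^ (l + r) * lap m (x + y : ℝ)).re

/-- The only exponential depending on `p - q` gives the translation invariant part. The four others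
decay or oscillate in a quantity comparable to `p + q`, and form the boundary correction. -/
theorem mode_mul_mode (l r : ℕ) (p q : ℝ) : mode l p * mode r q =
    (Complex.I ^ l * (-Complex.I) ^ r * Complex.exp ((p - q : ℝ) * Complex.I)
    + Complex.I ^ (l + r + 1) * Complex.exp ((p + q : ℝ) * Complex.I)
    - (-1) ^ r * (1 + Complex.I) * Complex.I ^ l * Complex.exp (-q + p * Complex.I)
    - (-1) ^ l * (1 + Complex.I) * Complex.I ^ r * Complex.exp (-p + q * Complex.I)
    + (-1) ^ (l + r) * Complex.exp (-(p + q : ℝ))).re := by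
  rw [mode_eq, mode_eq]
  have hc : (-Complex.I) ^ r = (starRingEnd ℂ) (Complex.I ^ r) := by simp
  have h1 : ∀ n : ℕ, (-1 : ℂ) ^ n = ((-1 : ℝ) ^ n : ℝ) := by intro n; push_cast; rfl
  have h2 : ∀ s : ℝ, Complex.exp (-(s : ℂ)) = (Real.exp (-s) : ℝ) := by intro s; push_cast; rfl
  rw [hc, pow_add Complex.I (l + r), pow_add Complex.I l, pow_add (-1 : ℂ), h1, h1,
    Complex.exp_add, Complex.exp_add, h2, h2, h2]
  simp only [Complex.exp_mul_I, ← Complex.ofReal_cos, ← Complex.ofReal_sin, Real.cos_sub,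
    Real.sin_sub, Real.cos_add, Real.sin_add, neg_add, Real.exp_add, pow_one]
  generalize Complex.I ^ l = u
  generalize Complex.I ^ r = v
  simp only [Complex.mul_re, Complex.mul_im, Complex.add_re, Complex.add_im, Complex.sub_re,
    Complex.ofReal_re, Complex.ofReal_im, Complex.I_re, Complex.I_im,
    Complex.one_re, Complex.one_im, Complex.conj_re, Complex.conj_im]
  ring

theorem ker_one_eq (m l r : ℕ) {x y : ℝ} (hx : 0 ≤ x) (hy : 0 ≤ y) :
    ker m l r 1 x y = Real.pi⁻¹ * (kerMain m l r (x - y) + kerCorr m l r x y) := by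
  rw [ker, kerMain, kerCorr, ← Complex.add_re]
  congr 1
  have w1 : 0 ≤ (-(((x - y : ℝ) : ℂ) * Complex.I)).re := by simp
  have w2 : 0 ≤ (-(((x + y : ℝ) : ℂ) * Complex.I)).re := by simp
  have w3 : 0 ≤ (y - x * Complex.I).re := by simpa
  have w4 : 0 ≤ (x - y * Complex.I).re := by simpa
  have w5 : 0 ≤ ((x + y : ℝ) : ℂ).re := by simp; positivity
  have i1 := (integrableOn_lap m w1).const_mul (Complex.I ^ l * (-Complex.I) ^ r)
  have i2 := (integrableOn_lap m w2).const_mul (Complex.I ^ (l + r + 1))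
  have i3 := (integrableOn_lap m w3).const_mul ((-1) ^ r * (1 + Complex.I) * Complex.I ^ l)
  have i4 := (integrableOn_lap m w4).const_mul ((-1) ^ l * (1 + Complex.I) * Complex.I ^ r)
  have i5 := (integrableOn_lap m w5).const_mul ((-1) ^ (l + r))
  simp only [lap]
  rw [← integral_const_mul, ← integral_const_mul, ← integral_const_mul, ← integral_const_mul,
    ← integral_const_mul]
  have s1 := integral_sub i2 i3
  have s2 := integral_sub (i2.sub i3) i4
  have s3 := integral_add ((i2.sub i3).sub i4) i5
  have s4 := integral_add i1 (((i2.sub i3).sub i4).add i5)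
  simp only [Pi.sub_apply, Pi.add_apply] at s1 s2 s3 s4
  rw [← s1, ← s2, ← s3, ← s4, ← RCLike.re_eq_complex_re, ← integral_re]
  swap
  · exact i1.add (((i2.sub i3).sub i4).add i5)
  refine integral_congr_ae (Eventually.of_forall fun k => ?_)
  simp only [RCLike.re_eq_complex_re]
  have hE : ((k : ℂ) ^ m * Complex.exp (-(k : ℂ) ^ 4)) =
      ((k ^ m * Real.exp (-(k ^ 4 * 1)) : ℝ) : ℂ) := by push_cast; rw [mul_one]
  rw [mode_mul_mode, ← Complex.re_ofReal_mul, hE]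
  congr 1
  have a1 : -((k : ℂ) * (-(((x - y : ℝ) : ℂ) * Complex.I))) =
    ((k * x - k * y : ℝ) : ℂ) * Complex.I := by push_cast; ring
  have a2 : -((k : ℂ) * (-(((x + y : ℝ) : ℂ) * Complex.I))) =
    ((k * x + k * y : ℝ) : ℂ) * Complex.I := by push_cast; ring
  have a3 : -((k : ℂ) * (y - x * Complex.I)) = -((k * y : ℝ) : ℂ) + (k * x : ℝ) * Complex.I := by
    push_cast; ring
  have a4 : -((k : ℂ) * (x - y * Complex.I)) = -((k * x : ℝ) : ℂ) + (k * y : ℝ) * Complex.I := by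
    push_cast; ring
  have a5 : -((k : ℂ) * (x + y : ℝ)) = -((k * x + k * y : ℝ) : ℂ) := by push_cast; ring
  rw [a1, a2, a3, a4, a5]
  ring

/-! ### Decay of the kernel at time one -/

theorem I_pow_congr {m n : ℕ} (h : n % 4 = m % 4) : Complex.I ^ n = Complex.I ^ m := by
  rw [Complex.I_pow_eq_pow_mod n, h, ← Complex.I_pow_eq_pow_mod]

/-- For `m = 0` the leading term decays only like `1 / |z|`, which is not integrable. When `l + r`
and `m` agree modulo four, the powers of `i` combine to `± i`, so the term is purely imaginary and
drops out of the real part. -/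
theorem kerMain_leading (m l r : ℕ) (h : (l + r) % 4 = m % 4) (z : ℝ) :
    (Complex.I ^ l * (-Complex.I) ^ r *
      (m.factorial / (-(z * Complex.I)) ^ (m + 1))).re = 0 := by
  have e0 := I_pow_congr h
  have e1 : (-(z * Complex.I)) ^ (m + 1) = z ^ (m + 1) * (-Complex.I) ^ (m + 1) := by
    rw [← mul_pow]; ring
  have e2 : ∀ n : ℕ, ((-Complex.I) ^ n)⁻¹ = Complex.I ^ n := by
    intro n; rw [← inv_pow, inv_neg, Complex.inv_I, neg_neg]
  have e3 : (-Complex.I) ^ r * Complex.I ^ r = 1 := by rw [← mul_pow]; simp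
  have e4 : ∀ n : ℕ, Complex.I ^ n * Complex.I ^ n = ((-1 : ℝ) ^ n : ℝ) := by
    intro n; rw [← mul_pow]; simp
  have : Complex.I ^ l * (-Complex.I) ^ r * (m.factorial / (-(z * Complex.I)) ^ (m + 1)) =
      ((m.factorial * (-1) ^ l * (z ^ (m + 1))⁻¹ : ℝ) : ℂ) * Complex.I := by
    rw [e1, div_eq_mul_inv, mul_inv, e2, pow_succ _ m, pow_succ Complex.I m, ← e0, pow_add]
    have := e4 l
    push_cast at this ⊢
    linear_combination (m.factorial : ℂ) * ((z : ℂ) ^ (m + 1))⁻¹ * Complex.I ^ l * Complex.I ^ l *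
      Complex.I * e3 + (m.factorial : ℂ) * ((z : ℂ) ^ (m + 1))⁻¹ * Complex.I * this
  rw [this, Complex.re_ofReal_mul, Complex.I_re, mul_zero]

/-- The leading terms cancel in pairs: the first is the opposite of the last, and the third is the
opposite of the conjugate of the second. -/
theorem kerCorr_leading (m l r : ℕ) (h : (l + r) % 4 = m % 4) (x y : ℝ) :
    (Complex.I ^ (l + r + 1) * (m.factorial / (-((x + y : ℝ) * Complex.I)) ^ (m + 1))
    - (-1) ^ r * (1 + Complex.I) * Complex.I ^ l * (m.factorial / (y - x * Complex.I) ^ (m + 1))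
    - (-1) ^ l * (1 + Complex.I) * Complex.I ^ r * (m.factorial / (x - y * Complex.I) ^ (m + 1))
    + (-1) ^ (l + r) * (m.factorial / ((x + y : ℝ) : ℂ) ^ (m + 1))).re = 0 := by
  have e0 := I_pow_congr h
  have e2 : ∀ n : ℕ, ((-Complex.I) ^ n)⁻¹ = Complex.I ^ n := by
    intro n; rw [← inv_pow, inv_neg, Complex.inv_I, neg_neg]
  have e4 : ∀ n : ℕ, Complex.I ^ n * Complex.I ^ n = (-1) ^ n := by
    intro n; rw [← mul_pow]; simp
  have e5 : ∀ n : ℕ, (-Complex.I) ^ n = (-1) ^ n * Complex.I ^ n := by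
    intro n; rw [← mul_pow]; simp
  have h1 : Complex.I ^ (l + r + 1) * (m.factorial / (-((x + y : ℝ) * Complex.I)) ^ (m + 1)) =
      - ((-1) ^ (l + r) * (m.factorial / ((x + y : ℝ) : ℂ) ^ (m + 1))) := by
    have e1 : (-((x + y : ℝ) * Complex.I)) ^ (m + 1) =
        ((x + y : ℝ) : ℂ) ^ (m + 1) * (-Complex.I) ^ (m + 1) := by
      rw [← mul_pow]; ring
    rw [e1, div_eq_mul_inv, mul_inv, e2, pow_succ Complex.I m, pow_succ _ (l + r), ← e0]
    have := e4 (l + r)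
    linear_combination (m.factorial : ℂ) * (((x + y : ℝ) : ℂ) ^ (m + 1))⁻¹ * Complex.I ^ 2 * this +
      (m.factorial : ℂ) * (((x + y : ℝ) : ℂ) ^ (m + 1))⁻¹ * (-1) ^ (l + r) * Complex.I_sq
  set v : ℂ := y - x * Complex.I with hv
  have h2 : (-1) ^ l * (1 + Complex.I) * Complex.I ^ r *
      (m.factorial / (x - y * Complex.I) ^ (m + 1)) =
      - (starRingEnd ℂ) ((-1) ^ r * (1 + Complex.I) * Complex.I ^ l *
        (m.factorial / v ^ (m + 1))) := by
    have e1 : ((x : ℂ) - y * Complex.I) ^ (m + 1) =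
        (-Complex.I) ^ (m + 1) * (starRingEnd ℂ v) ^ (m + 1) := by
      rw [← mul_pow, hv]
      congr 1
      simp
      linear_combination (x : ℂ) * Complex.I_sq
    rw [e1, div_eq_mul_inv, mul_inv, e2]
    simp only [map_mul, map_pow, map_div₀, map_add, map_one, map_neg, Complex.conj_I, map_natCast]
    rw [e5 l, pow_succ Complex.I m, ← e0, pow_add Complex.I l r]
    have := e4 r
    linear_combination ((-1) ^ l * (1 + Complex.I) * Complex.I ^ l * Complex.I *
      m.factorial * ((starRingEnd ℂ v) ^ (m + 1))⁻¹) * this +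
      ((-1) ^ l * (-1) ^ r * Complex.I ^ l *
      m.factorial * ((starRingEnd ℂ v) ^ (m + 1))⁻¹) * Complex.I_sq
  rw [h1, h2]
  simp only [Complex.add_re, Complex.sub_re, Complex.neg_re, Complex.conj_re]
  ring

theorem abs_kerMain_le (m l r : ℕ) (h : (l + r) % 4 = m % 4) :
    ∃ C : ℝ, ∀ z : ℝ, |kerMain m l r z| ≤ C * (1 + z ^ 2)⁻¹ := by
  obtain ⟨C, hC⟩ := norm_lap_le m
  obtain ⟨C', hC'⟩ := norm_lap_sub_le m
  refine ⟨2 * (|C| + |C'|), fun z => ?_⟩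
  have w : 0 ≤ (-((z : ℂ) * Complex.I)).re := by simp
  have hn : ‖(-((z : ℂ) * Complex.I))‖ = |z| := by simp
  rw [← div_eq_mul_inv, le_div_iff₀ (by positivity)]
  rcases le_total 1 |z| with h1 | h1
  · have e : kerMain m l r z = (Complex.I ^ l * (-Complex.I) ^ r *
        (lap m (-(z * Complex.I)) - m.factorial / (-(z * Complex.I)) ^ (m + 1))).re := by
      rw [mul_sub, Complex.sub_re, kerMain_leading m l r h, sub_zero, kerMain]
    have h2 := hC' _ w (hn ▸ h1)
    rw [hn, sq_abs] at h2
    have hz : 1 ≤ z ^ 2 := by rw [← sq_abs]; exact one_le_pow₀ h1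
    have h3 : |kerMain m l r z| ≤ C' / z ^ 2 := by
      rw [e]
      refine (Complex.abs_re_le_norm _).trans ?_
      simpa using h2
    rw [le_div_iff₀ (by positivity)] at h3
    have h0 := abs_nonneg (kerMain m l r z)
    have := le_abs_self C'
    have := abs_nonneg C
    nlinarith
  · have h3 : |kerMain m l r z| ≤ C := by
      rw [kerMain]
      refine (Complex.abs_re_le_norm _).trans ?_
      simpa using hC _ w
    have hz : z ^ 2 ≤ 1 := by rw [← sq_abs]; exact pow_le_one₀ (abs_nonneg _) h1
    have h0 := abs_nonneg (kerMain m l r z)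
    have := le_abs_self C
    have := abs_nonneg C'
    nlinarith

theorem norm_four_terms (l r : ℕ) (a b c d : ℂ) {K : ℝ} (ha : ‖a‖ ≤ K) (hb : ‖b‖ ≤ K)
    (hc : ‖c‖ ≤ K) (hd : ‖d‖ ≤ K) : |(Complex.I ^ (l + r + 1) * a
    - (-1) ^ r * (1 + Complex.I) * Complex.I ^ l * b
    - (-1) ^ l * (1 + Complex.I) * Complex.I ^ r * c + (-1) ^ (l + r) * d).re| ≤ 6 * K := by
  have h2 : ‖(1 + Complex.I : ℂ)‖ ≤ 2 := by
    have := norm_add_le (1 : ℂ) Complex.I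
    simp at this ⊢
    linarith
  have n1 : ‖Complex.I ^ (l + r + 1) * a‖ ≤ K := by simpa using ha
  have n2 : ‖(-1) ^ r * (1 + Complex.I) * Complex.I ^ l * b‖ ≤ 2 * K := by
    simp only [norm_mul, norm_pow, norm_neg, norm_one, Complex.norm_I, one_pow, one_mul, mul_one]
    gcongr
  have n3 : ‖(-1) ^ l * (1 + Complex.I) * Complex.I ^ r * c‖ ≤ 2 * K := by
    simp only [norm_mul, norm_pow, norm_neg, norm_one, Complex.norm_I, one_pow, one_mul, mul_one]
    gcongr
  have n4 : ‖(-1) ^ (l + r) * d‖ ≤ K := by simpa using hd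
  refine (Complex.abs_re_le_norm _).trans ?_
  refine (norm_add_le _ _).trans ?_
  have := norm_sub_le (Complex.I ^ (l + r + 1) * a
    - (-1) ^ r * (1 + Complex.I) * Complex.I ^ l * b) ((-1) ^ l * (1 + Complex.I) * Complex.I ^ r * c)
  have := norm_sub_le (Complex.I ^ (l + r + 1) * a)
    ((-1) ^ r * (1 + Complex.I) * Complex.I ^ l * b)
  linarith

/-- All four arguments of `lap` have modulus at least `(x + y) / √2`, so once the leading terms are
cancelled the remainders decay quadratically in `x + y`. -/
theorem abs_kerCorr_le (m l r : ℕ) (h : (l + r) % 4 = m % 4) :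
    ∃ C : ℝ, ∀ x y : ℝ, 0 ≤ x → 0 ≤ y → |kerCorr m l r x y| ≤ C * (1 + (x + y) ^ 2)⁻¹ := by
  obtain ⟨C, hC⟩ := norm_lap_le m
  obtain ⟨C', hC'⟩ := norm_lap_sub_le m
  -- The factor `6` of `norm_four_terms` is multiplied by the bound `5` for `1 + (x + y) ^ 2` on `x
  -- + y ≤ 2`. The far region needs only `24`.
  refine ⟨30 * (|C| + |C'|), fun x y hx hy => ?_⟩
  have w2 : 0 ≤ (-(((x + y : ℝ) : ℂ) * Complex.I)).re := by simp
  have w3 : 0 ≤ (y - x * Complex.I).re := by simpa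
  have w4 : 0 ≤ (x - y * Complex.I).re := by simpa
  have w5 : 0 ≤ ((x + y : ℝ) : ℂ).re := by simp; positivity
  rw [← div_eq_mul_inv, le_div_iff₀ (by positivity)]
  rcases le_total 2 (x + y) with h1 | h1
  · have e : kerCorr m l r x y = (Complex.I ^ (l + r + 1) *
        (lap m (-((x + y : ℝ) * Complex.I)) - m.factorial / (-((x + y : ℝ) * Complex.I)) ^ (m + 1))
        - (-1) ^ r * (1 + Complex.I) * Complex.I ^ l *
          (lap m (y - x * Complex.I) - m.factorial / (y - x * Complex.I) ^ (m + 1))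
        - (-1) ^ l * (1 + Complex.I) * Complex.I ^ r *
          (lap m (x - y * Complex.I) - m.factorial / (x - y * Complex.I) ^ (m + 1))
        + (-1) ^ (l + r) *
          (lap m (x + y : ℝ) - m.factorial / ((x + y : ℝ) : ℂ) ^ (m + 1))).re := by
      rw [← sub_zero (kerCorr m l r x y), ← kerCorr_leading m l r h x y, kerCorr, ← Complex.sub_re]
      congr 1
      ring
    have hs : 0 < (x + y) ^ 2 := by positivity
    have key : ∀ w : ℂ, 0 ≤ w.re → (x + y) ^ 2 ≤ 2 * ‖w‖ ^ 2 →
        ‖lap m w - m.factorial / w ^ (m + 1)‖ ≤ 2 * |C'| / (x + y) ^ 2 := by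
      intro w hw hw2
      have hpos : 0 < ‖w‖ ^ 2 := by linarith
      have hw1 : 1 ≤ ‖w‖ := by
        by_contra hlt
        have : ‖w‖ ^ 2 ≤ 1 := pow_le_one₀ (norm_nonneg _) (not_le.1 hlt).le
        nlinarith
      refine (hC' w hw hw1).trans ?_
      rw [div_le_div_iff₀ hpos hs]
      have := le_abs_self C'
      have := abs_nonneg C'
      nlinarith
    have sq3 : ‖(y - x * Complex.I : ℂ)‖ ^ 2 = x ^ 2 + y ^ 2 := by
      rw [Complex.sq_norm, Complex.normSq_apply]; simp; ring
    have sq4 : ‖(x - y * Complex.I : ℂ)‖ ^ 2 = x ^ 2 + y ^ 2 := by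
      rw [Complex.sq_norm, Complex.normSq_apply]; simp; ring
    have k2 := key _ w2 (by
      rw [norm_neg, norm_mul, Complex.norm_I, mul_one, Complex.norm_real, Real.norm_eq_abs, sq_abs]
      linarith)
    have k3 := key _ w3 (by rw [sq3]; nlinarith [sq_nonneg (x - y)])
    have k4 := key _ w4 (by rw [sq4]; nlinarith [sq_nonneg (x - y)])
    have k5 := key _ w5 (by
      rw [Complex.norm_real, Real.norm_eq_abs, sq_abs]
      linarith)
    have := norm_four_terms l r _ _ _ _ k2 k3 k4 k5
    rw [← e, ← mul_div_assoc, le_div_iff₀ hs] at this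
    have hs1 : 1 ≤ (x + y) ^ 2 := by nlinarith
    have h0 := mul_le_mul_of_nonneg_left hs1 (abs_nonneg (kerCorr m l r x y))
    have := abs_nonneg C
    have := abs_nonneg C'
    nlinarith
  · have := norm_four_terms l r _ _ _ _ (hC _ w2) (hC _ w3) (hC _ w4) (hC _ w5)
    rw [← kerCorr] at this
    have h0 := abs_nonneg (kerCorr m l r x y)
    have := le_abs_self C
    have := abs_nonneg C'
    have : (x + y) ^ 2 ≤ 4 := by nlinarith
    nlinarith

theorem abs_ker_one_le (m l r : ℕ) (h : (l + r) % 4 = m % 4) : ∃ C : ℝ, 0 ≤ C ∧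
    ∀ x y : ℝ, 0 ≤ x → 0 ≤ y → |ker m l r 1 x y| ≤ C * (1 + (x - y) ^ 2)⁻¹ := by
  obtain ⟨C, hC⟩ := abs_kerMain_le m l r h
  obtain ⟨C', hC'⟩ := abs_kerCorr_le m l r h
  refine ⟨Real.pi⁻¹ * (|C| + |C'|), by positivity, fun x y hx hy => ?_⟩
  rw [ker_one_eq m l r hx hy, abs_mul, abs_of_pos (inv_pos.2 Real.pi_pos), mul_assoc]
  gcongr
  refine (abs_add_le _ _).trans ?_
  rw [add_mul]
  have h1 : (1 + (x + y) ^ 2)⁻¹ ≤ (1 + (x - y) ^ 2)⁻¹ := by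
    apply inv_anti₀ (by positivity)
    nlinarith
  refine add_le_add ((hC _).trans ?_) ((hC' x y hx hy).trans ?_)
  · gcongr; exact le_abs_self _
  · gcongr; exact le_abs_self _

/-- The weight in parentheses has a mass independent of `q`, so the operator norms are governed by
`q⁻¹ ^ m` alone. -/
theorem abs_ker_le (m l r : ℕ) (h : (l + r) % 4 = m % 4) : ∃ C : ℝ, 0 ≤ C ∧
    ∀ q x y : ℝ, 0 < q → 0 ≤ x → 0 ≤ y →
      |ker m l r (q ^ 4) x y| ≤ C * q⁻¹ ^ m * (q⁻¹ * (1 + ((x - y) / q) ^ 2)⁻¹) := by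
  obtain ⟨C, h0, hC⟩ := abs_ker_one_le m l r h
  refine ⟨C, h0, fun q x y hq hx hy => ?_⟩
  rw [ker_scale m l r hq, abs_mul, abs_of_pos (by positivity : 0 < q⁻¹ ^ (m + 1))]
  have := hC (x / q) (y / q) (by positivity) (by positivity)
  rw [← sub_div] at this
  calc _ ≤ q⁻¹ ^ (m + 1) * (C * (1 + ((x - y) / q) ^ 2)⁻¹) := by gcongr
    _ = _ := by ring

/-! ### Calculus of the kernels -/

theorem ker_symm (m l r : ℕ) (t x y : ℝ) : ker m l r t x y = ker m r l t y x := by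
  simp only [ker, mul_comm (mode l _)]

theorem continuous_ker_integrand (m l r : ℕ) (k : ℝ) : Continuous fun p : ℝ × ℝ × ℝ =>
    k ^ m * Real.exp (-(k ^ 4 * p.1)) * (mode l (k * p.2.1) * mode r (k * p.2.2)) := by
  have := continuous_mode l
  have := continuous_mode r
  fun_prop

theorem hasDerivAt_ker_left (m l r : ℕ) {t x y : ℝ} (ht : 0 < t) (hx : 0 < x) (hy : 0 ≤ y) :
    HasDerivAt (fun x => ker m l r t x y) (ker (m + 1) (l + 1) r t x y) x := by
  have key := hasDerivAt_integral_of_dominated_loc_of_deriv_le (μ := volume.restrict (Ioi 0))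
    (F := fun x k => k ^ m * Real.exp (-(k ^ 4 * t)) * (mode l (k * x) * mode r (k * y)))
    (F' := fun x k => k ^ (m + 1) * Real.exp (-(k ^ 4 * t)) *
      (mode (l + 1) (k * x) * mode r (k * y)))
    (bound := fun k => 9 * (k ^ (m + 1) * Real.exp (-(k ^ 4 * t)))) (Ioi_mem_nhds hx)
    (eventually_of_mem (Ioi_mem_nhds hx) fun z hz =>
      (integrableOn_ker m l r ht (le_of_lt hz) hy).aestronglyMeasurable)
    (integrableOn_ker m l r ht hx.le hy)
    (integrableOn_ker (m + 1) (l + 1) r ht hx.le hy).aestronglyMeasurable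
    ((ae_restrict_iff' measurableSet_Ioi).2 (Eventually.of_forall fun k hk z hz =>
      abs_ker_integrand_le (m + 1) (l + 1) r t (le_of_lt hz) hy hk))
    ((integrableOn_pow_mul_exp (m + 1) ht).const_mul 9)
    (Eventually.of_forall fun k z _ => by
      have h1 : HasDerivAt (fun z : ℝ => k * z) k z := by
        simpa using (hasDerivAt_id z).const_mul k
      have h2 := (((hasDerivAt_mode l (k * z)).comp z h1).mul_const (mode r (k * y))).const_mul
        (k ^ m * Real.exp (-(k ^ 4 * t)))
      refine h2.congr_deriv ?_
      ring)
  exact key.2.const_mul _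

theorem hasDerivAt_ker_right (m l r : ℕ) {t x y : ℝ} (ht : 0 < t) (hx : 0 ≤ x) (hy : 0 < y) :
    HasDerivAt (fun y => ker m l r t x y) (ker (m + 1) l (r + 1) t x y) y := by
  simp only [fun y => ker_symm m l r t x y, ker_symm (m + 1) l (r + 1) t x y]
  exact hasDerivAt_ker_left m r l ht hy hx

theorem hasDerivAt_ker_time (m l r : ℕ) {t x y : ℝ} (ht : 0 < t) (hx : 0 ≤ x) (hy : 0 ≤ y) :
    HasDerivAt (fun t => ker m l r t x y) (-ker (m + 4) l r t x y) t := by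
  have ht2 : 0 < t / 2 := by positivity
  have hlt : t / 2 < t := by linarith
  have key := hasDerivAt_integral_of_dominated_loc_of_deriv_le (μ := volume.restrict (Ioi 0))
    (F := fun t k => k ^ m * Real.exp (-(k ^ 4 * t)) * (mode l (k * x) * mode r (k * y)))
    (F' := fun t k => -(k ^ (m + 4) * Real.exp (-(k ^ 4 * t)) *
      (mode l (k * x) * mode r (k * y))))
    (bound := fun k => 9 * (k ^ (m + 4) * Real.exp (-(k ^ 4 * (t / 2))))) (Ioi_mem_nhds hlt)
    (eventually_of_mem (Ioi_mem_nhds ht) fun z hz =>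
      (integrableOn_ker m l r hz hx hy).aestronglyMeasurable)
    (integrableOn_ker m l r ht hx hy)
    (integrableOn_ker (m + 4) l r ht hx hy).neg.aestronglyMeasurable
    ((ae_restrict_iff' measurableSet_Ioi).2 (Eventually.of_forall fun k hk z hz => by
      rw [norm_neg]
      refine (abs_ker_integrand_le (m + 4) l r z hx hy hk).trans ?_
      have : (0 : ℝ) < k := hk
      have : t / 2 ≤ z := le_of_lt hz
      gcongr))
    ((integrableOn_pow_mul_exp (m + 4) ht2).const_mul 9)
    (Eventually.of_forall fun k z _ => by
      have h1 : HasDerivAt (fun z : ℝ => -(k ^ 4 * z)) (-(k ^ 4)) z := by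
        simpa using ((hasDerivAt_id z).const_mul (k ^ 4)).fun_neg
      have h2 := ((h1.exp).const_mul (k ^ m)).mul_const (mode l (k * x) * mode r (k * y))
      refine h2.congr_deriv ?_
      ring)
  have h3 := key.2.const_mul Real.pi⁻¹
  rw [integral_neg, mul_neg] at h3
  exact h3

theorem continuousOn_ker (m l r : ℕ) : ContinuousOn (fun p : ℝ × ℝ × ℝ => ker m l r p.1 p.2.1 p.2.2)
    (Ioi 0 ×ˢ Ici 0 ×ˢ Ici 0) := by
  have key : ∀ t0 : ℝ, 0 < t0 → ContinuousOn
      (fun p : ℝ × ℝ × ℝ => ker m l r p.1 p.2.1 p.2.2) (Ioi t0 ×ˢ Ici 0 ×ˢ Ici 0) := by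
    intro t0 ht0
    refine ContinuousOn.mul continuousOn_const ?_
    refine continuousOn_of_dominated (bound := fun k => 9 * (k ^ m * Real.exp (-(k ^ 4 * t0))))
      ?_ ?_ ((integrableOn_pow_mul_exp m ht0).const_mul 9) ?_
    · rintro ⟨t, x, y⟩ ⟨ht, hx, hy⟩
      exact (integrableOn_ker m l r (ht0.trans ht) hx hy).aestronglyMeasurable
    · rintro ⟨t, x, y⟩ ⟨ht, hx, hy⟩
      refine (ae_restrict_iff' measurableSet_Ioi).2 (Eventually.of_forall fun k hk => ?_)
      refine (abs_ker_integrand_le m l r t hx hy hk).trans ?_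
      have : (0 : ℝ) < k := hk
      have : t0 < t := ht
      gcongr
    · exact Eventually.of_forall fun k => (continuous_ker_integrand m l r k).continuousOn
  rintro ⟨t, x, y⟩ ⟨ht, hx, hy⟩
  have ht' : (0 : ℝ) < t := ht
  have ht2 : 0 < t / 2 := by positivity
  have hlt : t / 2 < t := by linarith
  refine ((key (t / 2) ht2) (t, x, y) ⟨hlt, hx, hy⟩).mono_of_mem_nhdsWithin ?_
  have : (Ioi (t / 2) ×ˢ (univ : Set (ℝ × ℝ))) ∈ 𝓝 (t, x, y) :=
    prod_mem_nhds (Ioi_mem_nhds hlt) univ_mem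
  refine mem_nhdsWithin_iff_exists_mem_nhds_inter.2 ⟨_, this, ?_⟩
  rintro ⟨a, b, c⟩ ⟨⟨h1, -⟩, -, h2⟩
  exact ⟨h1, h2⟩

/-! ### The mass of the translation invariant part -/

theorem integrableOn_Iic_of_comp_neg {E : Type*} [NormedAddCommGroup E] {f : ℝ → E}
    (h : IntegrableOn (fun x => f (-x)) (Ioi 0)) : IntegrableOn f (Iic 0) := by
  rw [integrableOn_Iic_iff_integrableOn_Iio]
  refine ((Measure.measurePreserving_neg (volume : Measure ℝ)).integrableOn_comp_preimage
    (Homeomorph.neg ℝ).measurableEmbedding).1 ?_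
  have e : (Neg.neg ⁻¹' Iio 0 : Set ℝ) = Ioi 0 := by ext; simp
  rw [e]
  exact h

theorem lap_conj (m : ℕ) (w : ℂ) : lap m ((starRingEnd ℂ) w) = (starRingEnd ℂ) (lap m w) := by
  rw [lap, lap, ← integral_conj]
  congr 1
  ext k
  simp only [map_mul, map_pow, Complex.conj_ofReal, ← Complex.exp_conj, map_neg]

/-- The two half-lines contribute `lap 0` at conjugate points, and the sum is twice a real part. -/
theorem fourier_exp_neg_pow_four (ξ : ℝ) :
    FourierTransform.fourier (fun k : ℝ => (Real.exp (-(k ^ 4)) : ℂ)) ξ =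
      (2 * kerMain 0 0 0 (2 * Real.pi * ξ) : ℝ) := by
  set w : ℂ := -(((2 * Real.pi * ξ : ℝ) : ℂ) * Complex.I) with hw
  have hw0 : 0 ≤ w.re := by simp [hw]
  have hc : (starRingEnd ℂ) w = -w := by
    rw [hw, map_neg, map_mul, Complex.conj_ofReal, Complex.conj_I, mul_neg]
  have hw1 : 0 ≤ (-w).re := by simp [hw]
  have i1 := integrableOn_lap 0 hw0
  have i2 := integrableOn_lap 0 hw1
  rw [Real.fourier_real_eq_integral_exp_smul]
  have e : ∀ k : ℝ, Complex.exp (((-2 * Real.pi * k * ξ : ℝ) : ℂ) * Complex.I) •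
      ((Real.exp (-(k ^ 4)) : ℝ) : ℂ) =
      (k : ℂ) ^ 0 * Complex.exp (-(k : ℂ) ^ 4) * Complex.exp (-(k * -w)) := by
    intro k
    rw [smul_eq_mul, mul_comm, hw]
    push_cast
    rw [pow_zero, one_mul]
    congr 2
    ring
  simp only [e]
  have e2 : ∀ k : ℝ, (k : ℂ) ^ 0 * Complex.exp (-(k : ℂ) ^ 4) * Complex.exp (-(k * w)) =
      (((-k : ℝ) : ℂ)) ^ 0 * Complex.exp (-((-k : ℝ) : ℂ) ^ 4) *
        Complex.exp (-((-k : ℝ) * -w)) := by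
    intro k
    push_cast
    rw [Even.neg_pow (by decide : Even 4)]
    simp
  have i3 : IntegrableOn (fun k : ℝ => (k : ℂ) ^ 0 * Complex.exp (-(k : ℂ) ^ 4) *
      Complex.exp (-(k * -w))) (Iic 0) := by
    refine integrableOn_Iic_of_comp_neg ?_
    exact i1.congr_fun (fun k _ => e2 k) measurableSet_Ioi
  rw [← intervalIntegral.integral_Iic_add_Ioi i3 i2]
  have h1 := integral_comp_neg_Ioi 0 (fun k : ℝ => (k : ℂ) ^ 0 * Complex.exp (-(k : ℂ) ^ 4) *
      Complex.exp (-(k * -w)))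
  rw [neg_zero] at h1
  rw [← h1]
  simp only [← e2]
  change lap 0 w + lap 0 (-w) = _
  rw [← hc, lap_conj, Complex.add_conj, kerMain, ← hw]
  simp

theorem continuous_kerMain (m l r : ℕ) : Continuous (kerMain m l r) := by
  have h : Continuous fun z : ℝ => lap m (-(z * Complex.I)) := by
    refine continuous_of_dominated
      (bound := fun k : ℝ => k ^ m * Real.exp (-(k ^ 4 * 1))) ?_ ?_
      (integrableOn_pow_mul_exp m one_pos) ?_
    · exact fun z => (integrableOn_lap m (by simp)).aestronglyMeasurable
    · exact fun z => (ae_restrict_iff' measurableSet_Ioi).2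
        (Eventually.of_forall fun k hk => norm_lap_integrand_le m (by simp) hk)
    · exact Eventually.of_forall fun k => by fun_prop
  exact Complex.continuous_re.comp (continuous_const.mul h)

theorem integrable_kerMain : Integrable (kerMain 0 0 0) := by
  obtain ⟨C, hC⟩ := abs_kerMain_le 0 0 0 rfl
  refine Integrable.mono' (integrable_inv_one_add_sq.const_mul C) ?_ (Eventually.of_forall hC)
  exact (continuous_kerMain 0 0 0).aestronglyMeasurable

theorem integrable_exp_neg_pow_four :
    Integrable (fun k : ℝ => (Real.exp (-(k ^ 4)) : ℂ)) := by
  refine Integrable.ofReal ?_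
  have h := integrableOn_pow_mul_exp 0 one_pos
  simp only [pow_zero, one_mul, mul_one] at h
  have h2 : IntegrableOn (fun k : ℝ => Real.exp (-(k ^ 4))) (Iic 0) := by
    refine integrableOn_Iic_of_comp_neg ?_
    refine h.congr_fun (fun k _ => ?_) measurableSet_Ioi
    simp only [Even.neg_pow (by decide : Even 4)]
  rw [← integrableOn_univ, ← Iic_union_Ioi (a := (0 : ℝ))]
  exact h2.union h

/-- Fourier inversion at the origin: the integral of the transform of `exp (-k ^ 4)` is its value
`1` at `0`. This normalization makes the kernel an approximate identity. -/
theorem integral_kerMain : ∫ z, kerMain 0 0 0 z = Real.pi := by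
  have hf : FourierTransform.fourier (fun k : ℝ => (Real.exp (-(k ^ 4)) : ℂ)) =
      fun ξ : ℝ => ((2 * kerMain 0 0 0 (2 * Real.pi * ξ) : ℝ) : ℂ) :=
    funext fourier_exp_neg_pow_four
  have hpi : 2 * Real.pi ≠ 0 := by positivity
  have hi : Integrable (FourierTransform.fourier (fun k : ℝ => (Real.exp (-(k ^ 4)) : ℂ))) := by
    rw [hf]
    exact ((integrable_kerMain.comp_mul_left' hpi).const_mul 2).ofReal
  have hcont : Continuous (fun k : ℝ => (Real.exp (-(k ^ 4)) : ℂ)) := by fun_prop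
  have key := integrable_exp_neg_pow_four.fourierInv_fourier_eq hi (v := 0) hcont.continuousAt
  rw [Real.fourierInv_eq', hf] at key
  simp only [inner_zero_right, mul_zero, Complex.ofReal_zero, zero_mul, Complex.exp_zero,
    one_smul] at key
  rw [integral_complex_ofReal, integral_const_mul, Measure.integral_comp_mul_left] at key
  simp only [smul_eq_mul] at key
  norm_num at key
  have h3 : (2 * (|Real.pi|⁻¹ * (1 / 2) * ∫ z, kerMain 0 0 0 z) : ℝ) = 1 := by
    apply Complex.ofReal_injective
    push_cast
    exact key
  rw [abs_of_pos Real.pi_pos] at h3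
  have := Real.pi_pos
  field_simp at h3
  linarith

open scoped BoundedContinuousFunction

section

/-! ### Bounded continuous functions, optionally integrable on the half-line -/

/-- The measure giving the integrability condition: Lebesgue measure on `[0, ∞)`, or zero. -/
def meas : Bool → Measure ℝ
  | true => volume.restrict (Ici 0)
  | false => 0

/-- Bounded continuous functions which are integrable for `meas β`. -/
def bcSub (β : Bool) : Submodule ℝ ((ℝ →ᵇ ℝ) × Lp ℝ 1 (meas β)) where
  carrier := {p | p.2 =ᵐ[meas β] p.1}
  add_mem' {a b} ha hb := by
    change ((a.2 + b.2 : Lp ℝ 1 (meas β)) : ℝ → ℝ) =ᵐ[meas β] ⇑(a.1 + b.1)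
    filter_upwards [Lp.coeFn_add a.2 b.2, ha, hb] with x h1 h2 h3
    refine h1.trans ?_
    rw [Pi.add_apply, h2, h3, BoundedContinuousFunction.coe_add, Pi.add_apply]
  zero_mem' := by
    change ((0 : Lp ℝ 1 (meas β)) : ℝ → ℝ) =ᵐ[meas β] ⇑(0 : ℝ →ᵇ ℝ)
    filter_upwards [Lp.coeFn_zero ℝ 1 (meas β)] with x h1
    exact h1
  smul_mem' c a ha := by
    change ((c • a.2 : Lp ℝ 1 (meas β)) : ℝ → ℝ) =ᵐ[meas β] ⇑(c • a.1)
    filter_upwards [Lp.coeFn_smul c a.2, ha] with x h1 h2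
    refine h1.trans ?_
    rw [Pi.smul_apply, h2, BoundedContinuousFunction.coe_smul]

/-- A sequence converging in L¹ has a subsequence converging almost everywhere, whose limit must be
the uniform limit of the continuous representatives. -/
theorem isClosed_bcSub (β : Bool) : IsClosed (bcSub β : Set ((ℝ →ᵇ ℝ) × Lp ℝ 1 (meas β))) := by
  refine IsSeqClosed.isClosed fun u p hu hp => ?_
  have h1 : Tendsto (fun n => (u n).1) atTop (𝓝 p.1) := (continuous_fst.tendsto p).comp hp
  have h2 : Tendsto (fun n => (u n).2) atTop (𝓝 p.2) := (continuous_snd.tendsto p).comp hp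
  obtain ⟨ns, hns, hae⟩ := (tendstoInMeasure_of_tendsto_Lp h2).exists_seq_tendsto_ae
  have hall : ∀ᵐ x ∂(meas β), ∀ n, (u n).2 x = (u n).1 x := ae_all_iff.2 fun n => hu n
  change p.2 =ᵐ[meas β] p.1
  filter_upwards [hae, hall] with x hx1 hx2
  refine tendsto_nhds_unique hx1 ?_
  simp only [hx2]
  exact (BoundedContinuousFunction.tendsto_iff_tendstoUniformly.1
    (h1.comp hns.tendsto_atTop)).tendsto_at x

/-- The Banach space of bounded continuous functions which are integrable for `meas β`. -/
def BC (β : Bool) : Type := bcSub β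

instance (β : Bool) : NormedAddCommGroup (BC β) := inferInstanceAs (NormedAddCommGroup (bcSub β))

instance (β : Bool) : NormedSpace ℝ (BC β) := inferInstanceAs (NormedSpace ℝ (bcSub β))

instance (β : Bool) : CompleteSpace (BC β) := (isClosed_bcSub β).completeSpace_coe

variable {β : Bool}

def toC : BC β →L[ℝ] (ℝ →ᵇ ℝ) :=
  ((ContinuousLinearMap.fst ℝ (ℝ →ᵇ ℝ) (Lp ℝ 1 (meas β))).comp (bcSub β).subtypeL :
    bcSub β →L[ℝ] (ℝ →ᵇ ℝ))

theorem toC_ae (f : BC β) : f.1.2 =ᵐ[meas β] toC f := f.2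

theorem integrable_toC (f : BC β) : Integrable (toC f) (meas β) :=
  (L1.integrable_coeFn f.1.2).congr (toC_ae f)

def mkBC (f : ℝ →ᵇ ℝ) (hf : Integrable f (meas β)) : BC β :=
  ⟨(f, hf.toL1 f), hf.coeFn_toL1⟩

@[simp] theorem toC_mkBC (f : ℝ →ᵇ ℝ) (hf : Integrable f (meas β)) : toC (mkBC f hf) = f := rfl

theorem BC.ext {f g : BC β} (h : ∀ x, toC f x = toC g x) : f = g := by
  have h1 : toC f = toC g := BoundedContinuousFunction.ext h
  refine Subtype.ext (Prod.ext h1 ?_)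
  refine Lp.ext ((toC_ae f).trans ?_)
  rw [h1]
  exact (toC_ae g).symm

theorem norm_BC_snd (f : BC β) : ‖f.1.2‖ = ∫ x, |toC f x| ∂(meas β) := by
  rw [L1.norm_eq_integral_norm]
  refine integral_congr_ae ?_
  filter_upwards [toC_ae f] with x hx
  rw [hx, Real.norm_eq_abs]

theorem abs_toC_le (f : BC β) (x : ℝ) : |toC f x| ≤ ‖f‖ :=
  ((toC f).norm_coe_le_norm x).trans (norm_fst_le f.1)

theorem integral_abs_toC_le (f : BC β) : ∫ x, |toC f x| ∂(meas β) ≤ ‖f‖ :=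
  (norm_BC_snd f).symm.le.trans (norm_snd_le f.1)

theorem norm_BC_le {f : BC β} {C : ℝ} (hC : 0 ≤ C) (h1 : ∀ x, |toC f x| ≤ C)
    (h2 : ∫ x, |toC f x| ∂(meas β) ≤ C) : ‖f‖ ≤ C := by
  change ‖f.1‖ ≤ C
  rw [Prod.norm_def]
  refine max_le ?_ ?_
  · exact (BoundedContinuousFunction.norm_le (f := toC f) hC).2 h1
  · rw [norm_BC_snd]; exact h2

/-- Multiplication by a bounded continuous function. -/
def mulBC : (ℝ →ᵇ ℝ) →L[ℝ] BC β →L[ℝ] BC β :=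
  LinearMap.mkContinuous₂ (LinearMap.mk₂ ℝ
    (fun f g => mkBC (f * toC g) ((integrable_toC g).bdd_mul (c := ‖f‖)
      f.continuous.aestronglyMeasurable (Eventually.of_forall f.norm_coe_le_norm)))
    (fun f f' g => BC.ext fun x => by simp [add_mul])
    (fun c f g => BC.ext fun x => by simp [mul_assoc])
    (fun f g g' => BC.ext fun x => by simp [mul_add])
    (fun c f g => BC.ext fun x => by simp; ring)) 1 (by
    intro f g
    simp only [LinearMap.mk₂_apply, one_mul]
    refine norm_BC_le (by positivity) (fun x => ?_) ?_
    · simp only [toC_mkBC, BoundedContinuousFunction.coe_mul, Pi.mul_apply, abs_mul]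
      exact mul_le_mul (f.norm_coe_le_norm x) (abs_toC_le g x) (abs_nonneg _) (norm_nonneg _)
    · simp only [toC_mkBC, BoundedContinuousFunction.coe_mul, Pi.mul_apply, abs_mul]
      calc _ ≤ ∫ x, ‖f‖ * |toC g x| ∂(meas β) := by
            refine integral_mono_of_nonneg (Eventually.of_forall fun x => by positivity)
              ((integrable_toC g).abs.const_mul _) (Eventually.of_forall fun x => ?_)
            exact mul_le_mul_of_nonneg_right (f.norm_coe_le_norm x) (abs_nonneg _)
        _ ≤ _ := by
            rw [integral_const_mul]
            gcongr
            exact integral_abs_toC_le g)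

@[simp] theorem toC_mulBC (f : ℝ →ᵇ ℝ) (g : BC β) (x : ℝ) : toC (mulBC f g) x = f x * toC g x := rfl

/-- Forgetting the integrability. -/
def forget : BC β →L[ℝ] BC false :=
  LinearMap.mkContinuous
    { toFun := fun f => mkBC (toC f) (integrable_zero_measure)
      map_add' := fun f g => BC.ext fun x => by rw [map_add]; rfl
      map_smul' := fun c f => BC.ext fun x => by rw [map_smul]; rfl } 1 (by
    intro f
    rw [one_mul]
    refine norm_BC_le (norm_nonneg _) (fun x => abs_toC_le f x) ?_
    simp [meas])

@[simp] theorem toC_forget (f : BC β) : toC (forget f) = toC f := rfl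

theorem abs_primitive_le (f : BC true) (x : ℝ) : ‖∫ z in (0 : ℝ)..(max x 0), toC f z‖ ≤ ‖f‖ := by
  rw [intervalIntegral.integral_of_le (le_max_right _ _)]
  refine (norm_integral_le_integral_norm _).trans ((le_trans ?_ (integral_abs_toC_le f)))
  refine setIntegral_mono_set (integrable_toC f).abs
    (Eventually.of_forall fun x => abs_nonneg _) ?_
  exact (Ioc_subset_Ioi_self.trans Ioi_subset_Ici_self).eventuallyLE

/-- The primitive `x ↦ ∫₀^x f` on `[0, ∞)`, extended by `0`. -/
def prim : BC true →L[ℝ] (ℝ →ᵇ ℝ) :=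
  LinearMap.mkContinuous
    { toFun := fun f => BoundedContinuousFunction.ofNormedAddCommGroup
        (fun x => ∫ z in (0 : ℝ)..(max x 0), toC f z)
        ((intervalIntegral.continuous_primitive (fun a b => (toC f).continuous.intervalIntegrable a b)
          0).comp (continuous_id.max continuous_const)) (‖f‖) (abs_primitive_le f)
      map_add' := fun f g => by
        ext x
        simp only [map_add, BoundedContinuousFunction.coe_add,
          BoundedContinuousFunction.coe_ofNormedAddCommGroup, Pi.add_apply]
        exact intervalIntegral.integral_add ((toC f).continuous.intervalIntegrable _ _)
          ((toC g).continuous.intervalIntegrable _ _)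
      map_smul' := fun c f => by
        ext x
        simp only [map_smul]
        exact intervalIntegral.integral_const_mul c _ } 1 (by
    intro f
    rw [one_mul]
    exact (BoundedContinuousFunction.norm_le (norm_nonneg f)).2 fun x => abs_primitive_le f x)

theorem prim_apply (f : BC true) {x : ℝ} (hx : 0 ≤ x) : prim f x = ∫ z in (0 : ℝ)..x, toC f z := by
  change ∫ z in (0 : ℝ)..(max x 0), toC f z = _
  rw [max_eq_left hx]

theorem prim_zero (f : BC true) : prim f 0 = 0 := by
  rw [prim_apply f le_rfl, intervalIntegral.integral_same]

theorem hasDerivAt_prim (f : BC true) {x : ℝ} (hx : 0 < x) : HasDerivAt (prim f) (toC f x) x := by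
  refine (((toC f).continuous.integral_hasStrictDerivAt 0 x).hasDerivAt).congr_of_eventuallyEq ?_
  filter_upwards [Ioi_mem_nhds hx] with y hy
  exact prim_apply f (le_of_lt hy)

/-- Extension of a function on the half-line, constant to the left of `0`. -/
def extC (f : ℝ → ℝ) (hf : ContinuousOn f (Ici 0)) (C : ℝ) (hC : ∀ y, 0 ≤ y → |f y| ≤ C) :
    ℝ →ᵇ ℝ :=
  BoundedContinuousFunction.ofNormedAddCommGroup (fun x => f (max x 0))
    (hf.comp_continuous (continuous_id.max continuous_const) fun x => le_max_right x 0) C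
    (fun x => hC _ (le_max_right x 0))

theorem extC_apply (f : ℝ → ℝ) (hf : ContinuousOn f (Ici 0)) (C : ℝ)
    (hC : ∀ y, 0 ≤ y → |f y| ≤ C) {x : ℝ} (hx : 0 ≤ x) : extC f hf C hC x = f x := by
  change f (max x 0) = f x
  rw [max_eq_left hx]

end

section

variable {β : Bool}

/-! ### Integral operators on the half-line -/

def cauchyW (q z : ℝ) : ℝ := q⁻¹ * (1 + (z / q) ^ 2)⁻¹

theorem cauchyW_nonneg {q : ℝ} (hq : 0 < q) (z : ℝ) : 0 ≤ cauchyW q z := by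
  unfold cauchyW; positivity

theorem integrable_cauchyW {q : ℝ} (hq : 0 < q) : Integrable (cauchyW q) :=
  (integrable_inv_one_add_sq.comp_div hq.ne').const_mul _

theorem integral_cauchyW {q : ℝ} (hq : 0 < q) : ∫ z, cauchyW q z = Real.pi := by
  simp only [cauchyW]
  rw [integral_const_mul, Measure.integral_comp_div (fun z : ℝ => (1 + z ^ 2)⁻¹),
    integral_univ_inv_one_add_sq, abs_of_pos hq, smul_eq_mul, inv_mul_cancel_left₀ hq.ne']

/-- Lets the weight centred at one point dominate those centred within distance `q`, as needed for
dominated convergence in `x`. The constant comes from `1 + b² ≤ 3 (1 + a²)` when `|a - b| ≤ 1`. -/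
theorem cauchyW_le_shift {q : ℝ} (hq : 0 < q) {a b : ℝ} (h : |a - b| ≤ q) :
    cauchyW q a ≤ 3 * cauchyW q b := by
  unfold cauchyW
  have h1 : |a / q - b / q| ≤ 1 := by
    rw [← sub_div, abs_div, abs_of_pos hq]
    exact div_le_one_of_le₀ h hq.le
  generalize a / q = a at *
  generalize b / q = b at *
  have h2 : (1 + a ^ 2)⁻¹ ≤ 3 * (1 + b ^ 2)⁻¹ := by
    rw [← div_eq_mul_inv, inv_eq_one_div, div_le_div_iff₀ (by positivity) (by positivity)]
    rw [abs_le] at h1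
    nlinarith [sq_nonneg (a + (a - b)), mul_nonneg (sub_nonneg.2 h1.1) (sub_nonneg.2 h1.2)]
  calc _ ≤ q⁻¹ * (3 * (1 + b ^ 2)⁻¹) := by gcongr
    _ = _ := by ring

/-- `k` is dominated on the half-line by `C` times a Cauchy weight of width `q`. -/
def KerBound (k : ℝ → ℝ → ℝ) (C q : ℝ) : Prop :=
  ∀ x y, 0 ≤ x → 0 ≤ y → |k x y| ≤ C * cauchyW q (x - y)

structure GoodKer (k : ℝ → ℝ → ℝ) : Prop where
  cont : ContinuousOn (fun p : ℝ × ℝ => k p.1 p.2) (Ici 0 ×ˢ Ici 0)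
  bound : ∃ C q : ℝ, 0 ≤ C ∧ 0 < q ∧ KerBound k C q

/-- The integral operator with kernel `k`, extended constantly to the left of `0`. -/
def opFun (k : ℝ → ℝ → ℝ) (f : ℝ → ℝ) (x : ℝ) : ℝ := ∫ y in Ici 0, k (max x 0) y * f y

theorem opFun_of_nonneg (k : ℝ → ℝ → ℝ) (f : ℝ → ℝ) {x : ℝ} (hx : 0 ≤ x) :
    opFun k f x = ∫ y in Ici 0, k x y * f y := by
  rw [opFun, max_eq_left hx]

theorem integrable_cauchyW_sub {q : ℝ} (hq : 0 < q) (x : ℝ) (s : Set ℝ) :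
    IntegrableOn (fun y => cauchyW q (x - y)) s :=
  ((integrable_cauchyW hq).comp_sub_left x).integrableOn

theorem setIntegral_cauchyW_sub_le {q : ℝ} (hq : 0 < q) (x : ℝ) :
    ∫ y in Ici 0, cauchyW q (x - y) ≤ Real.pi := by
  refine (setIntegral_le_integral ((integrable_cauchyW hq).comp_sub_left x)
    (Eventually.of_forall fun y => cauchyW_nonneg hq _)).trans ?_
  rw [integral_sub_left_eq_self (cauchyW q), integral_cauchyW hq]

theorem GoodKer.aesm {k : ℝ → ℝ → ℝ} (hk : GoodKer k) {x : ℝ} (hx : 0 ≤ x) (f : ℝ →ᵇ ℝ) :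
    AEStronglyMeasurable (fun y => k x y * f y) (volume.restrict (Ici 0)) := by
  have h1 : ContinuousOn (fun y => k x y) (Ici 0) :=
    hk.cont.comp (by fun_prop : Continuous fun y : ℝ => (x, y)).continuousOn
      (fun y hy => ⟨hx, hy⟩)
  exact (h1.mul f.continuous.continuousOn).aestronglyMeasurable measurableSet_Ici

theorem KerBound.integrand_le {k : ℝ → ℝ → ℝ} {C q : ℝ} (hb : KerBound k C q) (f : ℝ →ᵇ ℝ)
    {x y : ℝ} (hx : 0 ≤ x) (hy : 0 ≤ y) : ‖k x y * f y‖ ≤ C * ‖f‖ * cauchyW q (x - y) := by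
  rw [norm_mul]
  calc _ ≤ C * cauchyW q (x - y) * ‖f‖ :=
        mul_le_mul (hb x y hx hy) (f.norm_coe_le_norm y) (norm_nonneg _)
          ((abs_nonneg _).trans (hb x y hx hy))
    _ = _ := by ring

theorem GoodKer.integrable {k : ℝ → ℝ → ℝ} (hk : GoodKer k) {x : ℝ} (hx : 0 ≤ x) (f : ℝ →ᵇ ℝ) :
    IntegrableOn (fun y => k x y * f y) (Ici 0) := by
  obtain ⟨C, q, -, hq, hb⟩ := hk.bound
  exact Integrable.mono' ((integrable_cauchyW_sub hq x _).const_mul (C * ‖f‖)) (hk.aesm hx f)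
    ((ae_restrict_iff' measurableSet_Ici).2 (Eventually.of_forall fun y hy =>
      hb.integrand_le f hx hy))

theorem GoodKer.abs_opFun_le {k : ℝ → ℝ → ℝ} {C q : ℝ} (hC : 0 ≤ C) (hq : 0 < q)
    (hb : KerBound k C q) (f : ℝ →ᵇ ℝ) (x : ℝ) : |opFun k f x| ≤ C * Real.pi * ‖f‖ := by
  have h1 : ‖opFun k f x‖ ≤ ∫ y in Ici 0, C * ‖f‖ * cauchyW q (max x 0 - y) :=
    norm_integral_le_of_norm_le ((integrable_cauchyW_sub hq (max x 0) _).const_mul (C * ‖f‖))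
      ((ae_restrict_iff' measurableSet_Ici).2 (Eventually.of_forall fun y hy =>
        hb.integrand_le f (le_max_right _ _) hy))
  rw [integral_const_mul] at h1
  refine h1.trans ?_
  calc _ ≤ C * ‖f‖ * Real.pi := by gcongr; exact setIntegral_cauchyW_sub_le hq _
    _ = _ := by ring

theorem GoodKer.continuousOn {k : ℝ → ℝ → ℝ} (hk : GoodKer k) (f : ℝ →ᵇ ℝ) :
    ContinuousOn (fun x => ∫ y in Ici 0, k x y * f y) (Ici 0) := by
  obtain ⟨C, q, hC, hq, hb⟩ := hk.bound
  intro x0 hx0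
  have hmem : Ici 0 ∩ Metric.closedBall x0 q ∈ 𝓝[Ici 0] x0 :=
    inter_mem self_mem_nhdsWithin (mem_nhdsWithin_of_mem_nhds (Metric.closedBall_mem_nhds x0 hq))
  refine continuousWithinAt_of_dominated
    (bound := fun y => C * ‖f‖ * (3 * cauchyW q (x0 - y))) ?_ ?_ ?_ ?_
  · filter_upwards [self_mem_nhdsWithin] with x hx using hk.aesm hx f
  · filter_upwards [hmem] with x hx
    refine (ae_restrict_iff' measurableSet_Ici).2 (Eventually.of_forall fun y hy => ?_)
    refine (hb.integrand_le f hx.1 hy).trans ?_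
    gcongr
    refine cauchyW_le_shift hq ?_
    have := hx.2
    rw [Metric.mem_closedBall, Real.dist_eq] at this
    simpa using this
  · exact ((integrable_cauchyW_sub hq x0 _).const_mul 3).const_mul _
  · refine (ae_restrict_iff' measurableSet_Ici).2 (Eventually.of_forall fun y hy => ?_)
    have h1 : ContinuousOn (fun x => k x y) (Ici 0) :=
      hk.cont.comp (by fun_prop : Continuous fun x : ℝ => (x, y)).continuousOn
        (fun x hx => ⟨hx, hy⟩)
    exact (h1 x0 hx0).mul continuousWithinAt_const

theorem GoodKer.continuous {k : ℝ → ℝ → ℝ} (hk : GoodKer k) (f : ℝ →ᵇ ℝ) :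
    Continuous (opFun k f) :=
  (hk.continuousOn f).comp_continuous (continuous_id.max continuous_const)
    fun x => le_max_right x 0

/-- The L¹ half of Schur's test: Tonelli's theorem, together with a bounding weight that is
symmetric in `x` and `y`. -/
theorem GoodKer.lintegral_opFun_le {k : ℝ → ℝ → ℝ} (hk : GoodKer k) {C q : ℝ} (hC : 0 ≤ C)
    (hq : 0 < q) (hb : KerBound k C q) (f : ℝ → ℝ)
    (hf : AEStronglyMeasurable f (volume.restrict (Ici 0))) :
    ∫⁻ x in Ici 0, ‖opFun k f x‖ₑ ≤ ENNReal.ofReal (C * Real.pi) * ∫⁻ y in Ici 0, ‖f y‖ₑ := by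
  have hmeas : AEMeasurable (fun p : ℝ × ℝ => ‖k p.1 p.2‖ₑ * ‖f p.2‖ₑ)
      ((volume.restrict (Ici 0)).prod (volume.restrict (Ici 0))) := by
    have h1 : AEStronglyMeasurable (fun p : ℝ × ℝ => k p.1 p.2)
        ((volume.restrict (Ici 0)).prod (volume.restrict (Ici 0))) := by
      rw [Measure.prod_restrict]
      exact hk.cont.aestronglyMeasurable (measurableSet_Ici.prod measurableSet_Ici)
    exact h1.enorm.mul (hf.comp_snd).enorm
  calc _ ≤ ∫⁻ x in Ici 0, ∫⁻ y in Ici 0, ‖k x y‖ₑ * ‖f y‖ₑ := by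
        refine setLIntegral_mono' measurableSet_Ici fun x hx => ?_
        rw [opFun_of_nonneg k f hx]
        refine (enorm_integral_le_lintegral_enorm _).trans_eq ?_
        simp only [enorm_mul]
    _ = ∫⁻ y in Ici 0, ∫⁻ x in Ici 0, ‖k x y‖ₑ * ‖f y‖ₑ :=
        lintegral_lintegral_swap hmeas
    _ ≤ ∫⁻ y in Ici 0, ENNReal.ofReal (C * Real.pi) * ‖f y‖ₑ := by
        refine setLIntegral_mono' measurableSet_Ici fun y hy => ?_
        rw [lintegral_mul_const' _ _ enorm_ne_top]
        gcongr
        calc _ ≤ ∫⁻ x in Ici 0, ENNReal.ofReal (C * cauchyW q (y - x)) := by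
              refine setLIntegral_mono' measurableSet_Ici fun x hx => ?_
              rw [Real.enorm_eq_ofReal_abs]
              refine ENNReal.ofReal_le_ofReal ((hb x y hx hy).trans_eq ?_)
              simp only [cauchyW, div_pow, sub_sq_comm x y]
          _ = ENNReal.ofReal (∫ x in Ici 0, C * cauchyW q (y - x)) := by
              rw [ofReal_integral_eq_lintegral_ofReal]
              · exact (integrable_cauchyW_sub hq y _).const_mul _
              · exact Eventually.of_forall fun x => mul_nonneg hC (cauchyW_nonneg hq _)
          _ ≤ _ := by
              refine ENNReal.ofReal_le_ofReal ?_
              rw [integral_const_mul]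
              gcongr
              exact setIntegral_cauchyW_sub_le hq y
    _ = _ := lintegral_const_mul' _ _ ENNReal.ofReal_ne_top

def opC (k : ℝ → ℝ → ℝ) (hk : GoodKer k) (f : ℝ →ᵇ ℝ) : ℝ →ᵇ ℝ :=
  BoundedContinuousFunction.ofNormedAddCommGroup (opFun k f) (hk.continuous f)
    (hk.bound.choose * Real.pi * ‖f‖) fun x =>
      GoodKer.abs_opFun_le hk.bound.choose_spec.choose_spec.1
        hk.bound.choose_spec.choose_spec.2.1 hk.bound.choose_spec.choose_spec.2.2 f x

theorem integrable_opC (k : ℝ → ℝ → ℝ) (hk : GoodKer k) (f : BC β) :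
    Integrable (opC k hk (toC f)) (meas β) := by
  cases β with
  | false => exact integrable_zero_measure
  | true =>
    refine ⟨(opC k hk (toC f)).continuous.aestronglyMeasurable, ?_⟩
    obtain ⟨C, q, hC, hq, hb⟩ := hk.bound
    refine (hk.lintegral_opFun_le hC hq hb (toC f)
      (toC f).continuous.aestronglyMeasurable).trans_lt ?_
    exact ENNReal.mul_lt_top ENNReal.ofReal_lt_top (integrable_toC f).2

theorem integral_abs_opC_le (k : ℝ → ℝ → ℝ) (hk : GoodKer k) {C q : ℝ} (hC : 0 ≤ C)
    (hq : 0 < q) (hb : KerBound k C q) (f : BC β) :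
    ∫ x, |opC k hk (toC f) x| ∂(meas β) ≤ C * Real.pi * ‖f‖ := by
  cases β with
  | false => simp only [meas, integral_zero_measure]; positivity
  | true =>
    have h1 := hk.lintegral_opFun_le hC hq hb (toC f) (toC f).continuous.aestronglyMeasurable
    have h2 : ∫⁻ y in Ici 0, ‖toC f y‖ₑ = ENNReal.ofReal (∫ x, |toC f x| ∂(meas true)) :=
      (ofReal_integral_norm_eq_lintegral_enorm (integrable_toC f)).symm
    have h3 : ∫⁻ y in Ici 0, ‖opFun k (toC f) y‖ₑ =
        ENNReal.ofReal (∫ x, |opC k hk (toC f) x| ∂(meas true)) :=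
      (ofReal_integral_norm_eq_lintegral_enorm (integrable_opC k hk f)).symm
    rw [h2, h3, ← ENNReal.ofReal_mul (by positivity), ENNReal.ofReal_le_ofReal_iff (by
      have : 0 ≤ ∫ x, |toC f x| ∂(meas true) := integral_nonneg fun x => abs_nonneg _
      positivity)] at h1
    refine h1.trans ?_
    gcongr
    exact integral_abs_toC_le f

theorem norm_opBC_le (k : ℝ → ℝ → ℝ) (hk : GoodKer k) {C q : ℝ} (hC : 0 ≤ C)
    (hq : 0 < q) (hb : KerBound k C q) (f : BC β) :
    ‖mkBC (opC k hk (toC f)) (integrable_opC k hk f)‖ ≤ C * Real.pi * ‖f‖ := by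
  refine norm_BC_le (by positivity) (fun x => ?_) (integral_abs_opC_le k hk hC hq hb f)
  refine (GoodKer.abs_opFun_le hC hq hb (toC f) x).trans ?_
  gcongr
  exact norm_fst_le f.1

theorem opFun_add {k : ℝ → ℝ → ℝ} (hk : GoodKer k) (f g : ℝ →ᵇ ℝ) (x : ℝ) :
    opFun k (f + g) x = opFun k f x + opFun k g x := by
  rw [opFun, opFun, opFun, ← integral_add (hk.integrable (le_max_right _ _) f)
    (hk.integrable (le_max_right _ _) g)]
  simp [mul_add]

theorem opFun_smul (k : ℝ → ℝ → ℝ) (c : ℝ) (f : ℝ → ℝ) (x : ℝ) :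
    opFun k (c • f) x = c * opFun k f x := by
  rw [opFun, opFun, ← integral_const_mul]
  congr 1
  ext y
  simp
  ring

open Classical in
/-- The bounded operator with kernel `k`, zero for bad kernels. -/
def op (β : Bool) (k : ℝ → ℝ → ℝ) : BC β →L[ℝ] BC β :=
  if hk : GoodKer k then
    LinearMap.mkContinuous
      { toFun := fun f => mkBC (opC k hk (toC f)) (integrable_opC k hk f)
        map_add' := fun f g => BC.ext fun x => by
          exact opFun_add hk (toC f) (toC g) x
        map_smul' := fun c f => BC.ext fun x => by
          exact opFun_smul k c (toC f) x } (hk.bound.choose * Real.pi) (fun f =>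
      norm_opBC_le k hk hk.bound.choose_spec.choose_spec.1
        hk.bound.choose_spec.choose_spec.2.1 hk.bound.choose_spec.choose_spec.2.2 f)
  else 0

theorem toC_op {k : ℝ → ℝ → ℝ} (hk : GoodKer k) (f : BC β) (x : ℝ) :
    toC (op β k f) x = opFun k (toC f) x := by
  rw [op, dif_pos hk]; rfl

theorem norm_op_le {k : ℝ → ℝ → ℝ} (hk : GoodKer k) {C q : ℝ} (hC : 0 ≤ C)
    (hq : 0 < q) (hb : KerBound k C q) : ‖op β k‖ ≤ C * Real.pi := by
  refine ContinuousLinearMap.opNorm_le_bound _ (by positivity) fun f => ?_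
  rw [op, dif_pos hk]
  exact norm_opBC_le k hk hC hq hb f

theorem forget_op {k : ℝ → ℝ → ℝ} (hk : GoodKer k) (f : BC β) :
    forget (op β k f) = op false k (forget f) :=
  BC.ext fun x => by rw [toC_forget, toC_op hk, toC_op hk, toC_forget]

theorem GoodKer.sub {k k' : ℝ → ℝ → ℝ} (hk : GoodKer k) (hk' : GoodKer k') {C q : ℝ} (hC : 0 ≤ C)
    (hq : 0 < q) (hb : KerBound (fun x y => k x y - k' x y) C q) :
    GoodKer (fun x y => k x y - k' x y) :=
  ⟨hk.cont.sub hk'.cont, C, q, hC, hq, hb⟩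

theorem op_sub {k k' : ℝ → ℝ → ℝ} (hk : GoodKer k) (hk' : GoodKer k')
    (hs : GoodKer (fun x y => k x y - k' x y)) :
    op β k - op β k' = op β (fun x y => k x y - k' x y) := by
  ext1 f
  refine BC.ext fun x => ?_
  rw [sub_apply, map_sub, BoundedContinuousFunction.coe_sub, Pi.sub_apply,
    toC_op hk, toC_op hk', toC_op hs, opFun, opFun, opFun,
    ← integral_sub (hk.integrable (le_max_right _ _) _) (hk'.integrable (le_max_right _ _) _)]
  simp only [sub_mul]

end

section

variable {β : Bool}

/-! ### The operator families `T e j t` -/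

/-- The kernel of `∂_x ^ j` applied to the evolution of `e`-th derivatives. -/
def kT (e j : ℕ) (t x y : ℝ) : ℝ := (-1) ^ e * ker j (e + j) (3 * e) t x y

theorem abs_kT (e j : ℕ) (t x y : ℝ) : |kT e j t x y| = |ker j (e + j) (3 * e) t x y| := by
  rw [kT, abs_mul, abs_pow, abs_neg, abs_one, one_pow, one_mul]

theorem ker_add_four_left (m l r : ℕ) (t x y : ℝ) : ker m (l + 4) r t x y = ker m l r t x y := by
  simp only [ker, mode_add_four]

theorem ker_add_four_right (m l r : ℕ) (t x y : ℝ) : ker m l (r + 4) t x y = ker m l r t x y := by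
  simp only [ker, mode_add_four]

theorem exists_kerBound_kT (e j : ℕ) : ∃ C : ℝ, 0 ≤ C ∧ ∀ q : ℝ, 0 < q →
    KerBound (kT e j (q ^ 4)) (C * q⁻¹ ^ j) q := by
  obtain ⟨C, hC, h⟩ := abs_ker_le j (e + j) (3 * e) (by omega)
  exact ⟨C, hC, fun q hq x y hx hy => by rw [abs_kT]; exact h q x y hq hx hy⟩

/-- One weight serves a whole range of times, since `p / (p² + z²) ≤ 2 q / (q² + z²)` for `q ≤ p ≤ 2
q`. This gives the domination required for differentiating in time. -/
theorem exists_kerBound_kT_Icc (e j : ℕ) : ∃ C : ℝ, 0 ≤ C ∧ ∀ q : ℝ, 0 < q →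
    ∀ t ∈ Icc (q ^ 4) ((2 * q) ^ 4), KerBound (kT e j t) (C * q⁻¹ ^ j) q := by
  obtain ⟨C, hC, h⟩ := exists_kerBound_kT e j
  refine ⟨2 * C, by positivity, fun q hq t ht x y hx hy => ?_⟩
  have ht0 : 0 < t := lt_of_lt_of_le (by positivity) ht.1
  obtain ⟨p, hp, rfl⟩ : ∃ p : ℝ, 0 < p ∧ p ^ 4 = t := by
    refine ⟨t ^ (1 / 4 : ℝ), by positivity, ?_⟩
    rw [← Real.rpow_natCast, ← Real.rpow_mul ht0.le]; norm_num
  have h1 : q ≤ p := le_of_pow_le_pow_left₀ (by norm_num) hp.le ht.1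
  have h2 : p ≤ 2 * q := le_of_pow_le_pow_left₀ (by norm_num) (by positivity) ht.2
  refine (h p hp x y hx hy).trans ?_
  have h3 : cauchyW p (x - y) ≤ 2 * cauchyW q (x - y) := by
    generalize x - y = z
    have e1 : ∀ s : ℝ, 0 < s → cauchyW s z = s / (s ^ 2 + z ^ 2) := by
      intro s hs
      rw [cauchyW]; field_simp
    rw [e1 p hp, e1 q hq, ← mul_div_assoc, div_le_div_iff₀ (by positivity) (by positivity)]
    calc p * (q ^ 2 + z ^ 2) ≤ 2 * q * (p ^ 2 + z ^ 2) := by gcongr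
      _ = _ := rfl
  have h4 : p⁻¹ ^ j ≤ q⁻¹ ^ j := by gcongr
  calc C * p⁻¹ ^ j * cauchyW p (x - y) ≤ C * q⁻¹ ^ j * (2 * cauchyW q (x - y)) := by
        gcongr
        exact cauchyW_nonneg hp _
    _ = _ := by ring

theorem continuousOn_kT (e j : ℕ) {t : ℝ} (ht : 0 < t) :
    ContinuousOn (fun p : ℝ × ℝ => kT e j t p.1 p.2) (Ici 0 ×ˢ Ici 0) :=
  continuousOn_const.mul ((continuousOn_ker j (e + j) (3 * e)).comp
    (by fun_prop : Continuous fun p : ℝ × ℝ => (t, p.1, p.2)).continuousOn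
    fun _ hp => ⟨ht, hp.1, hp.2⟩)

theorem exists_fourth_root {t : ℝ} (ht : 0 < t) : ∃ p : ℝ, 0 < p ∧ p ^ 4 = t := by
  refine ⟨t ^ (1 / 4 : ℝ), by positivity, ?_⟩
  rw [← Real.rpow_natCast, ← Real.rpow_mul ht.le]; norm_num

theorem goodKer_kT (e j : ℕ) {t : ℝ} (ht : 0 < t) : GoodKer (kT e j t) := by
  refine ⟨continuousOn_kT e j ht, ?_⟩
  obtain ⟨C, hC, h⟩ := exists_kerBound_kT e j
  obtain ⟨p, hp, rfl⟩ := exists_fourth_root ht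
  exact ⟨_, p, by positivity, hp, h p hp⟩

theorem hasDerivAt_kT_time (e j : ℕ) {t x y : ℝ} (ht : 0 < t) (hx : 0 ≤ x) (hy : 0 ≤ y) :
    HasDerivAt (fun t => kT e j t x y) (-kT e (j + 4) t x y) t := by
  refine ((hasDerivAt_ker_time j (e + j) (3 * e) ht hx hy).const_mul ((-1) ^ e)).congr_deriv ?_
  rw [kT, ← add_assoc, ker_add_four_left, mul_neg]

theorem hasDerivAt_kT_left (e j : ℕ) {t x y : ℝ} (ht : 0 < t) (hx : 0 < x) (hy : 0 ≤ y) :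
    HasDerivAt (fun x => kT e j t x y) (kT e (j + 1) t x y) x :=
  (hasDerivAt_ker_left j (e + j) (3 * e) ht hx hy).const_mul ((-1) ^ e)

/-- The reason for the index `3 * e`: one derivative in `y` raises `3 (e + 1)` to `3 e + 4`, which
is `3 e` by periodicity. Up to sign it is thus a derivative in `x` of the kernel of order `e`. -/
theorem hasDerivAt_kT_right (e j : ℕ) {t x y : ℝ} (ht : 0 < t) (hx : 0 ≤ x) (hy : 0 < y) :
    HasDerivAt (fun y => kT (e + 1) j t x y) (-kT e (j + 1) t x y) y := by
  refine ((hasDerivAt_ker_right j (e + 1 + j) (3 * (e + 1)) ht hx hy).const_mul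
    ((-1) ^ (e + 1))).congr_deriv ?_
  rw [kT, mul_add, mul_one, show 3 * e + 3 + 1 = 3 * e + 4 by ring, ker_add_four_right,
    show e + 1 + j = e + (j + 1) by ring]
  ring

theorem exists_kerBound_kT_sub (e j : ℕ) : ∃ C : ℝ, 0 ≤ C ∧ ∀ q : ℝ, 0 < q →
    ∀ s ∈ Icc (q ^ 4) ((2 * q) ^ 4), ∀ t ∈ Icc (q ^ 4) ((2 * q) ^ 4),
      KerBound (fun x y => kT e j t x y - kT e j s x y) (C * q⁻¹ ^ (j + 4) * |t - s|) q := by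
  obtain ⟨C, hC, h⟩ := exists_kerBound_kT_Icc e (j + 4)
  refine ⟨C, hC, fun q hq s hs t ht x y hx hy => ?_⟩
  have h1 := (convex_Icc (q ^ 4) ((2 * q) ^ 4)).norm_image_sub_le_of_norm_hasDerivWithin_le
    (f := fun t => kT e j t x y) (f' := fun t => -kT e (j + 4) t x y)
    (C := C * q⁻¹ ^ (j + 4) * cauchyW q (x - y))
    (fun r hr => (hasDerivAt_kT_time e j (lt_of_lt_of_le (by positivity) hr.1) hx
      hy).hasDerivWithinAt)
    (fun r hr => by rw [norm_neg]; exact h q hq r hr x y hx hy) hs ht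
  refine h1.trans_eq ?_
  rw [Real.norm_eq_abs]
  ring

/-- The operator with kernel `kT e j t`. -/
def T (β : Bool) (e j : ℕ) (t : ℝ) : BC β →L[ℝ] BC β := op β (kT e j t)

theorem toC_T {e j : ℕ} {t : ℝ} (ht : 0 < t) (f : BC β) (x : ℝ) :
    toC (T β e j t f) x = opFun (kT e j t) (toC f) x := toC_op (goodKer_kT e j ht) f x

theorem forget_T {e j : ℕ} {t : ℝ} (ht : 0 < t) (f : BC β) :
    forget (T β e j t f) = T false e j t (forget f) := forget_op (goodKer_kT e j ht) f

theorem exists_norm_T_le (β : Bool) (e j : ℕ) : ∃ C : ℝ, 0 ≤ C ∧ ∀ t : ℝ, 0 < t →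
    ‖T β e j t‖ ≤ C * t ^ (-(j / 4 : ℝ)) := by
  obtain ⟨C, hC, h⟩ := exists_kerBound_kT e j
  refine ⟨C * Real.pi, by positivity, fun t ht => ?_⟩
  obtain ⟨p, hp, rfl⟩ := exists_fourth_root ht
  refine (norm_op_le (goodKer_kT e j ht) (by positivity) hp (h p hp)).trans_eq ?_
  have : (p ^ 4) ^ (-(j / 4 : ℝ)) = p⁻¹ ^ j := by
    rw [← Real.rpow_natCast, ← Real.rpow_mul hp.le, inv_pow, ← Real.rpow_natCast p j,
      ← Real.rpow_neg hp.le]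
    congr 1
    push_cast
    ring
  rw [this]
  ring

theorem continuousOn_T (β : Bool) (e j : ℕ) : ContinuousOn (T β e j) (Ioi 0) := by
  obtain ⟨C, hC, h⟩ := exists_kerBound_kT_sub e j
  intro t ht
  have ht0 : (0 : ℝ) < t := ht
  obtain ⟨p, hp, rfl⟩ := exists_fourth_root ht0
  refine ContinuousAt.continuousWithinAt ?_
  -- Any `q` with `q < p < 2 q` would do: the time `p ^ 4` has to be interior to the range covered
  -- by the estimate.
  set q : ℝ := 2 / 3 * p with hq
  have hq0 : 0 < q := by positivity
  have hp4 : 0 < p ^ 4 := by positivity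
  have hmem : p ^ 4 ∈ Ioo (q ^ 4) ((2 * q) ^ 4) := by
    constructor
    · rw [hq, mul_pow]; linarith
    · rw [hq, ← mul_assoc, mul_pow]; linarith
  rw [ContinuousAt, tendsto_iff_norm_sub_tendsto_zero]
  have hlim : Tendsto (fun s => C * q⁻¹ ^ (j + 4) * |s - p ^ 4| * Real.pi) (𝓝 (p ^ 4)) (𝓝 0) := by
    have : Continuous fun s => C * q⁻¹ ^ (j + 4) * |s - p ^ 4| * Real.pi := by fun_prop
    have h2 := this.tendsto (p ^ 4)
    simpa using h2
  refine squeeze_zero' (Eventually.of_forall fun s => norm_nonneg _) ?_ hlim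
  filter_upwards [Ioo_mem_nhds hmem.1 hmem.2] with s hs
  have hs0 : 0 < s := lt_trans (by positivity) hs.1
  have hb := h q hq0 _ ⟨hmem.1.le, hmem.2.le⟩ s ⟨hs.1.le, hs.2.le⟩
  have hg := (goodKer_kT e j hs0).sub (goodKer_kT e j hp4) (by positivity) hq0 hb
  rw [T, T, op_sub (goodKer_kT e j hs0) (goodKer_kT e j hp4) hg]
  exact norm_op_le hg (by positivity) hq0 hb

theorem hasDerivAt_T (e j : ℕ) {t : ℝ} (ht : 0 < t) (f : BC β) {x : ℝ} (hx : 0 < x) :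
    HasDerivAt (toC (T β e j t f)) (toC (T β e (j + 1) t f) x) x := by
  obtain ⟨C, q, hC, hq, hb⟩ := (goodKer_kT e (j + 1) ht).bound
  have hball : Ioi 0 ∩ Metric.closedBall x q ∈ 𝓝 x :=
    inter_mem (Ioi_mem_nhds hx) (Metric.closedBall_mem_nhds x hq)
  have key := hasDerivAt_integral_of_dominated_loc_of_deriv_le (μ := volume.restrict (Ici 0))
    (F := fun x y => kT e j t x y * toC f y) (F' := fun x y => kT e (j + 1) t x y * toC f y)
    (bound := fun y => C * ‖toC f‖ * (3 * cauchyW q (x - y))) hball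
    (eventually_of_mem (Ioi_mem_nhds hx) fun z hz => (goodKer_kT e j ht).aesm (le_of_lt hz) (toC f))
    ((goodKer_kT e j ht).integrable hx.le (toC f))
    ((goodKer_kT e (j + 1) ht).aesm hx.le (toC f))
    ((ae_restrict_iff' measurableSet_Ici).2 (Eventually.of_forall fun y hy z hz => by
      refine (hb.integrand_le (toC f) (le_of_lt hz.1) hy).trans ?_
      gcongr
      refine cauchyW_le_shift hq ?_
      have := hz.2
      rw [Metric.mem_closedBall, Real.dist_eq] at this
      simpa using this))
    (((integrable_cauchyW_sub hq x _).const_mul 3).const_mul _)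
    ((ae_restrict_iff' measurableSet_Ici).2 (Eventually.of_forall fun y hy z hz =>
      (hasDerivAt_kT_left e j ht hz.1 hy).mul_const _))
  rw [toC_T ht, opFun_of_nonneg _ _ hx.le]
  refine key.2.congr_of_eventuallyEq ?_
  filter_upwards [Ioi_mem_nhds hx] with z hz
  rw [toC_T ht, opFun_of_nonneg _ _ (le_of_lt hz)]

theorem hasDerivAt_T_time (e j : ℕ) {t : ℝ} (ht : 0 < t) (f : BC β) (x : ℝ) :
    HasDerivAt (fun t => toC (T β e j t f) x) (-(toC (T β e (j + 4) t f) x)) t := by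
  obtain ⟨C, hC, h⟩ := exists_kerBound_kT_Icc e (j + 4)
  obtain ⟨p, hp, hpt⟩ := exists_fourth_root ht
  set q : ℝ := 2 / 3 * p with hq
  have hq0 : 0 < q := by positivity
  have hmem : Icc (q ^ 4) ((2 * q) ^ 4) ∈ 𝓝 t := by
    apply Icc_mem_nhds
    · rw [hq, mul_pow]; linarith
    · rw [hq, ← mul_assoc, mul_pow]; linarith
  have hx : 0 ≤ max x 0 := le_max_right _ _
  have key := hasDerivAt_integral_of_dominated_loc_of_deriv_le (μ := volume.restrict (Ici 0))
    (F := fun t y => kT e j t (max x 0) y * toC f y)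
    (F' := fun t y => -kT e (j + 4) t (max x 0) y * toC f y)
    (bound := fun y => C * q⁻¹ ^ (j + 4) * ‖toC f‖ * cauchyW q (max x 0 - y)) hmem
    (eventually_of_mem (Ioi_mem_nhds ht) fun z hz => (goodKer_kT e j hz).aesm hx (toC f))
    ((goodKer_kT e j ht).integrable hx (toC f))
    (by
      have := ((goodKer_kT e (j + 4) ht).aesm hx (toC f)).neg
      simp only [neg_mul]
      exact this)
    ((ae_restrict_iff' measurableSet_Ici).2 (Eventually.of_forall fun y hy z hz => by
      rw [neg_mul, norm_neg]
      exact (h q hq0 z hz).integrand_le (toC f) hx hy))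
    ((integrable_cauchyW_sub hq0 _ _).const_mul _)
    ((ae_restrict_iff' measurableSet_Ici).2 (Eventually.of_forall fun y hy z hz =>
      (hasDerivAt_kT_time e j (lt_of_lt_of_le (by positivity) hz.1) hx hy).mul_const _))
  have e1 : -(toC (T β e (j + 4) t f) x) = ∫ y in Ici 0, -kT e (j + 4) t (max x 0) y * toC f y := by
    rw [toC_T ht, opFun, ← integral_neg]
    simp only [neg_mul]
  rw [e1]
  refine key.2.congr_of_eventuallyEq ?_
  filter_upwards [Ioi_mem_nhds ht] with z hz
  rw [toC_T hz, opFun]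

/-! ### Moving a derivative from the kernel to the function -/

theorem ker_zero_right (m l r : ℕ) (h : mode r 0 = 0) (t x : ℝ) : ker m l r t x 0 = 0 := by
  simp [ker, h]

theorem ker_zero_left (m l r : ℕ) (h : mode l 0 = 0) (t y : ℝ) : ker m l r t 0 y = 0 := by
  simp [ker, h]

theorem tendsto_cauchyW {q : ℝ} (hq : 0 < q) (x : ℝ) :
    Tendsto (fun y => cauchyW q (x - y)) atTop (𝓝 0) := by
  have h1 : Tendsto (fun y : ℝ => ((x - y) / q) ^ 2) atTop atTop := by
    have h2 : Tendsto (fun y : ℝ => (y - x) / q) atTop atTop :=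
      (tendsto_atTop_add_const_right _ (-x) tendsto_id).atTop_div_const hq
    refine ((tendsto_pow_atTop (n := 2) (by norm_num)).comp h2).congr fun y => ?_
    simp only [Function.comp, div_pow]
    ring
  have h3 := ((tendsto_atTop_add_const_left _ 1 h1).inv_tendsto_atTop).const_mul q⁻¹
  rw [mul_zero] at h3
  exact h3

/-- Integration by parts in `y`. The boundary term is `f 0` times the trace of the kernel, which is
governed by `mode (3 * (e + 1))` and vanishes when `e` is 2 or 3 modulo 4. For the other orders `f 0
= 0` is needed. The two integrability flags are independent, so `f` may be integrable while `f'` is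
only bounded. -/
theorem toC_T_succ {β β' : Bool} (e j : ℕ) {t : ℝ} (ht : 0 < t) (f : BC β) (f' : BC β')
    (hf : ∀ y, 0 < y → HasDerivAt (toC f) (toC f' y) y)
    (h0 : toC f 0 = 0 ∨ mode (3 * (e + 1)) 0 = 0) (x : ℝ) :
    toC (T β e (j + 1) t f) x = toC (T β' (e + 1) j t f') x := by
  have hx : 0 ≤ max x 0 := le_max_right _ _
  have hg := goodKer_kT (e + 1) j ht
  have hg' := goodKer_kT e (j + 1) ht
  rw [toC_T ht, toC_T ht, opFun, opFun, integral_Ici_eq_integral_Ioi, integral_Ici_eq_integral_Ioi]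
  have hcont : ContinuousOn (fun y => kT (e + 1) j t (max x 0) y * toC f y) (Ici 0) :=
    (hg.cont.comp (by fun_prop : Continuous fun y : ℝ => (max x 0, y)).continuousOn
      (fun y hy => ⟨hx, hy⟩)).mul (toC f).continuous.continuousOn
  have hz : kT (e + 1) j t (max x 0) 0 * toC f 0 = 0 := by
    rcases h0 with h0 | h0
    · rw [h0, mul_zero]
    · rw [kT, ker_zero_right _ _ _ h0, mul_zero, zero_mul]
  have hlim0 : Tendsto ((fun y => kT (e + 1) j t (max x 0) y) * ⇑(toC f)) (𝓝[>] 0) (𝓝 0) := by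
    have := (hcont 0 self_mem_Ici).mono (Ioi_subset_Ici_self)
    rw [ContinuousWithinAt, hz] at this
    exact this
  have hlim1 : Tendsto ((fun y => kT (e + 1) j t (max x 0) y) * ⇑(toC f)) atTop (𝓝 0) := by
    obtain ⟨C, q, hC, hq, hb⟩ := hg.bound
    have h1 := (tendsto_cauchyW hq (max x 0)).const_mul (C * ‖toC f‖)
    rw [mul_zero] at h1
    refine squeeze_zero_norm' ?_ h1
    filter_upwards [eventually_ge_atTop 0] with y hy
    exact hb.integrand_le (toC f) hx hy
  have key := integral_Ioi_mul_deriv_eq_deriv_mul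
    (fun y hy => hasDerivAt_kT_right e j ht hx hy) hf
    ((hg.integrable hx (toC f')).mono_set Ioi_subset_Ici_self)
    (by
      have := ((hg'.integrable hx (toC f)).mono_set Ioi_subset_Ici_self).neg
      refine this.congr (Eventually.of_forall fun y => ?_)
      simp) hlim0 hlim1
  rw [key]
  simp only [neg_mul, integral_neg]
  ring

end

section

variable {β : Bool}

/-! ### The initial time -/

/-- The substitution `y = x i - p i * z` replaces the concentrating weight by a fixed one, and
dominated convergence applies. The moving base point makes the limit joint in time and space. -/
theorem tendsto_integral_cauchyW {ι : Type*} {l : Filter ι} [l.IsCountablyGenerated] (f : ℝ →ᵇ ℝ)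
    {p x : ι → ℝ} {x0 : ℝ} (hp : Tendsto p l (𝓝[>] 0)) (hx : Tendsto x l (𝓝 x0)) :
    Tendsto (fun i => ∫ y, cauchyW (p i) (x i - y) * |f y - f x0|) l (𝓝 0) := by
  have hp0 : Tendsto p l (𝓝 0) := hp.mono_right nhdsWithin_le_nhds
  have hppos : ∀ᶠ i in l, 0 < p i := hp.eventually self_mem_nhdsWithin
  have key : Tendsto (fun i => ∫ z, (1 + z ^ 2)⁻¹ * |f (x i - p i * z) - f x0|) l
      (𝓝 (∫ _ : ℝ, (0 : ℝ))) := by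
    refine tendsto_integral_filter_of_dominated_convergence
      (fun z => (1 + z ^ 2)⁻¹ * (2 * ‖f‖)) ?_ ?_ (integrable_inv_one_add_sq.mul_const _) ?_
    · refine Eventually.of_forall fun i => Continuous.aestronglyMeasurable ?_
      have h1 : Continuous fun z : ℝ => (1 + z ^ 2)⁻¹ :=
        (by fun_prop : Continuous fun z : ℝ => 1 + z ^ 2).inv₀ fun z => by positivity
      have h2 := f.continuous
      fun_prop
    · refine Eventually.of_forall fun i => Eventually.of_forall fun z => ?_
      rw [norm_mul, Real.norm_of_nonneg (by positivity : 0 ≤ (1 + z ^ 2)⁻¹), Real.norm_eq_abs,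
        abs_abs]
      gcongr
      have h1 := f.dist_le_two_norm (x i - p i * z) x0
      rwa [Real.dist_eq] at h1
    · refine Eventually.of_forall fun z => ?_
      have h1 : Tendsto (fun i => x i - p i * z) l (𝓝 x0) := by
        simpa using hx.sub (hp0.mul_const z)
      have h2 := (((f.continuous.tendsto x0).comp h1).sub_const (f x0)).abs.const_mul
        (1 + z ^ 2)⁻¹
      simpa using h2
  rw [integral_zero] at key
  refine key.congr' ?_
  filter_upwards [hppos] with i hi
  have h1 := Measure.integral_comp_mul_left
    (fun w => cauchyW (p i) w * |f (x i - w) - f x0|) (p i)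
  have h2 := integral_sub_left_eq_self (fun w => cauchyW (p i) w * |f (x i - w) - f x0|)
    volume (x i)
  simp only [sub_sub_cancel] at h2
  rw [h2]
  have h3 : ∫ w, cauchyW (p i) w * |f (x i - w) - f x0| =
      p i * ∫ z, cauchyW (p i) (p i * z) * |f (x i - p i * z) - f x0| := by
    rw [h1, abs_of_pos (inv_pos.2 hi), smul_eq_mul, mul_inv_cancel_left₀ hi.ne']
  rw [h3, ← integral_const_mul]
  congr 1
  ext z
  rw [cauchyW, mul_div_cancel_left₀ _ hi.ne', ← mul_assoc, ← mul_assoc, mul_inv_cancel₀ hi.ne',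
    one_mul]

/-- Since `i * (-i) ^ 3 = -1`, the sign `(-1) ^ e` in `kT` makes the translation invariant part the
same for every `e`. -/
theorem kerMain_diag (e : ℕ) (z : ℝ) : (-1) ^ e * kerMain 0 e (3 * e) z = kerMain 0 0 0 z := by
  have h1 : Complex.I ^ e * (-Complex.I) ^ (3 * e) = (((-1) ^ e : ℝ) : ℂ) := by
    rw [pow_mul, ← mul_pow]
    push_cast
    congr 1
    linear_combination (-Complex.I ^ 2 + 1) * Complex.I_sq
  have h2 : ((-1 : ℝ) ^ e) * (-1) ^ e = 1 := by rw [← mul_pow]; norm_num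
  rw [kerMain, kerMain, h1, Complex.re_ofReal_mul, ← mul_assoc, h2]
  simp

/-- Far from the boundary the correction contributes nothing in the limit, and the translation
invariant part recovers its full mass `π`. -/
theorem tendsto_mass (e : ℕ) :
    Tendsto (fun X => ∫ z in Ici 0, kT e 0 1 X z) atTop (𝓝 1) := by
  have hA : Tendsto (fun X => ∫ z in Ici 0, kerMain 0 0 0 (X - z)) atTop (𝓝 Real.pi) := by
    have h1 := (aecover_Iic (μ := volume) (tendsto_id (α := ℝ))).integral_tendsto_of_countably_generated
      integrable_kerMain
    rw [integral_kerMain] at h1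
    refine h1.congr fun X => ?_
    rw [← integral_indicator measurableSet_Iic, ← integral_indicator measurableSet_Ici,
      ← integral_sub_left_eq_self _ volume X]
    congr 1
    ext z
    by_cases hz : 0 ≤ z
    · rw [indicator_of_mem (by simpa using hz), indicator_of_mem (by simpa using hz)]
    · rw [indicator_of_notMem (by simpa using hz), indicator_of_notMem (by simpa using hz)]
  obtain ⟨C, hC⟩ := abs_kerCorr_le 0 e (3 * e) (by omega)
  have hle : ∀ X z : ℝ, 0 ≤ X → 0 ≤ z → (1 + (X + z) ^ 2)⁻¹ ≤ (1 + z ^ 2)⁻¹ := by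
    intro X z hX hz
    gcongr
    linarith
  have hm : ∀ X : ℝ, 0 ≤ X → AEStronglyMeasurable (fun z => kerCorr 0 e (3 * e) X z)
      (volume.restrict (Ici 0)) := by
    intro X hX
    have h1 : ContinuousOn (fun z => Real.pi * ker 0 e (3 * e) 1 X z - kerMain 0 e (3 * e) (X - z))
        (Ici 0) := by
      refine (continuousOn_const.mul ((continuousOn_ker 0 e (3 * e)).comp
        (by fun_prop : Continuous fun z : ℝ => ((1 : ℝ), X, z)).continuousOn
        fun z hz => ⟨mem_Ioi.2 one_pos, hX, hz⟩)).sub ?_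
      have := continuous_kerMain 0 e (3 * e)
      fun_prop
    refine (h1.aestronglyMeasurable measurableSet_Ici).congr ?_
    refine (ae_restrict_iff' measurableSet_Ici).2 (Eventually.of_forall fun z hz => ?_)
    simp only
    rw [ker_one_eq 0 e (3 * e) hX hz, mul_inv_cancel_left₀ Real.pi_ne_zero, add_sub_cancel_left]
  have hB : Tendsto (fun X => ∫ z in Ici 0, kerCorr 0 e (3 * e) X z) atTop (𝓝 0) := by
    have h1 : Tendsto (fun X => ∫ z in Ici 0, kerCorr 0 e (3 * e) X z) atTop
        (𝓝 (∫ z in Ici (0 : ℝ), (0 : ℝ))) := by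
      refine tendsto_integral_filter_of_dominated_convergence
        (fun z => |C| * (1 + z ^ 2)⁻¹) ?_ ?_ (integrable_inv_one_add_sq.integrableOn.const_mul _) ?_
      · filter_upwards [eventually_ge_atTop 0] with X hX using hm X hX
      · filter_upwards [eventually_ge_atTop 0] with X hX
        refine (ae_restrict_iff' measurableSet_Ici).2 (Eventually.of_forall fun z hz => ?_)
        refine (hC X z hX hz).trans ?_
        exact mul_le_mul (le_abs_self _) (hle X z hX hz) (by positivity) (abs_nonneg _)
      · refine (ae_restrict_iff' measurableSet_Ici).2 (Eventually.of_forall fun z hz => ?_)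
        have h2 : Tendsto (fun X : ℝ => C * (1 + (X + z) ^ 2)⁻¹) atTop (𝓝 0) := by
          have h3 : Tendsto (fun X : ℝ => 1 + (X + z) ^ 2) atTop atTop :=
            tendsto_atTop_add_const_left _ 1 ((tendsto_pow_atTop (n := 2) (by norm_num)).comp
              (tendsto_atTop_add_const_right _ z tendsto_id))
          simpa using h3.inv_tendsto_atTop.const_mul C
        refine squeeze_zero_norm' ?_ h2
        filter_upwards [eventually_ge_atTop 0] with X hX using hC X z hX hz
    simpa using h1
  have hAB := (hA.add (hB.const_mul ((-1) ^ e))).const_mul Real.pi⁻¹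
  rw [mul_zero, add_zero, inv_mul_cancel₀ Real.pi_ne_zero] at hAB
  refine hAB.congr' ?_
  filter_upwards [eventually_ge_atTop 0] with X hX
  rw [← integral_const_mul, ← integral_add, ← integral_const_mul]
  · refine setIntegral_congr_fun measurableSet_Ici fun z hz => ?_
    rw [kT, add_zero, ker_one_eq 0 e (3 * e) hX hz, ← kerMain_diag e]
    ring
  · exact (integrable_kerMain.comp_sub_left X).integrableOn
  · refine Integrable.const_mul ?_ _
    refine Integrable.mono' (integrable_inv_one_add_sq.integrableOn.const_mul |C|) (hm X hX) ?_
    refine (ae_restrict_iff' measurableSet_Ici).2 (Eventually.of_forall fun z hz => ?_)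
    refine (hC X z hX hz).trans ?_
    exact mul_le_mul (le_abs_self _) (hle X z hX hz) (by positivity) (abs_nonneg _)

theorem mass_scale (e : ℕ) {p : ℝ} (hp : 0 < p) (x : ℝ) :
    ∫ y in Ici 0, kT e 0 (p ^ 4) x y = ∫ z in Ici 0, kT e 0 1 (x / p) z := by
  have h1 := integral_comp_mul_left_Ioi (fun y => kT e 0 (p ^ 4) x y) 0 hp
  rw [mul_zero, smul_eq_mul, ← integral_Ici_eq_integral_Ioi, ← integral_Ici_eq_integral_Ioi] at h1
  have h2 : ∫ y in Ici 0, kT e 0 (p ^ 4) x y = p * ∫ z in Ici 0, kT e 0 (p ^ 4) x (p * z) := by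
    rw [h1, mul_inv_cancel_left₀ hp.ne']
  rw [h2, ← integral_const_mul]
  congr 1
  ext z
  rw [kT, kT, ker_scale _ _ _ hp, mul_div_cancel_left₀ _ hp.ne', zero_add, pow_one]
  field_simp

theorem abs_T_sub_mass_le (e : ℕ) : ∃ C : ℝ, 0 ≤ C ∧ ∀ (p : ℝ) (f : ℝ →ᵇ ℝ) (x c : ℝ), 0 < p →
    0 ≤ x → |(∫ y in Ici 0, kT e 0 (p ^ 4) x y * f y) - c * ∫ y in Ici 0, kT e 0 (p ^ 4) x y| ≤
      C * ∫ y, cauchyW p (x - y) * |f y - c| := by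
  obtain ⟨C, hC, h⟩ := exists_kerBound_kT e 0
  refine ⟨C, hC, fun p f x c hp hx => ?_⟩
  have hg := goodKer_kT e 0 (pow_pos hp 4)
  have h1 := hg.integrable hx (BoundedContinuousFunction.const ℝ (1 : ℝ))
  simp only [BoundedContinuousFunction.const_apply, mul_one] at h1
  rw [← integral_const_mul, ← integral_sub (hg.integrable hx f) (h1.const_mul c)]
  have hint : Integrable fun y => cauchyW p (x - y) * |f y - c| := by
    refine ((integrable_cauchyW hp).comp_sub_left x).mul_bdd (c := ‖f‖ + |c|) ?_ ?_
    · exact ((f.continuous.sub continuous_const).abs).aestronglyMeasurable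
    · refine Eventually.of_forall fun y => ?_
      rw [Real.norm_eq_abs, abs_abs]
      exact (abs_sub _ _).trans (add_le_add (f.norm_coe_le_norm y) le_rfl)
  have h3 := norm_integral_le_of_norm_le (μ := volume.restrict (Ici 0))
    (f := fun y => kT e 0 (p ^ 4) x y * f y - c * kT e 0 (p ^ 4) x y)
    (hint.const_mul C).integrableOn
    ((ae_restrict_iff' measurableSet_Ici).2 (Eventually.of_forall fun y hy => by
      have h2 := h p hp x y hx hy
      rw [pow_zero, mul_one] at h2
      rw [show kT e 0 (p ^ 4) x y * f y - c * kT e 0 (p ^ 4) x y =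
        kT e 0 (p ^ 4) x y * (f y - c) by ring, norm_mul, ← mul_assoc]
      exact mul_le_mul_of_nonneg_right h2 (norm_nonneg _)))
  refine h3.trans ?_
  rw [integral_const_mul]
  exact mul_le_mul_of_nonneg_left (setIntegral_le_integral hint (Eventually.of_forall fun y =>
    mul_nonneg (cauchyW_nonneg hp _) (abs_nonneg _))) hC

theorem tendsto_fourth_root : Tendsto (fun t : ℝ => t ^ (1 / 4 : ℝ)) (𝓝[>] 0) (𝓝[>] 0) := by
  refine tendsto_nhdsWithin_iff.2 ⟨?_, eventually_mem_nhdsWithin.mono fun t ht =>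
    Real.rpow_pos_of_pos ht _⟩
  have := (Real.continuousAt_rpow_const 0 (1 / 4) (Or.inr (by norm_num))).tendsto
  rw [Real.zero_rpow (by norm_num)] at this
  exact this.mono_left nhdsWithin_le_nhds

theorem rpow_quarter_pow {t : ℝ} (ht : 0 < t) : (t ^ (1 / 4 : ℝ)) ^ 4 = t := by
  rw [← Real.rpow_natCast, ← Real.rpow_mul ht.le]; norm_num

/-- For fixed `x > 0` the rescaled distance `x / t ^ (1/4)` to the boundary tends to infinity, so
the mass tends to one. The point `x = 0` has to be excluded: the kernel with `e = 0` vanishes there.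
-/
theorem tendsto_T_zero (e : ℕ) (f : BC β) {x : ℝ} (hx : 0 < x) :
    Tendsto (fun t => toC (T β e 0 t f) x) (𝓝[>] 0) (𝓝 (toC f x)) := by
  obtain ⟨C, hC, h⟩ := abs_T_sub_mass_le e
  have h1 := (tendsto_integral_cauchyW (toC f) tendsto_fourth_root
    (tendsto_const_nhds (x := x))).const_mul C
  rw [mul_zero] at h1
  have hm : Tendsto (fun t : ℝ => ∫ y in Ici 0, kT e 0 t x y) (𝓝[>] 0) (𝓝 1) := by
    have h2 : Tendsto (fun t : ℝ => x / t ^ (1 / 4 : ℝ)) (𝓝[>] 0) atTop :=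
      (tendsto_inv_nhdsGT_zero.comp tendsto_fourth_root).const_mul_atTop hx
    refine ((tendsto_mass e).comp h2).congr' ?_
    filter_upwards [self_mem_nhdsWithin] with t ht
    have := mass_scale e (Real.rpow_pos_of_pos ht (1 / 4)) x
    rw [rpow_quarter_pow ht] at this
    exact this.symm
  have h3 := (squeeze_zero_norm' (a := fun t : ℝ => C * ∫ y, cauchyW (t ^ (1 / 4 : ℝ)) (x - y) *
    |toC f y - toC f x|) (f := fun t => toC (T β e 0 t f) x -
      toC f x * ∫ y in Ici 0, kT e 0 t x y) ?_ h1).add (hm.const_mul (toC f x))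
  · simpa using h3
  · filter_upwards [self_mem_nhdsWithin] with t ht
    have := h _ (toC f) x (toC f x) (Real.rpow_pos_of_pos ht (1 / 4)) hx.le
    rw [rpow_quarter_pow ht] at this
    rw [toC_T ht, opFun_of_nonneg _ _ hx.le]
    exact this

/-- When the mass is exactly one there is no boundary layer, so the convergence is joint in `(t, x)`
up to the boundary. It applies to a sixth derivative that need not be uniformly continuous. -/
theorem tendsto_T_zero_of_mass (e : ℕ) (f : BC β)
    (hm : ∀ t x : ℝ, 0 < t → t ≤ 1 → 0 ≤ x → ∫ y in Ici 0, kT e 0 t x y = 1) {x0 : ℝ}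
    (hx0 : 0 ≤ x0) :
    Tendsto (fun p : ℝ × ℝ => toC (T β e 0 p.1 f) (max p.2 0)) (𝓝[>] 0 ×ˢ 𝓝 x0)
      (𝓝 (toC f x0)) := by
  obtain ⟨C, hC, h⟩ := abs_T_sub_mass_le e
  have hx : Tendsto (fun p : ℝ × ℝ => max p.2 0) (𝓝[>] 0 ×ˢ 𝓝 x0) (𝓝 x0) := by
    have := (tendsto_snd (f := 𝓝[>] (0 : ℝ)) (g := 𝓝 x0)).max
      (tendsto_const_nhds (x := (0 : ℝ)))
    rwa [max_eq_left hx0] at this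
  have h1 := (tendsto_integral_cauchyW (toC f) (tendsto_fourth_root.comp
    (tendsto_fst (f := 𝓝[>] (0 : ℝ)) (g := 𝓝 x0))) hx).const_mul C
  rw [mul_zero] at h1
  rw [tendsto_iff_norm_sub_tendsto_zero]
  refine squeeze_zero' (Eventually.of_forall fun _ => norm_nonneg _) ?_ h1
  have h2 : ∀ᶠ p : ℝ × ℝ in 𝓝[>] 0 ×ˢ 𝓝 x0, p.1 ∈ Ioc 0 1 :=
    (tendsto_fst (f := 𝓝[>] (0 : ℝ)) (g := 𝓝 x0)).eventually (Ioc_mem_nhdsGT one_pos)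
  filter_upwards [h2] with p hp
  have := h _ (toC f) (max p.2 0) (toC f x0) (Real.rpow_pos_of_pos hp.1 (1 / 4)) (le_max_right _ _)
  rw [rpow_quarter_pow hp.1, hm p.1 _ hp.1 hp.2 (le_max_right _ _), mul_one] at this
  rw [toC_T hp.1, opFun_of_nonneg _ _ (le_max_right _ _)]
  exact this

end

section

/-! ### Volterra equations with an integrable singularity -/

section Volterra

variable {E F : Type*} [NormedAddCommGroup E] [NormedSpace ℝ E] [NormedAddCommGroup F]
  [NormedSpace ℝ F]

/-- A family of operators on `(0, 1]`, continuous in operator norm, with the singularity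
`C * t ^ (-γ)` at `0`. -/
structure SingOp (V : ℝ → E →L[ℝ] F) (C γ : ℝ) : Prop where
  cont : ContinuousOn V (Ioi 0)
  nonneg : 0 ≤ C
  lt_one : γ < 1
  bound : ∀ t, 0 < t → t ≤ 1 → ‖V t‖ ≤ C * t ^ (-γ)

/-- The convolution `∫₀^t V(s) q(t - s) ds`. -/
def conv (V : ℝ → E →L[ℝ] F) (q : ℝ → E) (t : ℝ) : F := ∫ s in (0 : ℝ)..t, V s (q (t - s))

variable {V : ℝ → E →L[ℝ] F} {C γ : ℝ}

theorem intervalIntegrable_rpow_neg (hγ : γ < 1) (a b : ℝ) :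
    IntervalIntegrable (fun s : ℝ => s ^ (-γ)) volume a b :=
  intervalIntegral.intervalIntegrable_rpow' (by linarith)

theorem integral_rpow_neg (hγ : γ < 1) (t : ℝ) :
    ∫ s in (0 : ℝ)..t, s ^ (-γ) = t ^ (1 - γ) / (1 - γ) := by
  rw [integral_rpow (Or.inl (by linarith)), Real.zero_rpow (by linarith)]
  rw [sub_zero, show -γ + 1 = 1 - γ by ring]

theorem SingOp.aesm (hV : SingOp V C γ) {q : ℝ → E} (hq : Continuous q) {t a b : ℝ} (ha : 0 ≤ a) :
    AEStronglyMeasurable (fun s => V s (q (t - s))) (volume.restrict (Ioc a b)) := by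
  have h1 : ContinuousOn (fun s => V s (q (t - s))) (Ioc a b) :=
    (hV.cont.mono fun s hs => ha.trans_lt hs.1).clm_apply
      (by fun_prop : Continuous fun s => q (t - s)).continuousOn
  exact h1.aestronglyMeasurable measurableSet_Ioc

theorem SingOp.norm_apply_le (hV : SingOp V C γ) {s M : ℝ} (hs : 0 < s) (hs1 : s ≤ 1) {v : E}
    (hv : ‖v‖ ≤ M) : ‖V s v‖ ≤ C * M * s ^ (-γ) := by
  have h0 : 0 ≤ C * s ^ (-γ) := (norm_nonneg _).trans (hV.bound s hs hs1)
  calc _ ≤ ‖V s‖ * ‖v‖ := (V s).le_opNorm v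
    _ ≤ C * s ^ (-γ) * M := mul_le_mul (hV.bound s hs hs1) hv (norm_nonneg _) h0
    _ = _ := by ring

theorem SingOp.intervalIntegrable (hV : SingOp V C γ) {q : ℝ → E} (hq : Continuous q) {t : ℝ}
    (ht0 : 0 ≤ t) (ht : t ≤ 1) :
    IntervalIntegrable (fun s => V s (q (t - s))) volume 0 t := by
  rw [intervalIntegrable_iff_integrableOn_Ioc_of_le ht0]
  obtain ⟨M, hM⟩ := isCompact_Icc.exists_bound_of_continuousOn (s := Icc 0 t) hq.continuousOn
  have h1 := ((intervalIntegrable_iff_integrableOn_Ioc_of_le ht0).1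
    (intervalIntegrable_rpow_neg hV.lt_one 0 t)).const_mul (C * M)
  refine Integrable.mono' h1 (hV.aesm hq le_rfl) ?_
  refine (ae_restrict_iff' measurableSet_Ioc).2 (Eventually.of_forall fun s hs => ?_)
  exact hV.norm_apply_le hs.1 (hs.2.trans ht) (hM _ ⟨by linarith [hs.2], by linarith [hs.1]⟩)

theorem SingOp.norm_conv_le (hV : SingOp V C γ) {q : ℝ → E} {t M : ℝ}
    (ht0 : 0 ≤ t) (ht : t ≤ 1) (hM : ∀ s ∈ Icc 0 t, ‖q s‖ ≤ M) :
    ‖conv V q t‖ ≤ C * M * (t ^ (1 - γ) / (1 - γ)) := by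
  rw [conv, ← integral_rpow_neg hV.lt_one, ← intervalIntegral.integral_const_mul]
  refine intervalIntegral.norm_integral_le_of_norm_le ht0 ?_
    ((intervalIntegrable_rpow_neg hV.lt_one 0 t).const_mul _)
  exact Eventually.of_forall fun s hs =>
    hV.norm_apply_le hs.1 (hs.2.trans ht) (hM _ ⟨by linarith [hs.2], by linarith [hs.1]⟩)

theorem SingOp.conv_sub (hV : SingOp V C γ) {q q' : ℝ → E} (hq : Continuous q)
    (hq' : Continuous q') {t : ℝ} (ht0 : 0 ≤ t) (ht : t ≤ 1) :
    conv V q t - conv V q' t = conv V (fun s => q s - q' s) t := by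
  rw [conv, conv, conv, ← intervalIntegral.integral_sub (hV.intervalIntegrable hq ht0 ht)
    (hV.intervalIntegrable hq' ht0 ht)]
  simp only [map_sub]

theorem SingOp.continuousOn_conv (hV : SingOp V C γ) {q : ℝ → E} (hq : Continuous q) :
    ContinuousOn (conv V q) (Icc 0 1) := by
  obtain ⟨M, hM⟩ := isCompact_Icc.exists_bound_of_continuousOn (s := Icc 0 1) hq.continuousOn
  have heq : ∀ t ∈ Icc (0 : ℝ) 1, conv V q t =
      ∫ s in Ioc (0 : ℝ) 1, (Iic t).indicator (fun s => V s (q (t - s))) s := by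
    intro t ht
    rw [conv, intervalIntegral.integral_of_le ht.1, setIntegral_indicator measurableSet_Iic]
    congr 2
    ext s
    simp only [mem_Ioc, mem_inter_iff, mem_Iic]
    exact ⟨fun h => ⟨⟨h.1, h.2.trans ht.2⟩, h.2⟩, fun h => ⟨h.1.1, h.2⟩⟩
  intro t0 ht0
  refine ContinuousWithinAt.congr ?_ heq (heq t0 ht0)
  refine continuousWithinAt_of_dominated (bound := fun s => C * M * s ^ (-γ)) ?_ ?_ ?_ ?_
  · exact Eventually.of_forall fun t => (hV.aesm hq le_rfl).indicator measurableSet_Iic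
  · filter_upwards [self_mem_nhdsWithin] with t ht
    refine (ae_restrict_iff' measurableSet_Ioc).2 (Eventually.of_forall fun s hs => ?_)
    have hM0 : 0 ≤ M := (norm_nonneg _).trans (hM 0 ⟨le_rfl, zero_le_one⟩)
    by_cases hst : s ≤ t
    · rw [indicator_of_mem (mem_Iic.2 hst)]
      exact hV.norm_apply_le hs.1 hs.2 (hM _ ⟨by linarith, by linarith [hs.1, ht.2]⟩)
    · rw [indicator_of_notMem (by simpa using hst), norm_zero]
      have := Real.rpow_nonneg hs.1.le (-γ)
      have := hV.nonneg
      positivity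
  · exact ((intervalIntegrable_iff_integrableOn_Ioc_of_le zero_le_one).1
      (intervalIntegrable_rpow_neg hV.lt_one 0 1)).const_mul _
  · have hne : ∀ᵐ s ∂(volume.restrict (Ioc (0 : ℝ) 1)), s ≠ t0 :=
      ae_restrict_of_ae (Measure.ae_ne volume t0)
    filter_upwards [hne] with s hs
    refine ContinuousAt.continuousWithinAt ?_
    rcases lt_or_gt_of_ne hs with h | h
    · have h1 : ContinuousAt (fun t => V s (q (t - s))) t0 :=
        ((V s).continuous.comp (hq.comp (continuous_id.sub continuous_const))).continuousAt
      refine h1.congr ?_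
      filter_upwards [Ioi_mem_nhds h] with t ht
      rw [indicator_of_mem (mem_Iic.2 (le_of_lt ht))]
    · have h1 : ContinuousAt (fun _ : ℝ => (0 : F)) t0 := continuousAt_const
      refine h1.congr ?_
      filter_upwards [Iio_mem_nhds h] with t ht
      rw [indicator_of_notMem (by simpa using ht)]

theorem conv_zero (q : ℝ → E) : conv V q 0 = 0 := by simp [conv]

theorem exists_small_time (hγ : γ < 1) (K : ℝ) : ∃ τ : ℝ, 0 < τ ∧ τ ≤ 1 ∧
    ∀ t, 0 ≤ t → t ≤ τ → K * (t ^ (1 - γ) / (1 - γ)) ≤ 1 / 2 := by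
  have hc : ContinuousAt (fun t : ℝ => |K| * (t ^ (1 - γ) / (1 - γ))) 0 :=
    ContinuousAt.mul continuousAt_const
      ((Real.continuousAt_rpow_const 0 (1 - γ) (Or.inr (by linarith))).div_const _)
  have h0 : |K| * ((0 : ℝ) ^ (1 - γ) / (1 - γ)) < 1 / 2 := by
    rw [Real.zero_rpow (by linarith)]; norm_num
  have h1 := hc.eventually (gt_mem_nhds h0)
  obtain ⟨δ, hδ, h2⟩ := Metric.eventually_nhds_iff.1 h1
  refine ⟨min (δ / 2) 1, by positivity, min_le_right _ _, fun t ht0 ht => ?_⟩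
  have h3 := h2 (y := t) (by
    rw [Real.dist_eq, sub_zero, abs_of_nonneg ht0]
    linarith [ht.trans (min_le_left _ _)])
  refine le_trans ?_ h3.le
  have : 0 ≤ t ^ (1 - γ) / (1 - γ) := div_nonneg (Real.rpow_nonneg ht0 _) (by linarith)
  exact mul_le_mul_of_nonneg_right (le_abs_self K) this

theorem norm_bilin_sub_le (M : F →L[ℝ] F →L[ℝ] E) {R : ℝ} {a b : F} (ha : ‖a‖ ≤ R) (hb : ‖b‖ ≤ R) :
    ‖M a a - M b b‖ ≤ ‖M‖ * (2 * R) * ‖a - b‖ := by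
  have e : M a a - M b b = M (a - b) a + M b (a - b) := by
    simp only [map_sub, _root_.sub_apply]; abel
  rw [e]
  refine (norm_add_le _ _).trans ?_
  have h1 := M.le_opNorm₂ (a - b) a
  have h2 := M.le_opNorm₂ b (a - b)
  have h3 : ‖M‖ * ‖a - b‖ * ‖a‖ ≤ ‖M‖ * ‖a - b‖ * R := by gcongr
  have h4 : ‖M‖ * ‖b‖ * ‖a - b‖ ≤ ‖M‖ * R * ‖a - b‖ := by gcongr
  linarith

/-- Banach's fixed point theorem in the ball of radius `2 R`. The time is fixed before `A0` and
depends on it only through `R`, as continuation of solutions requires. -/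
theorem SingOp.exists_mild [CompleteSpace F] (hV : SingOp V C γ) (M : F →L[ℝ] F →L[ℝ] E) (R : ℝ) :
    ∃ τ : ℝ, 0 < τ ∧ τ ≤ 1 ∧ ∀ A0 : ℝ → F, ContinuousOn A0 (Icc 0 τ) →
      (∀ t ∈ Icc 0 τ, ‖A0 t‖ ≤ R) → ∃ A : ℝ → F, Continuous A ∧
        ∀ t ∈ Icc 0 τ, A t = A0 t + conv V (fun s => M (A s) (A s)) t := by
  -- On the ball of radius `2 R` the quadratic map has Lipschitz constant at most `‖M‖ * (2 * (2 *
  -- R))`.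
  obtain ⟨τ, hτ, hτ1, hsm⟩ := exists_small_time hV.lt_one (C * (‖M‖ * (2 * (2 * R))))
  refine ⟨τ, hτ, hτ1, fun A0 hA0 hR => ?_⟩
  have hR0 : 0 ≤ R := (norm_nonneg _).trans (hR 0 ⟨le_rfl, hτ.le⟩)
  let ext : C(Icc (0 : ℝ) τ, F) → ℝ → F := fun A => IccExtend hτ.le A
  have hext : ∀ A, Continuous (ext A) := fun A => A.continuous.Icc_extend'
  have hextn : ∀ A s, ‖ext A s‖ ≤ ‖A‖ := fun A s => A.norm_coe_le_norm _
  have hq : ∀ A : C(Icc (0 : ℝ) τ, F), Continuous fun s => M (ext A s) (ext A s) := fun A =>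
    (M.continuous.comp (hext A)).clm_apply (hext A)
  let Φ : C(Icc (0 : ℝ) τ, F) → C(Icc (0 : ℝ) τ, F) := fun A =>
    ⟨fun t => A0 t + conv V (fun s => M (ext A s) (ext A s)) t,
      (hA0.add ((hV.continuousOn_conv (hq A)).mono (Icc_subset_Icc_right hτ1))).domRestrict⟩
  have hmaps : MapsTo Φ (Metric.closedBall 0 (2 * R)) (Metric.closedBall 0 (2 * R)) := by
    intro A hA
    rw [mem_closedBall_zero_iff] at hA ⊢
    refine (ContinuousMap.norm_le _ (by positivity)).2 fun t => ?_
    have h1 := hV.norm_conv_le (M := ‖M‖ * (2 * R) * (2 * R)) (q := fun s => M (ext A s) (ext A s))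
      t.2.1 (t.2.2.trans hτ1) fun s _ => by
        refine (M.le_opNorm₂ _ _).trans ?_
        have := (hextn A s).trans hA
        gcongr
    have h2 := hsm t t.2.1 t.2.2
    have h3 := hR t t.2
    refine (norm_add_le _ _).trans ?_
    nlinarith
  have hlip : ∀ A ∈ Metric.closedBall (0 : C(Icc (0 : ℝ) τ, F)) (2 * R),
      ∀ B ∈ Metric.closedBall (0 : C(Icc (0 : ℝ) τ, F)) (2 * R),
      dist (Φ A) (Φ B) ≤ 1 / 2 * dist A B := by
    intro A hA B hB
    rw [mem_closedBall_zero_iff] at hA hB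
    rw [dist_eq_norm, dist_eq_norm]
    refine (ContinuousMap.norm_le _ (by positivity)).2 fun t => ?_
    have e : (Φ A - Φ B) t = conv V (fun s => M (ext A s) (ext A s) - M (ext B s) (ext B s)) t := by
      rw [← hV.conv_sub (hq A) (hq B) t.2.1 (t.2.2.trans hτ1)]
      change A0 t + _ - (A0 t + _) = _
      abel
    rw [e]
    have h1 := hV.norm_conv_le (M := ‖M‖ * (2 * (2 * R)) * ‖A - B‖)
      (q := fun s => M (ext A s) (ext A s) - M (ext B s) (ext B s))
      t.2.1 (t.2.2.trans hτ1) fun s _ => by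
        refine (norm_bilin_sub_le M ((hextn A s).trans hA) ((hextn B s).trans hB)).trans ?_
        gcongr
        exact (A - B).norm_coe_le_norm _
    have h2 := hsm t t.2.1 t.2.2
    have h3 := norm_nonneg (A - B)
    nlinarith
  have hcontr : ContractingWith (1 / 2) (hmaps.restrict Φ _ _) := by
    refine ⟨by rw [← NNReal.coe_lt_coe]; norm_num, LipschitzWith.of_dist_le_mul ?_⟩
    rintro ⟨A, hA⟩ ⟨B, hB⟩
    have h1 := hlip A hA B hB
    have e : ((1 / 2 : NNReal) : ℝ) = 1 / 2 := by norm_num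
    rw [e]
    exact h1
  obtain ⟨A, -, hfix, -⟩ := hcontr.exists_fixedPoint' Metric.isClosed_closedBall.isComplete hmaps
    (Metric.mem_closedBall_self (by positivity : (0 : ℝ) ≤ 2 * R)) (edist_ne_top _ _)
  refine ⟨ext A, hext A, fun t ht => ?_⟩
  have h1 : (Φ A) ⟨t, ht⟩ = A ⟨t, ht⟩ := by rw [hfix]
  rw [show ext A t = A ⟨t, ht⟩ from IccExtend_of_mem _ _ ht, ← h1]
  rfl

/-- At a time where the norm of the difference is maximal, the equation bounds this maximum by half
of itself. -/
theorem SingOp.mild_unique (hV : SingOp V C γ) (M : F →L[ℝ] F →L[ℝ] E) (R : ℝ) :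
    ∃ δ : ℝ, 0 < δ ∧ δ ≤ 1 ∧ ∀ (A0 A B : ℝ → F) (τ : ℝ), 0 ≤ τ → τ ≤ δ → Continuous A →
      Continuous B → (∀ t ∈ Icc 0 τ, ‖A t‖ ≤ R) → (∀ t ∈ Icc 0 τ, ‖B t‖ ≤ R) →
      (∀ t ∈ Icc 0 τ, A t = A0 t + conv V (fun s => M (A s) (A s)) t) →
      (∀ t ∈ Icc 0 τ, B t = A0 t + conv V (fun s => M (B s) (B s)) t) →
      ∀ t ∈ Icc 0 τ, A t = B t := by
  obtain ⟨δ, hδ, hδ1, hsm⟩ := exists_small_time hV.lt_one (C * (‖M‖ * (2 * R)))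
  refine ⟨δ, hδ, hδ1, fun A0 A B τ hτ0 hτ hA hB hAR hBR hAe hBe => ?_⟩
  obtain ⟨t1, ht1, hmax⟩ := isCompact_Icc.exists_isMaxOn (nonempty_Icc.2 hτ0)
    ((hA.sub hB).norm.continuousOn (s := Icc 0 τ))
  replace hmax : ∀ t ∈ Icc 0 τ, ‖A t - B t‖ ≤ ‖A t1 - B t1‖ := fun t ht => hmax ht
  have hq : ∀ A : ℝ → F, Continuous A → Continuous fun s => M (A s) (A s) := fun A hA =>
    (M.continuous.comp hA).clm_apply hA
  have e : A t1 - B t1 = conv V (fun s => M (A s) (A s) - M (B s) (B s)) t1 := by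
    rw [← hV.conv_sub (hq A hA) (hq B hB) ht1.1 ((ht1.2.trans hτ).trans hδ1), hAe t1 ht1,
      hBe t1 ht1]
    abel
  have h1 := hV.norm_conv_le (M := ‖M‖ * (2 * R) * ‖A t1 - B t1‖)
    (q := fun s => M (A s) (A s) - M (B s) (B s))
    ht1.1 ((ht1.2.trans hτ).trans hδ1) fun s hs => by
      have hs' : s ∈ Icc 0 τ := ⟨hs.1, hs.2.trans ht1.2⟩
      refine (norm_bilin_sub_le M (hAR s hs') (hBR s hs')).trans ?_
      have hR0 : 0 ≤ R := (norm_nonneg _).trans (hAR s hs')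
      have := hmax s hs'
      gcongr
  rw [← e] at h1
  have h2 := hsm t1 ht1.1 (ht1.2.trans hτ)
  have h3 : ‖A t1 - B t1‖ = 0 := by
    have := norm_nonneg (A t1 - B t1)
    nlinarith
  intro t ht
  have h4 := hmax t ht
  rw [h3] at h4
  exact sub_eq_zero.1 (norm_le_zero_iff.1 h4)

end Volterra

end

section

variable {β : Bool}

/-! ### Derivatives and convolutions in the space `BC` -/

def evalBC (x : ℝ) : BC β →L[ℝ] ℝ := (BoundedContinuousFunction.evalCLM ℝ x).comp toC

@[simp] theorem evalBC_apply (x : ℝ) (f : BC β) : evalBC x f = toC f x := rfl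

/-- The functional `f ↦ ∫₀^x f`. -/
def primAt (x : ℝ) : BC β →L[ℝ] ℝ :=
  LinearMap.mkContinuous
    { toFun := fun f => ∫ z in (0 : ℝ)..x, toC f z
      map_add' := fun f g => by
        simp only [map_add, BoundedContinuousFunction.coe_add, Pi.add_apply]
        exact intervalIntegral.integral_add ((toC f).continuous.intervalIntegrable _ _)
          ((toC g).continuous.intervalIntegrable _ _)
      map_smul' := fun c f => by
        simp only [map_smul]
        exact intervalIntegral.integral_const_mul c _ } |x| (by
    intro f
    have := intervalIntegral.norm_integral_le_of_norm_le_const (a := 0) (b := x) (f := toC f)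
      (C := ‖f‖) fun z _ => abs_toC_le f z
    rw [sub_zero, mul_comm] at this
    exact this)

theorem primAt_apply (x : ℝ) (f : BC β) : primAt x f = ∫ z in (0 : ℝ)..x, toC f z := rfl

/-- `f'` is the derivative of `f` on `(0, ∞)`. -/
def IsDer (f f' : ℝ → ℝ) : Prop := ∀ y, 0 < y → HasDerivAt f (f' y) y

theorem IsDer.integral_eq {f f' : ℝ → ℝ} (h : IsDer f f') (hf : ContinuousOn f (Ici 0))
    (hf' : Continuous f') {x : ℝ} (hx : 0 ≤ x) : ∫ z in (0 : ℝ)..x, f' z = f x - f 0 :=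
  intervalIntegral.integral_eq_sub_of_hasDerivAt_of_le hx (hf.mono Icc_subset_Ici_self)
    (fun y hy => h y hy.1) (hf'.intervalIntegrable _ _)

theorem isDer_of_integral_eq {f f' : ℝ → ℝ} (hf' : Continuous f')
    (h : ∀ x, 0 ≤ x → ∫ z in (0 : ℝ)..x, f' z = f x - f 0) : IsDer f f' := by
  intro y hy
  have h1 := ((hf'.integral_hasStrictDerivAt 0 y).hasDerivAt).add_const (f 0)
  refine h1.congr_of_eventuallyEq ?_
  filter_upwards [Ioi_mem_nhds hy] with x hx
  rw [h x (le_of_lt hx)]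
  ring

/-- In the integrated form `∫₀^x f' = f x - f 0`, being a derivative is a relation between
continuous linear functionals, which commute with the Bochner integral. -/
theorem isDer_intervalIntegral {F G : ℝ → BC β} {a b : ℝ} (hab : a ≤ b)
    (hF : IntervalIntegrable F volume a b) (hG : IntervalIntegrable G volume a b)
    (h : ∀ s ∈ Ioc a b, IsDer (toC (F s)) (toC (G s))) :
    IsDer (toC (∫ s in a..b, F s)) (toC (∫ s in a..b, G s)) := by
  refine isDer_of_integral_eq (toC _).continuous fun x hx => ?_
  have e1 : primAt x (∫ s in a..b, G s) = ∫ s in a..b, primAt x (G s) :=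
    ((primAt x).intervalIntegral_comp_comm hG).symm
  have e2 : ∀ x, evalBC x (∫ s in a..b, F s) = ∫ s in a..b, evalBC x (F s) := fun x =>
    ((evalBC x).intervalIntegral_comp_comm hF).symm
  have i2 : ∀ x, IntervalIntegrable (fun s => evalBC x (F s)) volume a b := fun x =>
    ⟨(evalBC x).integrable_comp hF.1, (evalBC x).integrable_comp hF.2⟩
  rw [← primAt_apply, e1, ← evalBC_apply, ← evalBC_apply, e2, e2,
    ← intervalIntegral.integral_sub (i2 x) (i2 0)]
  rw [intervalIntegral.integral_of_le hab, intervalIntegral.integral_of_le hab]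
  refine setIntegral_congr_fun measurableSet_Ioc fun s hs => ?_
  exact (h s hs).integral_eq (toC (F s)).continuous.continuousOn (toC (G s)).continuous hx

/-- `f` is constant to the left of `0`. -/
def IsExt (f : ℝ → ℝ) : Prop := ∀ x, f x = f (max x 0)

/-- Derivatives and limits at the initial time are available only at interior points. Continuity at
`0` and constancy to its left supply the rest. -/
theorem BC.ext_pos {f g : BC β} (hf : IsExt (toC f)) (hg : IsExt (toC g))
    (h : ∀ x, 0 < x → toC f x = toC g x) : f = g := by
  have h0 : toC f 0 = toC g 0 := by
    have h1 : Tendsto (toC f) (𝓝[>] 0) (𝓝 (toC f 0)) :=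
      ((toC f).continuous.tendsto 0).mono_left nhdsWithin_le_nhds
    have h2 : Tendsto (toC g) (𝓝[>] 0) (𝓝 (toC g 0)) :=
      ((toC g).continuous.tendsto 0).mono_left nhdsWithin_le_nhds
    refine tendsto_nhds_unique h1 (h2.congr' ?_)
    filter_upwards [self_mem_nhdsWithin] with x hx using (h x hx).symm
  refine BC.ext fun x => ?_
  rw [hf x, hg x]
  rcases (le_max_right x 0).eq_or_lt with h1 | h1
  · rw [← h1, h0]
  · exact h _ h1

theorem isExt_T (e j : ℕ) {t : ℝ} (ht : 0 < t) (f : BC β) : IsExt (toC (T β e j t f)) := fun x => by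
  rw [toC_T ht, toC_T ht, opFun, opFun, max_eq_left (le_max_right x 0)]

theorem isExt_intervalIntegral {F : ℝ → BC β} {a b : ℝ} (hab : a ≤ b)
    (hF : IntervalIntegrable F volume a b) (h : ∀ s ∈ Ioc a b, IsExt (toC (F s))) :
    IsExt (toC (∫ s in a..b, F s)) := by
  intro x
  have e2 : ∀ x, toC (∫ s in a..b, F s) x = ∫ s in a..b, toC (F s) x := fun x =>
    ((evalBC x).intervalIntegral_comp_comm hF).symm
  rw [e2, e2, intervalIntegral.integral_of_le hab, intervalIntegral.integral_of_le hab]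
  exact setIntegral_congr_fun measurableSet_Ioc fun s hs => h s hs x

/-! ### The semigroup in norm near the initial time -/

theorem exists_singOp_T (β : Bool) (e j : ℕ) (hj : j ≤ 3) :
    ∃ C, SingOp (T β e j) C (j / 4) := by
  obtain ⟨C, hC, h⟩ := exists_norm_T_le β e j
  refine ⟨C, continuousOn_T β e j, hC, ?_, fun t ht _ => h t ht⟩
  have : (j : ℝ) ≤ 3 := by exact_mod_cast hj
  linarith

theorem intervalIntegrable_T (e j : ℕ) (hj : j ≤ 3) (f : BC β) {t : ℝ} (ht0 : 0 ≤ t) (ht : t ≤ 1) :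
    IntervalIntegrable (fun r => T β e j r f) volume 0 t := by
  obtain ⟨C, hV⟩ := exists_singOp_T β e j hj
  exact hV.intervalIntegrable (q := fun _ => f) continuous_const ht0 ht

/-- In time the semigroup satisfies `∂_t T = -∂_x⁴ T`. One of the four derivatives is moved to `f`,
which leaves the integrable singularity `r ^ (-3/4)` and allows integration down to time `0`. -/
theorem T_sub_eq (e : ℕ) {f f' : BC β} (hder : IsDer (toC f) (toC f')) (hext : IsExt (toC f))
    (h0 : toC f 0 = 0 ∨ mode (3 * (e + 1)) 0 = 0) {t : ℝ} (ht0 : 0 < t) (ht : t ≤ 1) :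
    T β e 0 t f = f - ∫ r in (0 : ℝ)..t, T β (e + 1) 3 r f' := by
  have hint := intervalIntegrable_T (e + 1) 3 le_rfl f' ht0.le ht
  refine BC.ext_pos (isExt_T e 0 ht0 f) ?_ fun x hx => ?_
  · intro x
    rw [map_sub, BoundedContinuousFunction.coe_sub, Pi.sub_apply, Pi.sub_apply, ← hext x,
      ← isExt_intervalIntegral ht0.le hint (fun s hs => isExt_T _ _ hs.1 _) x]
  -- At `r = 0` the kernel formula is not the identity, so the value `toC f x` is prescribed there.
  -- `tendsto_T_zero` makes the result continuous.
  · let φ : ℝ → ℝ := fun r => if r ≤ 0 then toC f x else toC (T β e 0 r f) x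
    have hφ : ∀ r, 0 < r → φ r = toC (T β e 0 r f) x := fun r hr => if_neg (not_le.2 hr)
    have hd : ∀ r, 0 < r → HasDerivAt φ (-(toC (T β (e + 1) 3 r f') x)) r := by
      intro r hr
      have h1 := hasDerivAt_T_time e 0 hr f x
      rw [zero_add, toC_T_succ e 3 hr f f' hder h0] at h1
      refine h1.congr_of_eventuallyEq ?_
      filter_upwards [Ioi_mem_nhds hr] with s hs using hφ s hs
    have hc : ContinuousOn φ (Icc 0 t) := by
      intro r hr
      rcases hr.1.eq_or_lt with h1 | h1
      · subst h1
        have h2 : ContinuousWithinAt φ (Ioi 0) 0 := by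
          have := tendsto_T_zero e f hx
          rw [ContinuousWithinAt, show φ 0 = toC f x from if_pos le_rfl]
          refine this.congr' ?_
          filter_upwards [self_mem_nhdsWithin] with s hs using (hφ s hs).symm
        exact (continuousWithinAt_Ioi_iff_Ici.1 h2).mono Icc_subset_Ici_self
      · exact (hd r h1).continuousAt.continuousWithinAt
    have hi : IntervalIntegrable (fun r => -(toC (T β (e + 1) 3 r f') x)) volume 0 t :=
      IntervalIntegrable.neg (f := fun r => evalBC x (T β (e + 1) 3 r f'))
        ⟨(evalBC x).integrable_comp hint.1, (evalBC x).integrable_comp hint.2⟩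
    have key := intervalIntegral.integral_eq_sub_of_hasDerivAt_of_le ht0.le hc
      (fun r hr => hd r hr.1) hi
    rw [intervalIntegral.integral_neg, hφ t ht0, show φ 0 = toC f x from if_pos le_rfl] at key
    rw [map_sub, BoundedContinuousFunction.coe_sub, Pi.sub_apply]
    have e2 : toC (∫ r in (0 : ℝ)..t, T β (e + 1) 3 r f') x =
        ∫ r in (0 : ℝ)..t, toC (T β (e + 1) 3 r f') x :=
      ((evalBC x).intervalIntegral_comp_comm hint).symm
    rw [e2]
    linarith

/-- The constant `1` has zero derivative, so `T_sub_eq` shows that the semigroup fixes it. As it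
neither vanishes at `0` nor is integrable, the trace of the kernel must vanish and the space of
bounded functions is used. -/
theorem mass_eq_one (e : ℕ) (he : mode (3 * (e + 1)) 0 = 0) {t x : ℝ} (ht0 : 0 < t) (ht : t ≤ 1)
    (hx : 0 ≤ x) : ∫ y in Ici 0, kT e 0 t x y = 1 := by
  let f : BC false := mkBC (BoundedContinuousFunction.const ℝ 1) integrable_zero_measure
  have h1 := T_sub_eq (β := false) e (f := f) (f' := 0) (fun y _ => hasDerivAt_const y (1 : ℝ))
    (fun x => rfl) (Or.inr he) ht0 ht
  have h2 := congrArg (fun g => toC g x) h1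
  simp only [map_zero, intervalIntegral.integral_zero, sub_zero] at h2
  rw [toC_T ht0, opFun_of_nonneg _ _ hx] at h2
  have h3 : ∀ y, toC f y = 1 := fun y => rfl
  simpa only [h3, mul_one] using h2

theorem tendsto_T_of_der (e : ℕ) {f f' : BC β} (hder : IsDer (toC f) (toC f'))
    (hext : IsExt (toC f)) (h0 : toC f 0 = 0 ∨ mode (3 * (e + 1)) 0 = 0) :
    Tendsto (fun t => T β e 0 t f) (𝓝[>] 0) (𝓝 f) := by
  obtain ⟨C, hV⟩ := exists_singOp_T β (e + 1) 3 le_rfl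
  have h1 : ContinuousWithinAt (conv (T β (e + 1) 3) fun _ => f') (Icc 0 1) 0 :=
    hV.continuousOn_conv (q := fun _ => f') continuous_const 0 ⟨le_rfl, zero_le_one⟩
  have h2 : Tendsto (conv (T β (e + 1) 3) fun _ => f') (𝓝[>] 0) (𝓝 0) := by
    have := h1.mono_left (nhdsWithin_le_iff.2 (Icc_mem_nhdsGT one_pos))
    rwa [conv_zero] at this
  have h3 := (tendsto_const_nhds (x := f)).sub h2
  rw [sub_zero] at h3
  refine h3.congr' ?_
  filter_upwards [Ioc_mem_nhdsGT one_pos] with t ht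
  rw [T_sub_eq e hder hext h0 ht.1 ht.2, conv]

theorem isDer_conv_T (e j : ℕ) (hj : j ≤ 2) {q : ℝ → BC β} (hq : Continuous q) {t : ℝ}
    (ht0 : 0 ≤ t) (ht : t ≤ 1) :
    IsDer (toC (conv (T β e j) q t)) (toC (conv (T β e (j + 1)) q t)) := by
  obtain ⟨C, hV⟩ := exists_singOp_T β e j (by omega)
  obtain ⟨C', hV'⟩ := exists_singOp_T β e (j + 1) (by omega)
  exact isDer_intervalIntegral ht0 (hV.intervalIntegrable hq ht0 ht)
    (hV'.intervalIntegrable hq ht0 ht) fun s hs y hy => hasDerivAt_T e j hs.1 _ hy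

theorem toC_conv_T (e j : ℕ) (hj : j ≤ 3) {q : ℝ → BC β} (hq : Continuous q) {t : ℝ}
    (ht0 : 0 ≤ t) (ht : t ≤ 1) (x : ℝ) :
    toC (conv (T β e j) q t) x = ∫ s in (0 : ℝ)..t, toC (T β e j s (q (t - s))) x := by
  obtain ⟨C, hV⟩ := exists_singOp_T β e j hj
  exact ((evalBC x).intervalIntegral_comp_comm (hV.intervalIntegrable hq ht0 ht)).symm

theorem isExt_conv_T (e j : ℕ) (hj : j ≤ 3) {q : ℝ → BC β} (hq : Continuous q) {t : ℝ}
    (ht0 : 0 ≤ t) (ht : t ≤ 1) : IsExt (toC (conv (T β e j) q t)) := by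
  obtain ⟨C, hV⟩ := exists_singOp_T β e j hj
  exact isExt_intervalIntegral ht0 (hV.intervalIntegrable hq ht0 ht) fun s hs => isExt_T _ _ hs.1 _

theorem conv_T_succ (e j : ℕ) {q q' : ℝ → BC β} {t : ℝ} (ht0 : 0 ≤ t)
    (hder : ∀ s ∈ Icc 0 t, IsDer (toC (q s)) (toC (q' s)))
    (h0 : (∀ s ∈ Icc 0 t, toC (q s) 0 = 0) ∨ mode (3 * (e + 1)) 0 = 0) :
    conv (T β e (j + 1)) q t = conv (T β (e + 1) j) q' t := by
  rw [conv, conv, intervalIntegral.integral_of_le ht0, intervalIntegral.integral_of_le ht0]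
  refine setIntegral_congr_fun measurableSet_Ioc fun s hs => ?_
  have hs' : t - s ∈ Icc 0 t := ⟨by linarith [hs.2], by linarith [hs.1]⟩
  exact BC.ext fun x => toC_T_succ e j hs.1 _ _ (hder _ hs')
    (h0.imp (fun h => h _ hs') id) x

theorem forget_conv_T (e j : ℕ) (hj : j ≤ 3) {q : ℝ → BC β} (hq : Continuous q) {t : ℝ}
    (ht0 : 0 ≤ t) (ht : t ≤ 1) :
    forget (conv (T β e j) q t) = conv (T false e j) (fun s => forget (q s)) t := by
  obtain ⟨C, hV⟩ := exists_singOp_T β e j hj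
  rw [conv, conv, ← forget.intervalIntegral_comp_comm (hV.intervalIntegrable hq ht0 ht)]
  rw [intervalIntegral.integral_of_le ht0, intervalIntegral.integral_of_le ht0]
  exact setIntegral_congr_fun measurableSet_Ioc fun s hs => forget_T hs.1 _

end

section

variable {β : Bool}

/-! ### Strong continuity when the derivative is only bounded -/

theorem integrableOn_toC (f : BC true) : IntegrableOn (toC f) (Ici 0) := integrable_toC f

/-- Both `f²` and its derivative `2 f f'` are integrable, because `f` is integrable and `f`, `f'`
are bounded. Hence `f²` tends to zero. -/
theorem tendsto_zero_of_isDer (f : BC true) (f' : BC β) (h : IsDer (toC f) (toC f')) :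
    Tendsto (toC f) atTop (𝓝 0) := by
  have i0 : IntegrableOn (toC f) (Ioi 0) := (integrableOn_toC f).mono_set Ioi_subset_Ici_self
  have hb : ∀ (g : ℝ →ᵇ ℝ), IntegrableOn (fun x => g x * toC f x) (Ioi 0) := fun g =>
    i0.bdd_mul (c := ‖g‖) g.continuous.aestronglyMeasurable
      (Eventually.of_forall g.norm_coe_le_norm)
  have h1 := tendsto_zero_of_hasDerivAt_of_integrableOn_Ioi (a := 0)
    (f := fun x => toC f x * toC f x)
    (f' := fun x => toC f' x * toC f x + toC f' x * toC f x)
    (fun x hx => by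
      refine ((h x hx).mul (h x hx)).congr_deriv ?_
      ring) ((hb (toC f')).add (hb (toC f'))) (hb (toC f))
  have h2 := h1.sqrt
  simp only [Real.sqrt_mul_self_eq_abs, Real.sqrt_zero] at h2
  exact tendsto_zero_iff_abs_tendsto_zero _ |>.2 h2

/-- The cut-off `x ↦ exp (-ε * x)` on the half-line. -/
def expCut (ε : ℝ) (hε : 0 ≤ ε) : ℝ →ᵇ ℝ :=
  BoundedContinuousFunction.ofNormedAddCommGroup (fun x => Real.exp (-(ε * max x 0)))
    (by fun_prop) 1 fun x => by
      rw [Real.norm_of_nonneg (Real.exp_pos _).le, Real.exp_le_one_iff]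
      have := mul_nonneg hε (le_max_right x 0)
      linarith

/-- Multiplication by `exp (-ε x)` makes the derivative integrable and keeps the value at `0`.
Closeness in L¹ is dominated convergence; uniform closeness uses the decay of `f` at infinity. -/
theorem exists_isDer_approx (f : BC true) (f' : BC false) (hder : IsDer (toC f) (toC f'))
    (hext : IsExt (toC f)) {δ : ℝ} (hδ : 0 < δ) : ∃ g g' : BC true, IsDer (toC g) (toC g') ∧
      IsExt (toC g) ∧ toC g 0 = toC f 0 ∧ ‖g - f‖ ≤ δ := by
  have hlim := tendsto_zero_of_isDer f f' hder
  obtain ⟨Y, hY0, hY⟩ : ∃ Y : ℝ, 0 < Y ∧ ∀ y, Y ≤ y → |toC f y| ≤ δ := by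
    obtain ⟨Y, hY⟩ := eventually_atTop.1 (hlim.abs.eventually (ge_mem_nhds (by simpa using hδ)))
    exact ⟨max Y 1, by positivity, fun y hy => hY y ((le_max_left _ _).trans hy)⟩
  have hcut : ∀ ε : ℝ, 0 ≤ ε → ∀ x, |Real.exp (-(ε * max x 0)) - 1| ≤ min 1 (ε * max x 0) := by
    intro ε hε x
    have h0 := mul_nonneg hε (le_max_right x 0)
    have h1 : Real.exp (-(ε * max x 0)) ≤ 1 := Real.exp_le_one_iff.2 (by linarith)
    have h2 := Real.add_one_le_exp (-(ε * max x 0))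
    have h3 := Real.exp_pos (-(ε * max x 0))
    rw [abs_of_nonpos (by linarith)]
    exact le_min (by linarith) (by linarith)
  have hL : Tendsto (fun ε : ℝ => ∫ x in Ici 0, |Real.exp (-(ε * max x 0)) - 1| * |toC f x|)
      (𝓝[>] 0) (𝓝 0) := by
    have h1 : Tendsto (fun ε : ℝ => ∫ x in Ici 0, |Real.exp (-(ε * max x 0)) - 1| * |toC f x|)
        (𝓝[>] 0) (𝓝 (∫ x in Ici (0 : ℝ), (0 : ℝ))) := by
      refine tendsto_integral_filter_of_dominated_convergence (fun x => |toC f x|) ?_ ?_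
        (integrableOn_toC f).abs ?_
      · exact Eventually.of_forall fun ε =>
          ((by fun_prop : Continuous fun x : ℝ => |Real.exp (-(ε * max x 0)) - 1|).mul
            (toC f).continuous.abs).aestronglyMeasurable
      · filter_upwards [self_mem_nhdsWithin] with ε hε
        refine Eventually.of_forall fun x => ?_
        rw [norm_mul, Real.norm_eq_abs, Real.norm_eq_abs, abs_abs, abs_abs]
        exact mul_le_of_le_one_left (abs_nonneg _)
          ((hcut ε (le_of_lt hε) x).trans (min_le_left _ _))
      · refine Eventually.of_forall fun x => ?_
        have : Continuous fun ε : ℝ => |Real.exp (-(ε * max x 0)) - 1| * |toC f x| := by fun_prop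
        have h2 := (this.tendsto 0).mono_left (nhdsWithin_le_nhds (s := Ioi 0))
        simpa using h2
    simpa using h1
  have hε1 : ∀ᶠ ε : ℝ in 𝓝[>] 0, ε * (Y * ‖f‖) < δ := by
    have : Continuous fun ε : ℝ => ε * (Y * ‖f‖) := by fun_prop
    have h2 := (this.tendsto 0).mono_left (nhdsWithin_le_nhds (s := Ioi 0))
    rw [zero_mul] at h2
    exact h2.eventually (gt_mem_nhds hδ)
  obtain ⟨ε, hε, h1, h2⟩ :=
    ((eventually_mem_nhdsWithin (s := Ioi (0 : ℝ)) (a := 0)).and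
      (hε1.and (hL.eventually (gt_mem_nhds hδ)))).exists
  have hε0 : (0 : ℝ) < ε := hε
  let E := expCut ε hε0.le
  have hE : ∀ x, E x = Real.exp (-(ε * max x 0)) := fun x => rfl
  have hEi : IntegrableOn E (Ici 0) := by
    rw [integrableOn_Ici_iff_integrableOn_Ioi]
    refine (integrableOn_exp_mul_Ioi (a := -ε) (by linarith) 0).congr_fun (fun x hx => ?_)
      measurableSet_Ioi
    have hx0 : (0 : ℝ) < x := hx
    simp only [hE, max_eq_left hx0.le, neg_mul]
  let B := toC f' - ε • toC f
  have hi' : Integrable (E * B) (meas true) := by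
    have := Integrable.bdd_mul (f := B) (c := ‖B‖) hEi B.continuous.aestronglyMeasurable
      (Eventually.of_forall B.norm_coe_le_norm)
    rw [mul_comm]
    exact this
  refine ⟨mulBC E f, mkBC (E * B) hi', fun y hy => ?_, fun x => ?_, ?_, ?_⟩
  · have h3 : HasDerivAt E (-ε * Real.exp (-ε * y)) y := by
      have h4 := ((hasDerivAt_id y).const_mul (-ε)).exp
      refine (h4.congr_of_eventuallyEq ?_).congr_deriv (by simp [mul_comm])
      filter_upwards [Ioi_mem_nhds hy] with x hx
      rw [hE, max_eq_left (le_of_lt hx), neg_mul, id]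
    refine (h3.mul (hder y hy)).congr_deriv ?_
    change _ = E y * (toC f' y - ε * toC f y)
    rw [hE, max_eq_left hy.le, neg_mul]
    ring_nf
  · rw [toC_mulBC, toC_mulBC, hE, hE, max_eq_left (le_max_right x 0), ← hext x]
  · rw [toC_mulBC, hE]; simp
  · have e1 : ∀ x, toC (mulBC E f - f) x = (Real.exp (-(ε * max x 0)) - 1) * toC f x := by
      intro x
      rw [map_sub, BoundedContinuousFunction.coe_sub, Pi.sub_apply, toC_mulBC, hE]; ring
    refine norm_BC_le hδ.le (fun x => ?_) ?_
    · rw [e1, abs_mul]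
      -- Beyond `Y` the function is already small. Before `Y` the cut-off differs from one by at
      -- most `ε * Y`.
      rcases le_total Y (max x 0) with hx | hx
      · have h3 := (hcut ε hε0.le x).trans (min_le_left _ _)
        rw [hext x]
        calc _ ≤ 1 * δ := mul_le_mul h3 (hY _ hx) (abs_nonneg _) zero_le_one
          _ = δ := one_mul δ
      · have h3 := (hcut ε hε0.le x).trans (min_le_right _ _)
        calc _ ≤ ε * max x 0 * ‖f‖ := mul_le_mul h3 (abs_toC_le f x) (abs_nonneg _) (by positivity)
          _ ≤ ε * Y * ‖f‖ := by gcongr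
          _ ≤ δ := by linarith
    · simp only [e1, abs_mul]
      exact h2.le

/-- A density argument based on the uniform bound for the operators `T true e 0 t`. It is needed for
the fourth derivative of the datum, whose derivative is bounded but not assumed integrable. -/
theorem tendsto_T_of_bdd_der (e : ℕ) {f : BC true} {f' : BC false}
    (hder : IsDer (toC f) (toC f')) (hext : IsExt (toC f))
    (h0 : toC f 0 = 0 ∨ mode (3 * (e + 1)) 0 = 0) :
    Tendsto (fun t => T true e 0 t f) (𝓝[>] 0) (𝓝 f) := by
  obtain ⟨C, hC, h⟩ := exists_norm_T_le true e 0
  rw [Metric.tendsto_nhds]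
  intro ε hε
  obtain ⟨g, g', hg, hge, hg0, hgf⟩ := exists_isDer_approx f f' hder hext
    (δ := ε / (2 * (C + 2))) (by positivity)
  have h1 := tendsto_T_of_der e hg hge (by rwa [hg0])
  filter_upwards [(Metric.tendsto_nhds.1 h1) (ε / 2) (by positivity), self_mem_nhdsWithin]
    with t ht1 ht
  have hn : ‖T true e 0 t‖ ≤ C := by
    refine (h t ht).trans_eq ?_
    simp
  rw [dist_eq_norm] at ht1 ⊢
  have e1 : T true e 0 t f - f = (T true e 0 t g - g) + ((g - f) - T true e 0 t (g - f)) := by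
    rw [map_sub]; abel
  have h2 : ‖T true e 0 t (g - f)‖ ≤ C * ‖g - f‖ := (T true e 0 t).le_of_opNorm_le hn _
  have h3 := norm_add_le (T true e 0 t g - g) ((g - f) - T true e 0 t (g - f))
  have h4 := norm_sub_le (g - f) (T true e 0 t (g - f))
  have h5 : ‖g - f‖ * (2 * (C + 2)) ≤ ε := by rwa [← le_div_iff₀ (by positivity)]
  rw [e1]
  have h6 := norm_nonneg (g - f)
  have h7 := norm_nonneg (T true e 0 t g - g)
  rcases h6.eq_or_lt with h8 | h8
  · rw [← h8] at h2 h4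
    linarith
  · nlinarith

end

section

variable {β : Bool}

/-! ### Derivatives on the half-line -/

theorem D_zero (f : ℝ → ℝ) : D 0 f = f := by
  ext x; exact congrFun iteratedDerivWithin_zero x

theorem D_congr (k : ℕ) {f g : ℝ → ℝ} (h : ∀ y, 0 ≤ y → f y = g y) :
    ∀ y, 0 ≤ y → D k f y = D k g y := fun _ hy =>
  iteratedDerivWithin_congr (s := Ici 0) (fun _ hx => h _ hx) hy

theorem MemC.continuousOn {m k : ℕ} {f : ℝ → ℝ} (hf : MemC m f) (hk : k ≤ m) :
    ContinuousOn (D k f) (Ici 0) :=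
  hf.1.continuousOn_iteratedDerivWithin (by exact_mod_cast hk) (uniqueDiffOn_Ici 0)

theorem MemC.hasDerivWithinAt {m k : ℕ} {f : ℝ → ℝ} (hf : MemC m f) (hk : k < m) {y : ℝ}
    (hy : 0 ≤ y) : HasDerivWithinAt (D k f) (D (k + 1) f y) (Ici 0) y := by
  have h := hf.1.differentiableOn_iteratedDerivWithin (m := k) (by exact_mod_cast hk)
    (uniqueDiffOn_Ici 0) y hy
  have := h.hasDerivWithinAt
  rwa [← iteratedDerivWithin_succ] at this

theorem MemC.isDer {m k : ℕ} {f : ℝ → ℝ} (hf : MemC m f) (hk : k < m) :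
    IsDer (D k f) (D (k + 1) f) := fun _ hy =>
  (hf.hasDerivWithinAt hk hy.le).hasDerivAt (Ici_mem_nhds hy)

/-- At the endpoint the one-sided derivative is the limit of the interior derivatives, which exists
because `f'` is continuous up to `0`. -/
theorem IsDer.hasDerivWithinAt {f f' : ℝ → ℝ} (h : IsDer f f') (hf : ContinuousOn f (Ici 0))
    (hf' : ContinuousOn f' (Ici 0)) {y : ℝ} (hy : 0 ≤ y) :
    HasDerivWithinAt f (f' y) (Ici 0) y := by
  rcases hy.eq_or_lt with rfl | hy
  · refine hasDerivWithinAt_Ici_of_tendsto_deriv (s := Ioi 0)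
      (fun y hy => (h y hy).differentiableAt.differentiableWithinAt)
      ((hf 0 self_mem_Ici).mono Ioi_subset_Ici_self) self_mem_nhdsWithin ?_
    refine ((hf' 0 self_mem_Ici).mono Ioi_subset_Ici_self).tendsto.congr' ?_
    filter_upwards [self_mem_nhdsWithin] with x hx using (h x hx).deriv.symm
  · exact (h y hy).hasDerivWithinAt

theorem D_eq_of_chain {n : ℕ} {F : ℕ → ℝ → ℝ} (hc : ∀ k ≤ n, ContinuousOn (F k) (Ici 0))
    (hd : ∀ k < n, IsDer (F k) (F (k + 1))) :
    ∀ k ≤ n, ∀ y, 0 ≤ y → D k (F 0) y = F k y := by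
  intro k
  induction k with
  | zero => intro _ y _; rw [D_zero]
  | succ k ih =>
    intro hk y hy
    have h1 := (hd k hk).hasDerivWithinAt (hc k (by omega)) (hc (k + 1) hk) hy
    have h2 : HasDerivWithinAt (D k (F 0)) (F (k + 1) y) (Ici 0) y :=
      h1.congr (fun x hx => ih (by omega) x hx) (ih (by omega) y hy)
    rw [D, iteratedDerivWithin_succ]
    exact h2.derivWithin (uniqueDiffOn_Ici 0 y hy)

theorem contDiffOn_of_chain {n : ℕ} {F : ℕ → ℝ → ℝ} (hc : ∀ k ≤ n, ContinuousOn (F k) (Ici 0))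
    (hd : ∀ k < n, IsDer (F k) (F (k + 1))) : ContDiffOn ℝ n (F 0) (Ici 0) := by
  have h := D_eq_of_chain hc hd
  refine contDiffOn_of_continuousOn_differentiableOn_deriv (n := n) (fun m hm => ?_)
    (fun m hm => ?_)
  · have hm' : m ≤ n := by exact_mod_cast hm
    exact (hc m hm').congr fun y hy => h m hm' y hy
  · have hm' : m < n := by exact_mod_cast hm
    intro y hy
    exact (((hd m hm').hasDerivWithinAt (hc m hm'.le) (hc (m + 1) hm') hy).congr
      (fun x hx => h m hm'.le x hx) (h m hm'.le y hy)).differentiableWithinAt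

/-! ### Functions on the half-line as elements of `BC` -/

/-- Bounded continuous functions on the half-line, integrable if `β` is `true`. -/
structure Admissible (β : Bool) (f : ℝ → ℝ) : Prop where
  cont : ContinuousOn f (Ici 0)
  bdd : ∃ C : ℝ, ∀ y, 0 ≤ y → |f y| ≤ C
  int : Integrable f (meas β)

open Classical in
/-- The element of `BC` defined by a function on the half-line. -/
def toBC (β : Bool) (f : ℝ → ℝ) : BC β :=
  if h : Admissible β f then
    mkBC (extC f h.cont h.bdd.choose h.bdd.choose_spec) (by
      cases β with
      | false => exact integrable_zero_measure
      | true =>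
        refine IntegrableOn.congr_fun (f := f) h.int (fun x hx => ?_) measurableSet_Ici
        exact (extC_apply f _ _ _ hx).symm)
  else 0

theorem toC_toBC {f : ℝ → ℝ} (h : Admissible β f) {x : ℝ} (hx : 0 ≤ x) : toC (toBC β f) x = f x := by
  rw [toBC, dif_pos h, toC_mkBC, extC_apply _ _ _ _ hx]

theorem isExt_toBC (f : ℝ → ℝ) : IsExt (toC (toBC β f)) := by
  intro x
  by_cases h : Admissible β f
  · rw [toBC, dif_pos h, toC_mkBC]
    change f (max x 0) = f (max (max x 0) 0)
    rw [max_eq_left (le_max_right x 0)]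
  · rw [toBC, dif_neg h]; simp

theorem isDer_toBC {β' : Bool} {f f' : ℝ → ℝ} (h : Admissible β f) (h' : Admissible β' f')
    (hd : IsDer f f') : IsDer (toC (toBC β f)) (toC (toBC β' f')) := by
  intro y hy
  rw [toC_toBC h' hy.le]
  refine (hd y hy).congr_of_eventuallyEq ?_
  filter_upwards [Ioi_mem_nhds hy] with x hx using toC_toBC h (le_of_lt hx)

theorem MemC.admissible {m k : ℕ} {f : ℝ → ℝ} (hf : MemC m f) (hk : k ≤ m) :
    Admissible false (D k f) :=
  ⟨hf.continuousOn hk, hf.2 k hk, integrable_zero_measure⟩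

theorem MemC.admissible_true {m n k : ℕ} {f : ℝ → ℝ} (hf : MemC m f) (hw : MemW n f) (hk : k ≤ m)
    (hn : k ≤ n) : Admissible true (D k f) :=
  ⟨hf.continuousOn hk, hf.2 k hk, hw k hn⟩

/-! ### Integration of a convolution in time -/

section Fubini

variable {E F : Type*} [NormedAddCommGroup E] [NormedSpace ℝ E] [NormedAddCommGroup F]
  [NormedSpace ℝ F] {V : ℝ → E →L[ℝ] F} {C γ : ℝ}

theorem SingOp.integral_triangle_swap (hV : SingOp V C γ) {p : ℝ → ℝ → E}
    (hp : Continuous fun x : ℝ × ℝ => p x.1 x.2) {t : ℝ} (ht0 : 0 ≤ t) (ht : t ≤ 1) :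
    ∫ s in (0 : ℝ)..t, ∫ r in (0 : ℝ)..s, V r (p s r) =
      ∫ r in (0 : ℝ)..t, ∫ s in r..t, V r (p s r) := by
  let f : ℝ → ℝ → F := fun s r => (Iic s).indicator (fun r => V r (p s r)) r
  have h1 : ∀ s ∈ Ioc 0 t, ∫ r in (0 : ℝ)..s, V r (p s r) = ∫ r in Ioc 0 t, f s r := by
    intro s hs
    rw [intervalIntegral.integral_of_le hs.1.le, setIntegral_indicator measurableSet_Iic]
    congr 2
    ext r
    simp only [mem_Ioc, mem_inter_iff, mem_Iic]
    exact ⟨fun h => ⟨⟨h.1, h.2.trans hs.2⟩, h.2⟩, fun h => ⟨h.1.1, h.2⟩⟩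
  have h2 : ∀ r ∈ Ioc 0 t, ∫ s in r..t, V r (p s r) = ∫ s in Ioc 0 t, f s r := by
    intro r hr
    have e : ∀ s, f s r = (Ici r).indicator (fun s => V r (p s r)) s := fun s => by
      simp only [f, indicator, mem_Iic, mem_Ici]
    simp only [e]
    rw [intervalIntegral.integral_of_le hr.2, setIntegral_indicator measurableSet_Ici,
      ← integral_Icc_eq_integral_Ioc]
    congr 2
    ext s
    simp only [mem_Icc, mem_Ioc, mem_inter_iff, mem_Ici]
    exact ⟨fun h => ⟨⟨hr.1.trans_le h.1, h.2⟩, h.1⟩, fun h => ⟨h.2, h.1.2⟩⟩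
  rw [intervalIntegral.integral_of_le ht0, intervalIntegral.integral_of_le ht0,
    setIntegral_congr_fun measurableSet_Ioc h1, setIntegral_congr_fun measurableSet_Ioc h2]
  refine integral_integral_swap ?_
  obtain ⟨M, hM⟩ := (isCompact_Icc.prod isCompact_Icc).exists_bound_of_continuousOn
    (s := Icc (0 : ℝ) t ×ˢ Icc (0 : ℝ) t) hp.continuousOn
  have hg : Integrable (fun r : ℝ => C * M * r ^ (-γ)) (volume.restrict (Ioc 0 t)) :=
    ((intervalIntegrable_iff_integrableOn_Ioc_of_le ht0).1
      (intervalIntegrable_rpow_neg hV.lt_one 0 t)).const_mul _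
  refine Integrable.mono' (hg.comp_snd (volume.restrict (Ioc 0 t))) ?_ ?_
  · have e : Function.uncurry f =
        {x : ℝ × ℝ | x.2 ≤ x.1}.indicator (fun x => V x.2 (p x.1 x.2)) := by
      ext x; simp only [Function.uncurry, f, indicator, mem_Iic, mem_ofPred_eq]
    rw [e, Measure.prod_restrict]
    refine AEStronglyMeasurable.indicator ?_ (measurableSet_le measurable_snd measurable_fst)
    refine ContinuousOn.aestronglyMeasurable ?_ (measurableSet_Ioc.prod measurableSet_Ioc)
    exact (hV.cont.comp continuous_snd.continuousOn fun x hx => hx.2.1).clm_apply hp.continuousOn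
  · rw [Measure.prod_restrict]
    refine (ae_restrict_iff' (measurableSet_Ioc.prod measurableSet_Ioc)).2
      (Eventually.of_forall fun x hx => ?_)
    have hM0 : 0 ≤ M := (norm_nonneg _).trans (hM (0, 0) ⟨⟨le_rfl, ht0⟩, ⟨le_rfl, ht0⟩⟩)
    simp only [Function.uncurry, f, indicator, mem_Iic]
    split_ifs
    · exact hV.norm_apply_le hx.2.1 (hx.2.2.trans ht) (hM x
        ⟨Ioc_subset_Icc_self hx.1, Ioc_subset_Icc_self hx.2⟩)
    · rw [norm_zero]
      have := Real.rpow_nonneg hx.2.1.le (-γ)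
      have := hV.nonneg
      positivity

/-- After exchanging the integrals, both sides have the inner integral `V r (∫₀^(t - r) q)`. -/
theorem SingOp.integral_conv [CompleteSpace E] [CompleteSpace F] (hV : SingOp V C γ) {q : ℝ → E}
    (hq : Continuous q) {t : ℝ} (ht0 : 0 ≤ t) (ht : t ≤ 1) :
    ∫ s in (0 : ℝ)..t, conv V q s = ∫ s in (0 : ℝ)..t, ∫ r in (0 : ℝ)..s, V r (q (t - s)) := by
  rw [hV.integral_triangle_swap (p := fun s _ => q (t - s)) (by fun_prop) ht0 ht]
  simp only [conv]
  rw [hV.integral_triangle_swap (p := fun s r => q (s - r)) (by fun_prop) ht0 ht]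
  refine intervalIntegral.integral_congr fun r _ => ?_
  have e1 : ∫ s in r..t, V r (q (s - r)) = V r (∫ s in r..t, q (s - r)) :=
    (V r).intervalIntegral_comp_comm ((by fun_prop : Continuous fun s => q (s - r)).intervalIntegrable
      _ _)
  have e2 : ∫ s in r..t, V r (q (t - s)) = V r (∫ s in r..t, q (t - s)) :=
    (V r).intervalIntegral_comp_comm ((by fun_prop : Continuous fun s => q (t - s)).intervalIntegrable
      _ _)
  simp only [e1, e2]
  rw [intervalIntegral.integral_comp_sub_left, intervalIntegral.integral_comp_sub_right, sub_self,
    sub_self]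

end Fubini

end

section

variable {β : Bool}

/-! ### Mild solutions and their regularity -/

/-- The clamped semigroup applied to the `e`-th derivative of a datum, including time `0`. -/
def free (β : Bool) (e : ℕ) (f : BC β) (t : ℝ) : BC β := if t ≤ 0 then f else T β e 0 t f

theorem free_of_pos (e : ℕ) (f : BC β) {t : ℝ} (ht : 0 < t) : free β e f t = T β e 0 t f :=
  if_neg (not_le.2 ht)

theorem free_zero (e : ℕ) (f : BC β) : free β e f 0 = f := if_pos le_rfl

theorem continuousAt_free (e : ℕ) (f : BC β) {t : ℝ} (ht : 0 < t) :
    ContinuousAt (free β e f) t := by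
  have h1 : ContinuousAt (fun t => T β e 0 t f) t :=
    ((continuousOn_T β e 0).continuousAt (Ioi_mem_nhds ht)).clm_apply continuousAt_const
  refine h1.congr ?_
  filter_upwards [Ioi_mem_nhds ht] with s hs using (free_of_pos e f hs).symm

theorem continuous_free (e : ℕ) {f : BC β}
    (h : Tendsto (fun t => T β e 0 t f) (𝓝[>] 0) (𝓝 f)) : Continuous (free β e f) := by
  rw [continuous_iff_continuousAt]
  intro t
  rcases lt_trichotomy t 0 with ht | rfl | ht
  · have h1 : ContinuousAt (fun _ : ℝ => f) t := continuousAt_const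
    refine h1.congr ?_
    filter_upwards [Iio_mem_nhds ht] with s hs using (if_pos (le_of_lt hs)).symm
  · rw [continuousAt_iff_continuous_left'_right']
    constructor
    · have h1 : ContinuousWithinAt (fun _ : ℝ => f) (Iio 0) 0 := continuousWithinAt_const
      exact h1.congr (fun s hs => if_pos (le_of_lt hs)) (free_zero e f)
    · rw [ContinuousWithinAt, free_zero]
      refine h.congr' ?_
      filter_upwards [self_mem_nhdsWithin] with s hs using (free_of_pos e f hs).symm
  · exact continuousAt_free e f ht

theorem isDer_free {β' : Bool} (e : ℕ) {f : BC β} {f' : BC β'} (hder : IsDer (toC f) (toC f'))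
    (h0 : toC f 0 = 0 ∨ mode (3 * (e + 1)) 0 = 0) (t : ℝ) :
    IsDer (toC (free β e f t)) (toC (free β' (e + 1) f' t)) := by
  rcases le_or_gt t 0 with ht | ht
  · rw [free, free, if_pos ht, if_pos ht]; exact hder
  · rw [free_of_pos e f ht, free_of_pos (e + 1) f' ht]
    intro y hy
    rw [← toC_T_succ e 0 ht f f' hder h0]
    exact hasDerivAt_T e 0 ht f hy

theorem exists_norm_free_le (β : Bool) (e : ℕ) : ∃ C : ℝ, 1 ≤ C ∧ ∀ (f : BC β) (t : ℝ),
    ‖free β e f t‖ ≤ C * ‖f‖ := by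
  obtain ⟨C, hC, h⟩ := exists_norm_T_le β e 0
  refine ⟨max C 1, le_max_right _ _, fun f t => ?_⟩
  rcases le_or_gt t 0 with ht | ht
  · rw [free, if_pos ht]
    exact le_mul_of_one_le_left (norm_nonneg f) (le_max_right _ _)
  · rw [free_of_pos e f ht]
    refine (T β e 0 t).le_of_opNorm_le ((h t ht).trans ?_) f
    simp

/-- The polarization of the nonlinearity `a ^ 2 - a_y ∫₀^y a`, in the variables `(a, a_y)`. -/
def nonlin : (BC true × BC true) →L[ℝ] (BC true × BC true) →L[ℝ] BC true :=
  (mulBC.comp toC).bilinearComp (ContinuousLinearMap.fst ℝ _ _) (ContinuousLinearMap.fst ℝ _ _) -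
    (mulBC.comp prim).bilinearComp (ContinuousLinearMap.fst ℝ _ _) (ContinuousLinearMap.snd ℝ _ _)

theorem nonlin_apply (A B : BC true × BC true) :
    nonlin A B = mulBC (toC A.1) B.1 - mulBC (prim A.1) B.2 := rfl

/-- The clamped semigroup together with its first space derivative. -/
def duhamelOp (t : ℝ) : BC true →L[ℝ] BC true × BC true := (T true 0 0 t).prod (T true 0 1 t)

theorem exists_singOp_duhamelOp : ∃ C, SingOp duhamelOp C (1 / 4) := by
  obtain ⟨C0, h0, h0'⟩ := exists_norm_T_le true 0 0
  obtain ⟨C1, h1, h1'⟩ := exists_norm_T_le true 0 1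
  refine ⟨C0 + C1, ?_, by positivity, by norm_num, fun t ht ht1 => ?_⟩
  · exact (ContinuousLinearMap.prodₗᵢ ℝ).continuous.comp_continuousOn
      ((continuousOn_T true 0 0).prodMk (continuousOn_T true 0 1))
  · refine ContinuousLinearMap.opNorm_le_bound _ ?_ fun f => ?_
    · have := Real.rpow_nonneg ht.le (-(1 / 4))
      positivity
    have hp : 1 ≤ t ^ (-(1 / 4 : ℝ)) := Real.one_le_rpow_of_pos_of_le_one_of_nonpos ht ht1 (by norm_num)
    have e0 := (T true 0 0 t).le_of_opNorm_le (h0' t ht) f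
    have e1 := (T true 0 1 t).le_of_opNorm_le (h1' t ht) f
    simp only [Nat.cast_zero, zero_div, neg_zero, Real.rpow_zero, mul_one, Nat.cast_one] at e0 e1
    have hf := norm_nonneg f
    refine (Prod.norm_def _).trans_le (max_le (e0.trans ?_) (e1.trans ?_))
    · gcongr
      nlinarith
    · gcongr
      nlinarith

theorem conv_prod {V W : ℝ → BC true →L[ℝ] BC true} {q : ℝ → BC true} {t : ℝ}
    (hV : IntervalIntegrable (fun s => V s (q (t - s))) volume 0 t)
    (hW : IntervalIntegrable (fun s => W s (q (t - s))) volume 0 t) :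
    conv (fun s => (V s).prod (W s)) q t = (conv V q t, conv W q t) := by
  have h : IntervalIntegrable (fun s => ((V s).prod (W s)) (q (t - s))) volume 0 t :=
    ⟨hV.1.prodMk hW.1, hV.2.prodMk hW.2⟩
  refine Prod.ext ?_ ?_
  · exact ((ContinuousLinearMap.fst ℝ (BC true) (BC true)).intervalIntegral_comp_comm h).symm
  · exact ((ContinuousLinearMap.snd ℝ (BC true) (BC true)).intervalIntegral_comp_comm h).symm

theorem conv_duhamelOp {q : ℝ → BC true} (hq : Continuous q) {t : ℝ} (ht0 : 0 ≤ t) (ht : t ≤ 1) :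
    conv duhamelOp q t = (conv (T true 0 0) q t, conv (T true 0 1) q t) := by
  obtain ⟨C0, h0⟩ := exists_singOp_T true 0 0 (by norm_num)
  obtain ⟨C1, h1⟩ := exists_singOp_T true 0 1 (by norm_num)
  exact conv_prod (h0.intervalIntegrable hq ht0 ht) (h1.intervalIntegrable hq ht0 ht)

theorem IsDatum.isDer {a₀ : ℝ → ℝ} (h : IsDatum a₀) {k : ℕ} (hk : k ≤ 3) :
    IsDer (toC (toBC true (D k a₀))) (toC (toBC true (D (k + 1) a₀))) :=
  isDer_toBC (h.memC.admissible_true h.memW (by omega) (by omega))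
    (h.memC.admissible_true h.memW (by omega) (by omega)) (h.memC.isDer (by omega))

theorem IsDatum.isDer_false {a₀ : ℝ → ℝ} (h : IsDatum a₀) {k : ℕ} (hk : k ≤ 5) :
    IsDer (toC (toBC false (D k a₀))) (toC (toBC false (D (k + 1) a₀))) :=
  isDer_toBC (h.memC.admissible (by omega)) (h.memC.admissible (by omega))
    (h.memC.isDer (by omega))

theorem IsDatum.isDer_mixed {a₀ : ℝ → ℝ} (h : IsDatum a₀) :
    IsDer (toC (toBC true (D 4 a₀))) (toC (toBC false (D 5 a₀))) :=
  isDer_toBC (h.memC.admissible_true h.memW (by omega) (by omega))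
    (h.memC.admissible (by omega)) (h.memC.isDer (by omega))

theorem mode_eq_zero_of_mod {n : ℕ} (h : n % 4 = 0 ∨ n % 4 = 1) : mode n 0 = 0 := by
  have h1 : ∀ m j, mode (j + 4 * m) = mode j := by
    intro m
    induction m with
    | zero => intro j; rfl
    | succ m ih =>
      intro j
      ext z
      rw [show j + 4 * (m + 1) = j + 4 * m + 4 by ring, mode_add_four, ih]
  rcases h with h | h
  · rw [show n = 0 + 4 * (n / 4) by omega, h1, mode_zero_zero]
  · rw [show n = 1 + 4 * (n / 4) by omega, h1, mode_one_zero]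

/-- The origin of the compatibility conditions. At orders 2 and 3 the traces `mode 9` and `mode 12`
vanish and the datum is free; at orders 0, 1, 4, 5 they do not, and the datum must vanish. -/
theorem IsDatum.boundary {a₀ : ℝ → ℝ} (h : IsDatum a₀) {k : ℕ} (hk : k ≤ 5) (β : Bool)
    (hβ : Admissible β (D k a₀)) :
    toC (toBC β (D k a₀)) 0 = 0 ∨ mode (3 * (k + 1)) 0 = 0 := by
  rw [toC_toBC hβ le_rfl]
  interval_cases k
  · left; rw [D_zero]; exact h.compat0
  · left; exact h.compat1
  · right; exact mode_eq_zero_of_mod (by norm_num)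
  · right; exact mode_eq_zero_of_mod (by norm_num)
  · left; exact h.compat4
  · left; exact h.compat5

theorem IsDatum.admissible {a₀ : ℝ → ℝ} (h : IsDatum a₀) {k : ℕ} (hk : k ≤ 4) :
    Admissible true (D k a₀) := h.memC.admissible_true h.memW (by omega) hk

theorem IsDatum.continuous_free {a₀ : ℝ → ℝ} (h : IsDatum a₀) {k : ℕ} (hk : k ≤ 4) :
    Continuous (free true k (toBC true (D k a₀))) := by
  refine Prandtl4.continuous_free k ?_
  have hb := h.boundary (k := k) (by omega) true (h.admissible hk)
  -- At order four the next derivative of the datum is bounded but not assumed integrable.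
  rcases hk.eq_or_lt with rfl | hk
  · exact tendsto_T_of_bdd_der 4 h.isDer_mixed (isExt_toBC _) hb
  · exact tendsto_T_of_der k (h.isDer (by omega)) (isExt_toBC _) hb

theorem IsDatum.continuous_free_false {a₀ : ℝ → ℝ} (h : IsDatum a₀) {k : ℕ} (hk : k ≤ 5) :
    Continuous (free false k (toBC false (D k a₀))) :=
  Prandtl4.continuous_free k (tendsto_T_of_der k (h.isDer_false hk) (isExt_toBC _)
    (h.boundary hk false (h.memC.admissible (by omega))))

theorem IsDer.add {f f' g g' : ℝ → ℝ} (hf : IsDer f f') (hg : IsDer g g') :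
    IsDer (fun x => f x + g x) (fun x => f' x + g' x) := fun y hy => (hf y hy).add (hg y hy)

theorem isDer_toC_add {β' : Bool} {f g : BC β} {f' g' : BC β'} (hf : IsDer (toC f) (toC f'))
    (hg : IsDer (toC g) (toC g')) : IsDer (toC (f + g)) (toC (f' + g')) := by
  rw [map_add, map_add]
  exact IsDer.add hf hg

/-- The projection to a time interval. -/
def clampTime (τ t : ℝ) : ℝ := max 0 (min t τ)

theorem clampTime_mem {τ : ℝ} (hτ : 0 ≤ τ) (t : ℝ) : clampTime τ t ∈ Icc 0 τ :=
  ⟨le_max_left _ _, max_le hτ (min_le_right _ _)⟩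

theorem clampTime_of_mem {τ t : ℝ} (ht : t ∈ Icc 0 τ) : clampTime τ t = t := by
  rw [clampTime, min_eq_left ht.2, max_eq_right ht.1]

theorem continuous_conv_clampTime {e j : ℕ} (hj : j ≤ 3) {q : ℝ → BC β} (hq : Continuous q)
    {τ : ℝ} (hτ : 0 ≤ τ) (hτ1 : τ ≤ 1) :
    Continuous fun t => conv (T β e j) q (clampTime τ t) := by
  obtain ⟨C, hV⟩ := exists_singOp_T β e j hj
  exact (hV.continuousOn_conv hq).comp_continuous
    (by unfold clampTime; fun_prop) fun t =>
      Icc_subset_Icc_right hτ1 (clampTime_mem hτ t)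

end

section

variable {β : Bool}

/-! ### Regularity of mild solutions -/

theorem toC_add_apply (f g : BC β) (x : ℝ) : toC (f + g) x = toC f x + toC g x := by
  rw [map_add]; rfl

theorem toC_sub_apply (f g : BC β) (x : ℝ) : toC (f - g) x = toC f x - toC g x := by
  rw [map_sub]; rfl

theorem toC_smul_apply (c : ℝ) (f : BC β) (x : ℝ) : toC (c • f) x = c * toC f x := by
  rw [map_smul]; rfl

theorem isExt_free (e : ℕ) {f : BC β} (hf : IsExt (toC f)) (t : ℝ) :
    IsExt (toC (free β e f t)) := by
  rcases le_or_gt t 0 with ht | ht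
  · rw [free, if_pos ht]; exact hf
  · rw [free_of_pos e f ht]; exact isExt_T e 0 ht f

theorem isExt_prim (f : BC true) : IsExt (prim f) := fun x => by
  change ∫ z in (0 : ℝ)..(max x 0), toC f z = ∫ z in (0 : ℝ)..(max (max x 0) 0), toC f z
  rw [max_eq_left (le_max_right x 0)]

theorem T_zero_zero_right (e j : ℕ) (h : mode (e + j) 0 = 0) {t : ℝ} (ht : 0 < t) (f : BC β) :
    toC (T β e j t f) 0 = 0 := by
  rw [toC_T ht, opFun]
  simp [kT, ker_zero_left j (e + j) (3 * e) h]

theorem conv_T_zero_right (e j : ℕ) (hj : j ≤ 3) (h : mode (e + j) 0 = 0) {q : ℝ → BC β}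
    (hq : Continuous q) {t : ℝ} (ht0 : 0 ≤ t) (ht : t ≤ 1) : toC (conv (T β e j) q t) 0 = 0 := by
  rw [toC_conv_T e j hj hq ht0 ht, intervalIntegral.integral_of_le ht0,
    setIntegral_congr_fun measurableSet_Ioc (g := fun _ => 0)
      fun s hs => T_zero_zero_right e j h hs.1 _, integral_zero]

theorem free_zero_right (e : ℕ) (h : mode e 0 = 0) {f : BC β} (hf : toC f 0 = 0) (t : ℝ) :
    toC (free β e f t) 0 = 0 := by
  rcases le_or_gt t 0 with ht | ht
  · rw [free, if_pos ht, hf]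
  · rw [free_of_pos e f ht]; exact T_zero_zero_right e 0 h ht f

/-- Duhamel's integral is the primitive in time of its equation. -/
theorem conv_eq_integral {q q' : ℝ → BC true} {q'' : ℝ → BC true} (hq : Continuous q)
    (hq'' : Continuous q'') {t : ℝ} (ht0 : 0 ≤ t) (ht : t ≤ 1)
    (hext : ∀ s ∈ Icc 0 t, IsExt (toC (q s)))
    (h1 : ∀ s ∈ Icc 0 t, IsDer (toC (q s)) (toC (q' s)))
    (h2 : ∀ s ∈ Icc 0 t, IsDer (toC (q' s)) (toC (q'' s)))
    (z1 : ∀ s ∈ Icc 0 t, toC (q s) 0 = 0) (z2 : ∀ s ∈ Icc 0 t, toC (q' s) 0 = 0) :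
    conv (T true 0 0) q t = ∫ s in (0 : ℝ)..t, (q s - conv (T true 2 2) q'' s) := by
  obtain ⟨C0, hV0⟩ := exists_singOp_T true 0 0 (by norm_num)
  obtain ⟨C2, hV2⟩ := exists_singOp_T true 2 2 (by norm_num)
  -- Four derivatives on the kernel would not be integrable at `r = 0`. Two of them are moved onto
  -- `q`, which leaves `T true 2 2` with the singularity `r ^ (-1/2)`.
  have e : ∀ s ∈ Ioc 0 t, T true 0 0 s (q (t - s)) =
      q (t - s) - ∫ r in (0 : ℝ)..s, T true 2 2 r (q'' (t - s)) := by
    intro s hs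
    have hs' : t - s ∈ Icc 0 t := ⟨by linarith [hs.2], by linarith [hs.1]⟩
    rw [T_sub_eq 0 (h1 _ hs') (hext _ hs') (Or.inl (z1 _ hs')) hs.1 (hs.2.trans ht)]
    congr 1
    rw [intervalIntegral.integral_of_le hs.1.le, intervalIntegral.integral_of_le hs.1.le]
    refine setIntegral_congr_fun measurableSet_Ioc fun r hr => ?_
    exact BC.ext fun x => toC_T_succ 1 2 hr.1 _ _ (h2 _ hs') (Or.inl (z2 _ hs')) x
  have i0 := hV0.intervalIntegrable hq ht0 ht
  have i1 : IntervalIntegrable (fun s => q (t - s)) volume 0 t :=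
    (by fun_prop : Continuous fun s => q (t - s)).intervalIntegrable _ _
  have i2 : IntervalIntegrable (fun s => ∫ r in (0 : ℝ)..s, T true 2 2 r (q'' (t - s))) volume 0 t := by
    refine (i1.sub i0).congr fun s hs => ?_
    rw [uIoc_of_le ht0] at hs
    rw [e s hs, sub_sub_cancel]
  have i3 : IntervalIntegrable (conv (T true 2 2) q'') volume 0 t := by
    refine ContinuousOn.intervalIntegrable_of_Icc ht0 ?_
    exact (hV2.continuousOn_conv hq'').mono (Icc_subset_Icc_right ht)
  rw [intervalIntegral.integral_sub (hq.intervalIntegrable _ _) i3, hV2.integral_conv hq'' ht0 ht,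
    conv, intervalIntegral.integral_congr_ae (g := fun s =>
      q (t - s) - ∫ r in (0 : ℝ)..s, T true 2 2 r (q'' (t - s))) ?_,
    intervalIntegral.integral_sub i1 i2]
  · congr 1
    rw [intervalIntegral.integral_comp_sub_left, sub_self, sub_zero]
  · refine Eventually.of_forall fun s hs => ?_
    rw [uIoc_of_le ht0] at hs
    exact e s hs

/-- A curve of functions on `[0, τ]` together with its space derivatives, solving the equation. -/
structure SolCurve (a₀ : ℝ → ℝ) (τ : ℝ) (u : ℕ → ℝ → BC true) (v : ℕ → ℝ → BC false)
    (w : ℝ → BC false) : Prop where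
  cont_u : ∀ k ≤ 4, Continuous (u k)
  cont_v : ∀ k ≤ 5, Continuous (v k)
  cont_w : Continuous w
  forget_u : ∀ k ≤ 4, ∀ t, forget (u k t) = v k t
  der : ∀ k < 6, ∀ t ∈ Icc 0 τ, IsDer (toC (v k t)) (toC (v (k + 1) t))
  six : ∀ t, v 6 t = free false 6 (toBC false (D 6 a₀)) t + w t
  initial : u 0 0 = toBC true a₀
  boundary0 : ∀ t ∈ Icc 0 τ, toC (u 0 t) 0 = 0
  boundary1 : ∀ t ∈ Icc 0 τ, toC (u 1 t) 0 = 0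
  equation : ∀ t ∈ Ioo 0 τ, ∀ y, 0 < y → HasDerivAt (fun s => toC (u 0 s) y)
    (-toC (u 4 t) y + (toC (u 0 t) y) ^ 2 - toC (u 1 t) y * prim (u 0 t) y) t

/-- A bootstrap in the number of derivatives. For `k ≥ 2`, the `k`-th derivative of Duhamel's
integral is the convolution of `T (k - 2) 2` with the derivative `n_(k-2)` of the nonlinearity: only
two derivatives stay on the kernel, and `n_(k-2)` involves the unknown up to order `k - 1`. In the
transfers, `n0` and `n1` vanish at the boundary because of the clamped conditions, while for `n2`
and `n3` the trace of the kernel vanishes. -/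
theorem exists_solCurve {a₀ : ℝ → ℝ} (h : IsDatum a₀) {τ : ℝ} (hτ0 : 0 ≤ τ) (hτ1 : τ ≤ 1)
    {A : ℝ → BC true × BC true} (hA : Continuous A)
    (hmild : ∀ t ∈ Icc 0 τ, A t = (free true 0 (toBC true (D 0 a₀)) t,
      free true 1 (toBC true (D 1 a₀)) t) + conv duhamelOp (fun s => nonlin (A s) (A s)) t) :
    ∃ u v w, SolCurve a₀ τ u v w := by
  have hmem : ∀ {t}, t ∈ Icc 0 τ → t ≤ 1 := fun ht => ht.2.trans hτ1
  let d : ℕ → BC true := fun k => toBC true (D k a₀)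
  let d' : ℕ → BC false := fun k => toBC false (D k a₀)
  let u0 : ℝ → BC true := fun t => (A t).1
  let u1 : ℝ → BC true := fun t => (A t).2
  let b : ℝ → ℝ →ᵇ ℝ := fun t => prim (u0 t)
  have c0 : Continuous u0 := hA.fst
  have c1 : Continuous u1 := hA.snd
  have cb : Continuous b := prim.continuous.comp c0
  have cmul : ∀ {β : Bool} {f : ℝ → ℝ →ᵇ ℝ} {g : ℝ → BC β}, Continuous f → Continuous g →
      Continuous fun t => mulBC (f t) (g t) := fun hf hg =>
    (mulBC.continuous.comp hf).clm_apply hg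
  have cC : ∀ {β : Bool} {g : ℝ → BC β}, Continuous g → Continuous fun t => toC (g t) := fun hg =>
    toC.continuous.comp hg
  let n0 : ℝ → BC true := fun t => mulBC (toC (u0 t)) (u0 t) - mulBC (b t) (u1 t)
  have cn0 : Continuous n0 := (cmul (cC c0) c0).sub (cmul cb c1)
  have hu : ∀ t ∈ Icc 0 τ, u0 t = free true 0 (d 0) t + conv (T true 0 0) n0 t ∧
      u1 t = free true 1 (d 1) t + conv (T true 0 1) n0 t := by
    intro t ht
    have h1 := hmild t ht
    rw [show (fun s => nonlin (A s) (A s)) = n0 from rfl, conv_duhamelOp cn0 ht.1 (hmem ht)] at h1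
    exact ⟨congrArg Prod.fst h1, congrArg Prod.snd h1⟩
  -- Freezing the convolution outside `[0, τ]` gives a curve that is continuous for all times.
  let u2 : ℝ → BC true := fun t => free true 2 (d 2) t + conv (T true 0 2) n0 (clampTime τ t)
  have c2 : Continuous u2 := (h.continuous_free (by norm_num)).add
    (continuous_conv_clampTime (by norm_num) cn0 hτ0 hτ1)
  have i01 : ∀ t ∈ Icc 0 τ, IsDer (toC (u0 t)) (toC (u1 t)) := by
    intro t ht
    rw [(hu t ht).1, (hu t ht).2]
    exact isDer_toC_add (isDer_free 0 (h.isDer (by norm_num)) (h.boundary (by norm_num) _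
      (h.admissible (by norm_num))) t) (isDer_conv_T 0 0 (by norm_num) cn0 ht.1 (hmem ht))
  have i12 : ∀ t ∈ Icc 0 τ, IsDer (toC (u1 t)) (toC (u2 t)) := by
    intro t ht
    simp only [u2]
    rw [(hu t ht).2, clampTime_of_mem ht]
    exact isDer_toC_add (isDer_free 1 (h.isDer (by norm_num)) (h.boundary (by norm_num) _
      (h.admissible (by norm_num))) t) (isDer_conv_T 0 1 (by norm_num) cn0 ht.1 (hmem ht))
  have z0 : ∀ t ∈ Icc 0 τ, toC (u0 t) 0 = 0 := by
    intro t ht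
    rw [(hu t ht).1, toC_add_apply, conv_T_zero_right 0 0 (by norm_num) mode_zero_zero cn0 ht.1
      (hmem ht), free_zero_right 0 mode_zero_zero, add_zero]
    rw [toC_toBC (h.admissible (by norm_num)) le_rfl, D_zero, h.compat0]
  have z1 : ∀ t ∈ Icc 0 τ, toC (u1 t) 0 = 0 := by
    intro t ht
    rw [(hu t ht).2, toC_add_apply, conv_T_zero_right 0 1 (by norm_num) mode_one_zero cn0 ht.1
      (hmem ht), free_zero_right 1 mode_one_zero, add_zero]
    rw [toC_toBC (h.admissible (by norm_num)) le_rfl, h.compat1]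
  -- Since `b_y = a`, the derivative of `a² - b a_y` is `a a_y - b a_yy`. The same cancellation
  -- gives `a_y² - b a_yyy` for `n2`.
  let n1 : ℝ → BC true := fun t => mulBC (toC (u0 t)) (u1 t) - mulBC (b t) (u2 t)
  have cn1 : Continuous n1 := (cmul (cC c0) c1).sub (cmul cb c2)
  have hn0 : ∀ t ∈ Icc 0 τ, IsDer (toC (n0 t)) (toC (n1 t)) := by
    intro t ht y hy
    simp only [n0, n1, toC_sub_apply, toC_mulBC]
    refine (((i01 t ht y hy).mul (i01 t ht y hy)).sub
      ((hasDerivAt_prim (u0 t) hy).mul (i12 t ht y hy))).congr_deriv ?_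
    ring
  have zn0 : ∀ t ∈ Icc 0 τ, toC (n0 t) 0 = 0 := fun t ht => by
    simp only [n0, toC_sub_apply, toC_mulBC, z0 t ht, z1 t ht, mul_zero, sub_zero]
  let u3 : ℝ → BC true := fun t => free true 3 (d 3) t + conv (T true 1 2) n1 (clampTime τ t)
  have c3 : Continuous u3 := (h.continuous_free (by norm_num)).add
    (continuous_conv_clampTime (by norm_num) cn1 hτ0 hτ1)
  have i23 : ∀ t ∈ Icc 0 τ, IsDer (toC (u2 t)) (toC (u3 t)) := by
    intro t ht
    simp only [u2, u3]
    have hsub : Icc 0 t ⊆ Icc 0 τ := Icc_subset_Icc_right ht.2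
    rw [clampTime_of_mem ht, ← conv_T_succ 0 2 ht.1 (fun s hs => hn0 s (hsub hs))
      (Or.inl fun s hs => zn0 s (hsub hs))]
    exact isDer_toC_add (isDer_free 2 (h.isDer (by norm_num)) (h.boundary (by norm_num) _
      (h.admissible (by norm_num))) t) (isDer_conv_T 0 2 (by norm_num) cn0 ht.1 (hmem ht))
  let n2 : ℝ → BC true := fun t => mulBC (toC (u1 t)) (u1 t) - mulBC (b t) (u3 t)
  have cn2 : Continuous n2 := (cmul (cC c1) c1).sub (cmul cb c3)
  have hn1 : ∀ t ∈ Icc 0 τ, IsDer (toC (n1 t)) (toC (n2 t)) := by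
    intro t ht y hy
    simp only [n1, n2, toC_sub_apply, toC_mulBC]
    refine (((i01 t ht y hy).mul (i12 t ht y hy)).sub
      ((hasDerivAt_prim (u0 t) hy).mul (i23 t ht y hy))).congr_deriv ?_
    ring
  have zn1 : ∀ t ∈ Icc 0 τ, toC (n1 t) 0 = 0 := fun t ht => by
    simp only [n1, toC_sub_apply, toC_mulBC, z0 t ht, b, prim_zero, zero_mul, sub_zero]
  let u4 : ℝ → BC true := fun t => free true 4 (d 4) t + conv (T true 2 2) n2 (clampTime τ t)
  have c4 : Continuous u4 := (h.continuous_free (by norm_num)).add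
    (continuous_conv_clampTime (by norm_num) cn2 hτ0 hτ1)
  have i34 : ∀ t ∈ Icc 0 τ, IsDer (toC (u3 t)) (toC (u4 t)) := by
    intro t ht
    simp only [u3, u4]
    have hsub : Icc 0 t ⊆ Icc 0 τ := Icc_subset_Icc_right ht.2
    rw [clampTime_of_mem ht, ← conv_T_succ 1 2 ht.1 (fun s hs => hn1 s (hsub hs))
      (Or.inl fun s hs => zn1 s (hsub hs))]
    exact isDer_toC_add (isDer_free 3 (h.isDer (by norm_num)) (h.boundary (by norm_num) _
      (h.admissible (by norm_num))) t) (isDer_conv_T 1 2 (by norm_num) cn1 ht.1 (hmem ht))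
  let n3 : ℝ → BC true := fun t => mulBC (toC (u1 t)) (u2 t) + mulBC (toC (u1 t)) (u2 t) -
    mulBC (b t) (u4 t) - mulBC (toC (u3 t)) (u0 t)
  have cn3 : Continuous n3 := (((cmul (cC c1) c2).add (cmul (cC c1) c2)).sub (cmul cb c4)).sub
    (cmul (cC c3) c0)
  have hn2 : ∀ t ∈ Icc 0 τ, IsDer (toC (n2 t)) (toC (n3 t)) := by
    intro t ht y hy
    simp only [n2, n3, toC_sub_apply, toC_add_apply, toC_mulBC]
    refine (((i12 t ht y hy).mul (i12 t ht y hy)).sub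
      ((hasDerivAt_prim (u0 t) hy).mul (i34 t ht y hy))).congr_deriv ?_
    ring
  -- The fifth derivative of the datum is not assumed integrable, so orders five and six are treated
  -- in the uniform norm.
  let u5 : ℝ → BC false := fun t => free false 5 (d' 5) t +
    conv (T false 3 2) (fun s => forget (n3 s)) (clampTime τ t)
  have c5 : Continuous u5 := (h.continuous_free_false (by norm_num)).add
    (continuous_conv_clampTime (by norm_num) (forget.continuous.comp cn3) hτ0 hτ1)
  have i45 : ∀ t ∈ Icc 0 τ, IsDer (toC (u4 t)) (toC (u5 t)) := by
    intro t ht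
    simp only [u4, u5]
    have hsub : Icc 0 t ⊆ Icc 0 τ := Icc_subset_Icc_right ht.2
    rw [clampTime_of_mem ht, ← forget_conv_T 3 2 (by norm_num) cn3 ht.1 (hmem ht),
      ← conv_T_succ 2 2 ht.1 (fun s hs => hn2 s (hsub hs))
      (Or.inr (mode_eq_zero_of_mod (by norm_num)))]
    exact isDer_toC_add (isDer_free 4 h.isDer_mixed (h.boundary (by norm_num) _
      (h.admissible (by norm_num))) t) (isDer_conv_T 2 2 (by norm_num) cn2 ht.1 (hmem ht))
  let n4 : ℝ → BC false := fun t => mulBC (toC (u2 t)) (forget (u2 t)) +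
    mulBC (toC (u2 t)) (forget (u2 t)) + mulBC (toC (u1 t)) (forget (u3 t)) -
    mulBC (toC (u4 t)) (forget (u0 t)) - mulBC (toC (u4 t)) (forget (u0 t)) - mulBC (b t) (u5 t)
  have cF : ∀ {g : ℝ → BC true}, Continuous g → Continuous fun t => forget (g t) := fun hg =>
    forget.continuous.comp hg
  have cn4 : Continuous n4 := (((((cmul (cC c2) (cF c2)).add (cmul (cC c2) (cF c2))).add
    (cmul (cC c1) (cF c3))).sub (cmul (cC c4) (cF c0))).sub (cmul (cC c4) (cF c0))).sub
    (cmul cb c5)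
  have hn3 : ∀ t ∈ Icc 0 τ, IsDer (toC (forget (n3 t))) (toC (n4 t)) := by
    intro t ht y hy
    rw [toC_forget]
    simp only [n3, n4, toC_sub_apply, toC_mulBC, toC_add_apply, toC_forget]
    have e12 := (i12 t ht y hy).mul (i23 t ht y hy)
    refine (((e12.add e12).sub
      ((hasDerivAt_prim (u0 t) hy).mul (i45 t ht y hy))).sub
      ((i34 t ht y hy).mul (i01 t ht y hy))).congr_deriv ?_
    ring
  -- At order six the Duhamel part is kept apart: it is continuous in norm up to time `0`, which the
  -- free part need not be.
  let w : ℝ → BC false := fun t => conv (T false 4 2) n4 (clampTime τ t)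
  have cw : Continuous w := continuous_conv_clampTime (by norm_num) cn4 hτ0 hτ1
  let u6 : ℝ → BC false := fun t => free false 6 (d' 6) t + w t
  have i56 : ∀ t ∈ Icc 0 τ, IsDer (toC (u5 t)) (toC (u6 t)) := by
    intro t ht
    simp only [u5, u6, w]
    have hsub : Icc 0 t ⊆ Icc 0 τ := Icc_subset_Icc_right ht.2
    rw [clampTime_of_mem ht, ← conv_T_succ 3 2 ht.1 (fun s hs => hn3 s (hsub hs))
      (Or.inr (mode_eq_zero_of_mod (by norm_num)))]
    exact isDer_toC_add (isDer_free 5 (h.isDer_false (by norm_num)) (h.boundary (by norm_num) _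
      (h.memC.admissible (by norm_num))) t)
      (isDer_conv_T 3 2 (by norm_num) (cF cn3) ht.1 (hmem ht))
  have hext0 : ∀ t ∈ Icc 0 τ, IsExt (toC (u0 t)) := by
    intro t ht x
    rw [(hu t ht).1, toC_add_apply, toC_add_apply, isExt_free 0 (isExt_toBC _) t x,
      isExt_conv_T 0 0 (by norm_num) cn0 ht.1 (hmem ht) x]
  have hext1 : ∀ t ∈ Icc 0 τ, IsExt (toC (u1 t)) := by
    intro t ht x
    rw [(hu t ht).2, toC_add_apply, toC_add_apply, isExt_free 1 (isExt_toBC _) t x,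
      isExt_conv_T 0 1 (by norm_num) cn0 ht.1 (hmem ht) x]
  have hextn : ∀ t ∈ Icc 0 τ, IsExt (toC (n0 t)) := by
    intro t ht x
    simp only [n0, toC_sub_apply, toC_mulBC, b]
    rw [hext0 t ht x, hext1 t ht x, isExt_prim _ x]
  let g : ℝ → BC true := fun s => n0 s - conv (T true 2 2) n2 (clampTime τ s)
  have cg : Continuous g := cn0.sub (continuous_conv_clampTime (by norm_num) cn2 hτ0 hτ1)
  -- In this form time enters only as the upper limit, so the fundamental theorem of calculus gives
  -- the equation.
  have hduh : ∀ t ∈ Icc 0 τ, conv (T true 0 0) n0 t = ∫ s in (0 : ℝ)..t, g s := by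
    intro t ht
    have hsub : Icc 0 t ⊆ Icc 0 τ := Icc_subset_Icc_right ht.2
    rw [conv_eq_integral cn0 cn2 ht.1 (hmem ht) (fun s hs => hextn s (hsub hs))
      (fun s hs => hn0 s (hsub hs)) (fun s hs => hn1 s (hsub hs)) (fun s hs => zn0 s (hsub hs))
      (fun s hs => zn1 s (hsub hs))]
    refine intervalIntegral.integral_congr fun s hs => ?_
    rw [uIcc_of_le ht.1] at hs
    simp only [g]
    rw [clampTime_of_mem (hsub hs)]
  let U : ℕ → ℝ → BC true := fun k => match k with
    | 0 => u0 | 1 => u1 | 2 => u2 | 3 => u3 | _ => u4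
  let W : ℕ → ℝ → BC false := fun k => match k with
    | 0 => fun t => forget (u0 t) | 1 => fun t => forget (u1 t) | 2 => fun t => forget (u2 t)
    | 3 => fun t => forget (u3 t) | 4 => fun t => forget (u4 t) | 5 => u5 | _ => u6
  refine ⟨U, W, w, ⟨?_, ?_, cw, ?_, ?_, fun _ => rfl, ?_, z0, z1, ?_⟩⟩
  · intro k hk
    interval_cases k
    exacts [c0, c1, c2, c3, c4]
  · intro k hk
    interval_cases k
    exacts [cF c0, cF c1, cF c2, cF c3, cF c4, c5]
  · intro k hk t
    interval_cases k <;> rfl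
  · intro k hk
    interval_cases k
    exacts [i01, i12, i23, i34, i45, i56]
  · change u0 0 = _
    rw [(hu 0 ⟨le_rfl, hτ0⟩).1, conv_zero, free_zero, add_zero]
    simp only [d, D_zero]
  · intro t ht y hy
    have e1 : HasDerivAt (fun s => toC (T true 0 0 s (d 0)) y) (-toC (free true 4 (d 4) t) y) t := by
      have := hasDerivAt_T_time (β := true) 0 0 ht.1 (d 0) y
      have hb : ∀ k ≤ 3, toC (d k) 0 = 0 ∨ mode (3 * (k + 1)) 0 = 0 := fun k hk =>
        h.boundary (by omega) _ (h.admissible (by omega))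
      rwa [zero_add, toC_T_succ 0 3 ht.1 (d 0) (d 1) (h.isDer (by norm_num)) (hb 0 (by norm_num)),
        toC_T_succ 1 2 ht.1 (d 1) (d 2) (h.isDer (by norm_num)) (hb 1 (by norm_num)),
        toC_T_succ 2 1 ht.1 (d 2) (d 3) (h.isDer (by norm_num)) (hb 2 (by norm_num)),
        toC_T_succ 3 0 ht.1 (d 3) (d 4) (h.isDer (by norm_num)) (hb 3 (by norm_num)),
        ← free_of_pos 4 (d 4) ht.1] at this
    have e2 : HasDerivAt (fun s => toC (∫ r in (0 : ℝ)..s, g r) y) (toC (g t) y) t :=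
      (evalBC (β := true) y).hasFDerivAt.comp_hasDerivAt t
        (cg.integral_hasStrictDerivAt 0 t).hasDerivAt
    have e3 := e1.add e2
    refine (e3.congr_of_eventuallyEq ?_).congr_deriv ?_
    · filter_upwards [Ioo_mem_nhds ht.1 ht.2] with s hs
      change toC (u0 s) y = _
      have hs' := Ioo_subset_Icc_self hs
      rw [(hu s hs').1, hduh s hs', toC_add_apply, free_of_pos 0 (d 0) hs.1]
      rfl
    · change _ = -toC (u4 t) y + (toC (u0 t) y) ^ 2 - toC (u1 t) y * b t y
      simp only [u4, g, n0, toC_add_apply, toC_sub_apply, toC_mulBC]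
      ring

end

section

variable {β : Bool}

/-! ### Local existence -/

theorem eLpNorm_toC_le (f : BC true) :
    eLpNorm (toC f) 1 (volume.restrict (Ici 0)) ≤ ENNReal.ofReal ‖f‖ := by
  rw [eLpNorm_one_eq_lintegral_enorm, ← ofReal_integral_norm_eq_lintegral_enorm (integrableOn_toC f)]
  exact ENNReal.ofReal_le_ofReal (integral_abs_toC_le f)

theorem eLpNorm_congr_Ici {p : ℝ≥0∞} {f g : ℝ → ℝ} (h : ∀ y, 0 ≤ y → f y = g y) :
    eLpNorm f p (volume.restrict (Ici 0)) = eLpNorm g p (volume.restrict (Ici 0)) :=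
  eLpNorm_congr_ae ((ae_restrict_iff' measurableSet_Ici).2 (Eventually.of_forall h))

theorem tendsto_eLpNorm_of_tendsto {l : Filter ℝ} {f : ℝ → BC true} {g : BC true}
    (h : Tendsto f l (𝓝 g)) {F : ℝ → ℝ → ℝ} {G : ℝ → ℝ}
    (hF : ∀ᶠ s in l, ∀ y, 0 ≤ y → F s y = toC (f s) y) (hG : ∀ y, 0 ≤ y → G y = toC g y) :
    Tendsto (fun s => eLpNorm (fun y => F s y - G y) 1 (volume.restrict (Ici 0))) l (𝓝 0) := by
  have h1 : Tendsto (fun s => ENNReal.ofReal ‖f s - g‖) l (𝓝 0) := by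
    have := ENNReal.tendsto_ofReal (tendsto_iff_norm_sub_tendsto_zero.1 h)
    rwa [ENNReal.ofReal_zero] at this
  refine tendsto_of_tendsto_of_tendsto_of_le_of_le' tendsto_const_nhds h1
    (Eventually.of_forall fun _ => zero_le) ?_
  filter_upwards [hF] with s hs
  rw [eLpNorm_congr_Ici (g := toC (f s - g)) fun y hy => by
    rw [hs y hy, hG y hy, toC_sub_apply]]
  exact eLpNorm_toC_le _

theorem tendstoUniformlyOn_of_tendsto {l : Filter ℝ} {f : ℝ → BC β} {g : BC β}
    (h : Tendsto f l (𝓝 g)) {F : ℝ → ℝ → ℝ} {G : ℝ → ℝ}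
    (hF : ∀ᶠ s in l, ∀ y, 0 ≤ y → F s y = toC (f s) y) (hG : ∀ y, 0 ≤ y → G y = toC g y) :
    TendstoUniformlyOn F G l (Ici 0) := by
  rw [Metric.tendstoUniformlyOn_iff]
  intro ε hε
  filter_upwards [hF, (Metric.tendsto_nhds.1 h) ε hε] with s hs h1 y hy
  rw [hs y hy, hG y hy, dist_comm, Real.dist_eq, ← toC_sub_apply]
  rw [dist_eq_norm] at h1
  exact (abs_toC_le _ y).trans_lt h1

theorem SolCurve.isSolution {a₀ : ℝ → ℝ} (h₀ : IsDatum a₀) {τ : ℝ}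
    {u : ℕ → ℝ → BC true} {v : ℕ → ℝ → BC false} {w : ℝ → BC false} (h : SolCurve a₀ τ u v w) :
    IsSolution a₀ τ (fun t => toC (v 0 t)) := by
  have hD : ∀ k ≤ 6, ∀ t ∈ Icc 0 τ, ∀ y, 0 ≤ y → D k (toC (v 0 t)) y = toC (v k t) y := by
    intro k hk t ht y hy
    exact D_eq_of_chain (n := 6) (F := fun k => toC (v k t))
      (fun k _ => (toC (v k t)).continuous.continuousOn) (fun k hk => h.der k hk t ht) k hk y hy
  have hDu : ∀ k ≤ 4, ∀ t ∈ Icc 0 τ, ∀ y, 0 ≤ y → D k (toC (v 0 t)) y = toC (u k t) y := by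
    intro k hk t ht y hy
    rw [hD k (by omega) t ht y hy, ← h.forget_u k hk t, toC_forget]
  have hIco : ∀ t ∈ Ico 0 τ, t ∈ Icc 0 τ := fun t ht => Ico_subset_Icc_self ht
  have hev : ∀ t, ∀ᶠ s in 𝓝[Ico 0 τ] t, s ∈ Icc 0 τ := fun t => by
    filter_upwards [self_mem_nhdsWithin] with s hs using hIco s hs
  have hu0 : ∀ t, toC (v 0 t) = toC (u 0 t) := fun t => by
    rw [← h.forget_u 0 (by norm_num) t, toC_forget]
  refine ⟨fun t ht => ⟨?_, ?_⟩, ?_, ?_, ?_, ?_, ?_, ?_, ?_, ?_, ?_, ?_, ?_⟩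
  · exact contDiffOn_of_chain (n := 6) (F := fun k => toC (v k t))
      (fun k _ => (toC (v k t)).continuous.continuousOn) (fun k hk => h.der k hk t (hIco t ht))
  · intro k hk
    refine ⟨‖v k t‖, fun y hy => ?_⟩
    rw [hD k hk t (hIco t ht) y hy]
    exact abs_toC_le _ _
  · intro t ht k hk
    exact (integrableOn_toC (u k t)).congr_fun (fun y hy => (hDu k hk t (hIco t ht) y hy).symm)
      measurableSet_Ici
  · intro k hk t ht
    refine tendsto_eLpNorm_of_tendsto (f := u k) (g := u k t)
      (((h.cont_u k hk).tendsto t).mono_left nhdsWithin_le_nhds) ?_ (hDu k hk t (hIco t ht))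
    filter_upwards [hev t] with s hs using hDu k hk s hs
  · intro k hk t ht
    refine tendstoUniformlyOn_of_tendsto (f := v k) (g := v k t)
      (((h.cont_v k hk).tendsto t).mono_left nhdsWithin_le_nhds) ?_ (hD k (by omega) t (hIco t ht))
    filter_upwards [hev t] with s hs using hD k (by omega) s hs
  · intro t ht
    have hc : ContinuousAt (v 6) t := by
      rw [show v 6 = fun t => free false 6 (toBC false (D 6 a₀)) t + w t from funext h.six]
      exact (continuousAt_free 6 _ ht.1).add h.cont_w.continuousAt
    refine tendstoUniformlyOn_of_tendsto (f := v 6) (g := v 6 t)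
      (hc.tendsto.mono_left nhdsWithin_le_nhds) ?_ (hD 6 le_rfl t (Ioo_subset_Icc_self ht))
    filter_upwards [self_mem_nhdsWithin] with s hs using hD 6 le_rfl s (Ioo_subset_Icc_self hs)
  · have hev : ∀ f : ℝ → BC false, ∀ t, ContinuousAt f t → ∀ y,
        ContinuousAt (fun p : ℝ × ℝ => toC (f p.1) p.2) (t, y) := by
      intro f t hf y
      have h1 : ContinuousAt (fun p : ℝ × ℝ => toC (f p.1)) (t, y) :=
        toC.continuous.continuousAt.comp (hf.comp continuousAt_fst)
      exact h1.eval continuousAt_snd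
    have hfree : ContinuousOn
        (fun p : ℝ × ℝ => toC (free false 6 (toBC false (D 6 a₀)) p.1) p.2) (Ico 0 τ ×ˢ Ici 0) := by
      rintro ⟨t, y⟩ ⟨ht, hy⟩
      rcases ht.1.eq_or_lt with h0 | h0
      · obtain rfl : (0 : ℝ) = t := h0
        -- At order six the mass is one because `3 * 7` is `1` modulo `4`. Joint continuity at `t =
        -- 0` follows although convergence in norm may fail.
        have hm : ∀ t x : ℝ, 0 < t → t ≤ 1 → 0 ≤ x → ∫ y in Ici 0, kT 6 0 t x y = 1 :=
          fun t x => mass_eq_one 6 (mode_eq_zero_of_mod (by norm_num))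
        have h1 : ContinuousWithinAt
            (fun p : ℝ × ℝ => toC (free false 6 (toBC false (D 6 a₀)) p.1) p.2)
            (Ioi 0 ×ˢ Ici 0) (0, y) := by
          have := tendsto_T_zero_of_mass (β := false) 6 (toBC false (D 6 a₀)) hm hy
          rw [ContinuousWithinAt, nhdsWithin_prod_eq, free_zero]
          refine (this.mono_left (prod_mono le_rfl nhdsWithin_le_nhds)).congr' ?_
          filter_upwards [prod_mem_prod self_mem_nhdsWithin self_mem_nhdsWithin] with p hp
          rw [free_of_pos 6 _ hp.1, max_eq_left hp.2]
        have h2 : ContinuousWithinAt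
            (fun p : ℝ × ℝ => toC (free false 6 (toBC false (D 6 a₀)) p.1) p.2)
            ({0} ×ˢ Ici 0) (0, y) := by
          have h3 : ContinuousAt (fun p : ℝ × ℝ => toC (toBC false (D 6 a₀)) p.2) (0, y) :=
            ((toC (toBC false (D 6 a₀))).continuous.comp continuous_snd).continuousAt
          refine h3.continuousWithinAt.congr (fun p hp => ?_) ?_
          · rw [show p.1 = 0 from hp.1, free_zero]
          · rw [free_zero]
        refine (h2.union h1).mono ?_
        rintro ⟨s, x⟩ ⟨hs, hx⟩
        rcases hs.1.eq_or_lt with h0 | h0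
        · exact Or.inl ⟨h0.symm, hx⟩
        · exact Or.inr ⟨h0, hx⟩
      · exact (hev _ t (continuousAt_free 6 _ h0) y).continuousWithinAt
    have hw : ContinuousOn (fun p : ℝ × ℝ => toC (w p.1) p.2) (Ico 0 τ ×ˢ Ici 0) :=
      fun p _ => (hev w p.1 h.cont_w.continuousAt p.2).continuousWithinAt
    refine (hfree.add hw).congr fun p hp => ?_
    rw [hD 6 le_rfl p.1 (hIco p.1 hp.1) p.2 hp.2, h.six, toC_add_apply]
    rfl
  · intro S hS
    obtain ⟨C, hC, hf⟩ := exists_norm_free_le false 6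
    obtain ⟨M, hM⟩ := isCompact_Icc.exists_bound_of_continuousOn (s := Icc 0 τ)
      h.cont_w.continuousOn
    refine ⟨C * ‖toBC false (D 6 a₀)‖ + M, fun t ht y hy => ?_⟩
    have ht' : t ∈ Icc 0 τ := ⟨ht.1, ht.2.trans hS.le⟩
    rw [hD 6 le_rfl t ht' y hy]
    refine (abs_toC_le _ _).trans ?_
    rw [h.six]
    exact (norm_add_le _ _).trans (add_le_add (hf _ _) (hM t ht'))
  · intro t ht y hy
    have ht' := Ioo_subset_Icc_self ht
    have := h.equation t ht y hy
    rw [← hDu 4 le_rfl t ht' y hy.le, ← hDu 1 (by norm_num) t ht' y hy.le,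
      prim_apply _ hy.le] at this
    simpa only [← hu0] using this
  · intro y hy
    rw [hu0, h.initial, toC_toBC _ hy]
    simpa only [D_zero] using h₀.admissible (k := 0) (by norm_num)
  · intro t ht
    rw [hu0]
    exact h.boundary0 t (hIco t ht)
  · intro t ht
    rw [hDu 1 (by norm_num) t (hIco t ht) 0 le_rfl]
    exact h.boundary1 t (hIco t ht)
  · intro m hm t ht
    have hder : IsDer (toC (u m t)) (toC (u (m + 1) t)) := by
      have := h.der m (by omega) t (hIco t ht)
      rwa [← h.forget_u m (by omega), ← h.forget_u (m + 1) (by omega), toC_forget,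
        toC_forget] at this
    refine (tendsto_zero_of_isDer _ _ hder).congr' ?_
    filter_upwards [eventually_ge_atTop 0] with y hy
    exact (hDu m (by omega) t (hIco t ht) y hy).symm

/-- The existence time sees only the first two components of the datum. Higher derivatives are
propagated on the same interval without shrinking it. -/
theorem exists_local (R : ℝ) : ∃ τ : ℝ, 0 < τ ∧ ∀ a₀ : ℝ → ℝ, IsDatum a₀ →
    ‖toBC true (D 0 a₀)‖ ≤ R → ‖toBC true (D 1 a₀)‖ ≤ R → ∃ a, IsSolution a₀ τ a := by
  obtain ⟨C0, h0, hf0⟩ := exists_norm_free_le true 0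
  obtain ⟨C1, h1, hf1⟩ := exists_norm_free_le true 1
  obtain ⟨C, hV⟩ := exists_singOp_duhamelOp
  obtain ⟨τ, hτ, hτ1, hex⟩ := hV.exists_mild nonlin (max (C0 * R) (C1 * R))
  refine ⟨τ, hτ, fun a₀ h hR0 hR1 => ?_⟩
  obtain ⟨A, hA, hmild⟩ := hex (fun t => (free true 0 (toBC true (D 0 a₀)) t,
      free true 1 (toBC true (D 1 a₀)) t))
    (((h.continuous_free (by norm_num)).prodMk (h.continuous_free (by norm_num))).continuousOn)
    (fun t _ => by
      refine (Prod.norm_def _).trans_le (max_le_max ?_ ?_)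
      · exact (hf0 _ t).trans (by gcongr)
      · exact (hf1 _ t).trans (by gcongr))
  obtain ⟨u, v, w, hs⟩ := exists_solCurve h hτ.le hτ1 hA hmild
  exact ⟨_, hs.isSolution h⟩

end

section

/-! ### Locality in time of the notion of solution -/

/-- `a` satisfies the requirements on a solution at the interior time `t`. -/
structure RegAt (a : ℝ → ℝ → ℝ) (t : ℝ) : Prop where
  memC : MemC 6 (a t)
  memW : MemW 4 (a t)
  continuous_W : ∀ k ≤ 4,
    Tendsto (fun s => eLpNorm (fun y => D k (a s) y - D k (a t) y) 1 (volume.restrict (Ici 0)))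
      (𝓝 t) (𝓝 0)
  continuous_C : ∀ k ≤ 6, TendstoUniformlyOn (fun s => D k (a s)) (D k (a t)) (𝓝 t) (Ici 0)
  equation : ∀ y, 0 < y → HasDerivAt (fun s => a s y)
    (-D 4 (a t) y + (a t y) ^ 2 - D 1 (a t) y * ∫ z in (0 : ℝ)..y, a t z) t
  boundary0 : a t 0 = 0
  boundary1 : D 1 (a t) 0 = 0
  decay : ∀ m ≤ 3, Tendsto (D m (a t)) atTop (𝓝 0)

theorem MemC.congr {m : ℕ} {f g : ℝ → ℝ} (hf : MemC m f) (h : ∀ y, 0 ≤ y → g y = f y) :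
    MemC m g := by
  refine ⟨hf.1.congr h, fun k hk => ?_⟩
  obtain ⟨C, hC⟩ := hf.2 k hk
  exact ⟨C, fun y hy => by rw [D_congr k h y hy]; exact hC y hy⟩

theorem MemW.congr {m : ℕ} {f g : ℝ → ℝ} (hf : MemW m f) (h : ∀ y, 0 ≤ y → g y = f y) :
    MemW m g := fun k hk =>
  (hf k hk).congr_fun (fun y hy => (D_congr k h y hy).symm) measurableSet_Ici

theorem tendsto_D_congr {m : ℕ} {f g : ℝ → ℝ} (hf : Tendsto (D m f) atTop (𝓝 0))
    (h : ∀ y, 0 ≤ y → g y = f y) : Tendsto (D m g) atTop (𝓝 0) := by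
  refine hf.congr' ?_
  filter_upwards [eventually_ge_atTop 0] with y hy using (D_congr m h y hy).symm

theorem tendsto_eLpNorm_congr {k : ℕ} {l : Filter ℝ} {a b : ℝ → ℝ → ℝ} {f g : ℝ → ℝ}
    (hab : ∀ᶠ s in l, ∀ y, 0 ≤ y → a s y = b s y) (hfg : ∀ y, 0 ≤ y → f y = g y)
    (h : Tendsto (fun s => eLpNorm (fun y => D k (b s) y - D k g y) 1 (volume.restrict (Ici 0)))
      l (𝓝 0)) :
    Tendsto (fun s => eLpNorm (fun y => D k (a s) y - D k f y) 1 (volume.restrict (Ici 0)))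
      l (𝓝 0) := by
  refine h.congr' ?_
  filter_upwards [hab] with s hs
  refine eLpNorm_congr_Ici fun y hy => ?_
  rw [D_congr k hs y hy, D_congr k hfg y hy]

theorem tendstoUniformlyOn_congr {k : ℕ} {l : Filter ℝ} {a b : ℝ → ℝ → ℝ} {f g : ℝ → ℝ}
    (hab : ∀ᶠ s in l, ∀ y, 0 ≤ y → a s y = b s y) (hfg : ∀ y, 0 ≤ y → f y = g y)
    (h : TendstoUniformlyOn (fun s => D k (b s)) (D k g) l (Ici 0)) :
    TendstoUniformlyOn (fun s => D k (a s)) (D k f) l (Ici 0) := by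
  refine (h.congr ?_).congr_right fun y hy => (D_congr k hfg y hy).symm
  filter_upwards [hab] with s hs y hy using (D_congr k hs y hy).symm

theorem integral_congr_nonneg {f g : ℝ → ℝ} (h : ∀ y, 0 ≤ y → f y = g y) {y : ℝ} (hy : 0 ≤ y) :
    ∫ z in (0 : ℝ)..y, f z = ∫ z in (0 : ℝ)..y, g z := by
  refine intervalIntegral.integral_congr fun z hz => h z ?_
  rw [uIcc_of_le hy] at hz
  exact hz.1

theorem RegAt.congr {a b : ℝ → ℝ → ℝ} {t : ℝ} (h : RegAt b t)
    (hab : ∀ᶠ s in 𝓝 t, ∀ y, 0 ≤ y → a s y = b s y) : RegAt a t := by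
  have ht := hab.self_of_nhds
  refine ⟨h.memC.congr ht, h.memW.congr ht, fun k hk => ?_, fun k hk => ?_, fun y hy => ?_, ?_, ?_,
    fun m hm => tendsto_D_congr (h.decay m hm) ht⟩
  · exact tendsto_eLpNorm_congr hab ht (h.continuous_W k hk)
  · exact tendstoUniformlyOn_congr hab ht (h.continuous_C k hk)
  · rw [D_congr 4 ht y hy.le, D_congr 1 ht y hy.le, ht y hy.le, integral_congr_nonneg ht hy.le]
    refine (h.equation y hy).congr_of_eventuallyEq ?_
    filter_upwards [hab] with s hs using hs y hy.le
  · rw [ht 0 le_rfl, h.boundary0]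
  · rw [D_congr 1 ht 0 le_rfl, h.boundary1]

theorem tendsto_add_left_nhds (t₀ t : ℝ) : Tendsto (fun s => t₀ + s) (𝓝 t) (𝓝 (t₀ + t)) :=
  (continuous_const_add t₀).tendsto t

theorem RegAt.shift {a : ℝ → ℝ → ℝ} {t₀ t : ℝ} (h : RegAt a (t₀ + t)) :
    RegAt (fun s => a (t₀ + s)) t :=
  ⟨h.memC, h.memW, fun k hk => (h.continuous_W k hk).comp (tendsto_add_left_nhds t₀ t),
    fun k hk u hu => (tendsto_add_left_nhds t₀ t).eventually (h.continuous_C k hk u hu),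
    fun y hy => (h.equation y hy).comp_const_add t₀ t, h.boundary0, h.boundary1, h.decay⟩

theorem RegAt.of_shift {a : ℝ → ℝ → ℝ} {t₀ t : ℝ} (h : RegAt (fun s => a (t₀ + s)) t) :
    RegAt a (t₀ + t) := by
  have h1 : RegAt (fun s => a (t₀ + s)) (-t₀ + (t₀ + t)) := by rwa [neg_add_cancel_left]
  refine h1.shift.congr (Eventually.of_forall fun s y _ => ?_)
  rw [add_neg_cancel_left]

variable {a₀ : ℝ → ℝ} {T : ℝ} {a b : ℝ → ℝ → ℝ}

theorem IsSolution.regAt (h : IsSolution a₀ T a) {t : ℝ} (ht : t ∈ Ioo 0 T) : RegAt a t := by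
  have ht' := Ioo_subset_Ico_self ht
  have e1 : 𝓝[Ico 0 T] t = 𝓝 t := nhdsWithin_eq_nhds.2 (Ico_mem_nhds ht.1 ht.2)
  have e2 : 𝓝[Ioo 0 T] t = 𝓝 t := nhdsWithin_eq_nhds.2 (Ioo_mem_nhds ht.1 ht.2)
  refine ⟨h.memC t ht', h.memW t ht', fun k hk => ?_, fun k hk => ?_, h.equation t ht,
    h.boundary0 t ht', h.boundary1 t ht', fun m hm => h.decay m hm t ht'⟩
  · rw [← e1]; exact h.continuous_W k hk t ht'
  · rcases hk.eq_or_lt with rfl | hk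
    · rw [← e2]; exact h.continuous_C6 t ht
    · rw [← e1]; exact h.continuous_C5 k (by omega) t ht'

theorem RegAt.continuousWithinAt_D6 {t : ℝ} (h : RegAt a t) {y : ℝ} (hy : 0 ≤ y) (s : Set ℝ) :
    ContinuousWithinAt (fun p : ℝ × ℝ => D 6 (a p.1) p.2) (s ×ˢ Ici 0) (t, y) := by
  have h1 := h.memC.continuousOn (k := 6) le_rfl y hy
  rw [ContinuousWithinAt, nhdsWithin_prod_eq]
  rw [ContinuousWithinAt] at h1
  refine Metric.tendsto_nhds.2 fun ε hε => ?_
  have h2 := (Metric.tendsto_nhds.1 h1) (ε / 2) (by positivity)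
  have h3 := (Metric.tendstoUniformlyOn_iff.1 (h.continuous_C 6 le_rfl)) (ε / 2) (by positivity)
  have h3' : ∀ᶠ r in 𝓝[s] t, ∀ x ∈ Ici (0 : ℝ), dist (D 6 (a t) x) (D 6 (a r) x) < ε / 2 :=
    nhdsWithin_le_nhds h3
  filter_upwards [prod_mem_prod h3' (inter_mem h2 self_mem_nhdsWithin)] with p hp
  have h4 := hp.1 p.2 hp.2.2
  have h5 : dist (D 6 (a t) p.2) (D 6 (a t) y) < ε / 2 := hp.2.1
  rw [dist_comm] at h4
  have := dist_triangle (D 6 (a p.1) p.2) (D 6 (a t) p.2) (D 6 (a t) y)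
  change dist (D 6 (a p.1) p.2) (D 6 (a t) y) < ε
  linarith

theorem isSolution_of_regAt (h0 : ∀ y, 0 ≤ y → a 0 y = a₀ y) (h : ∀ t ∈ Ico 0 T, RegAt a t)
    (hb : ∀ S < T, ∃ C : ℝ, ∀ t ∈ Icc 0 S, ∀ y, 0 ≤ y → |D 6 (a t) y| ≤ C) :
    IsSolution a₀ T a where
  memC t ht := (h t ht).memC
  memW t ht := (h t ht).memW
  continuous_W k hk t ht := ((h t ht).continuous_W k hk).mono_left nhdsWithin_le_nhds
  continuous_C5 k hk t ht := fun u hu =>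
    nhdsWithin_le_nhds ((h t ht).continuous_C k (by omega) u hu)
  continuous_C6 t ht := fun u hu =>
    nhdsWithin_le_nhds ((h t (Ioo_subset_Ico_self ht)).continuous_C 6 le_rfl u hu)
  continuousOn_D6 := fun p hp => (h p.1 hp.1).continuousWithinAt_D6 hp.2 _
  bounded_D6 := hb
  equation t ht := (h t (Ioo_subset_Ico_self ht)).equation
  initial := h0
  boundary0 t ht := (h t ht).boundary0
  boundary1 t ht := (h t ht).boundary1
  decay m hm t ht := (h t ht).decay m hm

theorem IsSolution.shift (h : IsSolution a₀ T a) {t₀ : ℝ} (ht₀ : 0 < t₀) :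
    IsSolution (a t₀) (T - t₀) fun t => a (t₀ + t) := by
  refine isSolution_of_regAt (fun y _ => by rw [add_zero]) (fun t ht => ?_) fun S hS => ?_
  · exact (h.regAt ⟨by linarith [ht.1], by linarith [ht.2]⟩).shift
  · obtain ⟨C, hC⟩ := h.bounded_D6 (t₀ + S) (by linarith)
    exact ⟨C, fun t ht => hC _ ⟨by linarith [ht.1], by linarith [ht.2]⟩⟩

/-- Extension of a solution beyond its interval of existence. -/
theorem IsSolution.extend {S : ℝ} (hS : 0 < S) (hb : IsSolution a₀ S b)
    (hab : ∀ t ∈ Ico 0 S, ∀ y, 0 ≤ y → a t y = b t y) (h : ∀ t ∈ Ioo 0 T, RegAt a t)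
    (hbd : ∀ S < T, ∃ C : ℝ, ∀ t ∈ Icc 0 S, ∀ y, 0 ≤ y → |D 6 (a t) y| ≤ C) :
    IsSolution a₀ T a := by
  have h00 : (0 : ℝ) ∈ Ico 0 S := ⟨le_rfl, hS⟩
  have hd := hab 0 h00
  have hlt : ∀ᶠ s : ℝ in 𝓝 0, s < S := gt_mem_nhds hS
  have hev : ∀ᶠ s in 𝓝[Ico 0 T] (0 : ℝ), s ∈ Ico 0 S := by
    filter_upwards [self_mem_nhdsWithin, nhdsWithin_le_nhds hlt] with s hs hs' using ⟨hs.1, hs'⟩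
  have hle : 𝓝[Ico 0 T] (0 : ℝ) ≤ 𝓝[Ico 0 S] 0 := nhdsWithin_le_iff.2 hev
  have hev' : ∀ᶠ s in 𝓝[Ico 0 T] (0 : ℝ), ∀ y, 0 ≤ y → a s y = b s y :=
    hev.mono fun s hs => hab s hs
  have hpos : ∀ t ∈ Ico 0 T, t = 0 ∨ RegAt a t := fun t ht => by
    rcases ht.1.eq_or_lt with h1 | h1
    · exact Or.inl h1.symm
    · exact Or.inr (h t ⟨h1, ht.2⟩)
  constructor
  · intro t ht
    rcases hpos t ht with rfl | hr
    exacts [(hb.memC 0 h00).congr hd, hr.memC]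
  · intro t ht
    rcases hpos t ht with rfl | hr
    exacts [(hb.memW 0 h00).congr hd, hr.memW]
  · intro k hk t ht
    rcases hpos t ht with rfl | hr
    · exact tendsto_eLpNorm_congr hev' hd ((hb.continuous_W k hk 0 h00).mono_left hle)
    · exact (hr.continuous_W k hk).mono_left nhdsWithin_le_nhds
  · intro k hk t ht
    rcases hpos t ht with rfl | hr
    · exact tendstoUniformlyOn_congr hev' hd fun u hu => hle (hb.continuous_C5 k hk 0 h00 u hu)
    · exact fun u hu => nhdsWithin_le_nhds (hr.continuous_C k (by omega) u hu)
  · exact fun t ht u hu => nhdsWithin_le_nhds ((h t ht).continuous_C 6 le_rfl u hu)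
  · rintro ⟨t, y⟩ ⟨ht, hy⟩
    rcases ht.1.eq_or_lt with h1 | h1
    · obtain rfl : (0 : ℝ) = t := h1
      have h2 := hb.continuousOn_D6 (0, y) ⟨h00, hy⟩
      have h3 : {p : ℝ × ℝ | p ∈ Ico 0 S ×ˢ Ici (0 : ℝ)} ∈ 𝓝[Ico 0 T ×ˢ Ici 0] ((0 : ℝ), y) := by
        rw [nhdsWithin_prod_eq]
        exact prod_mem_prod hev self_mem_nhdsWithin
      refine (h2.mono_of_mem_nhdsWithin h3).congr_of_eventuallyEq ?_ (D_congr 6 hd y hy)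
      filter_upwards [h3] with p hp
      exact D_congr 6 (hab p.1 hp.1) p.2 hp.2
    · exact (h t ⟨h1, ht.2⟩).continuousWithinAt_D6 hy _
  · exact hbd
  · exact fun t ht => (h t ht).equation
  · intro y hy
    rw [hd y hy, hb.initial y hy]
  · intro t ht
    rcases hpos t ht with rfl | hr
    exacts [(hd 0 le_rfl).trans (hb.boundary0 0 h00), hr.boundary0]
  · intro t ht
    rcases hpos t ht with rfl | hr
    exacts [(D_congr 1 hd 0 le_rfl).trans (hb.boundary1 0 h00), hr.boundary1]
  · intro m hm t ht
    rcases hpos t ht with rfl | hr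
    exacts [tendsto_D_congr (hb.decay m hm 0 h00) hd, hr.decay m hm]

end

section

variable {β : Bool}

/-! ### Classical solutions as curves in `BC` -/

theorem Admissible.congr {f g : ℝ → ℝ} (h : Admissible β f) (hfg : ∀ y, 0 ≤ y → g y = f y) :
    Admissible β g := by
  refine ⟨h.cont.congr hfg, ?_, ?_⟩
  · obtain ⟨C, hC⟩ := h.bdd
    exact ⟨C, fun y hy => by rw [hfg y hy]; exact hC y hy⟩
  · cases β with
    | false => exact integrable_zero_measure
    | true => exact IntegrableOn.congr_fun h.int (fun y hy => (hfg y hy).symm) measurableSet_Ici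

theorem toBC_congr (β : Bool) {f g : ℝ → ℝ} (hfg : ∀ y, 0 ≤ y → f y = g y) :
    toBC β f = toBC β g := by
  by_cases h : Admissible β f
  · have h' := h.congr fun y hy => (hfg y hy).symm
    refine BC.ext fun x => ?_
    rw [isExt_toBC f x, isExt_toBC g x, toC_toBC h (le_max_right x 0),
      toC_toBC h' (le_max_right x 0), hfg _ (le_max_right x 0)]
  · have h' : ¬Admissible β g := fun h' => h (h'.congr hfg)
    rw [toBC, toBC, dif_neg h, dif_neg h']

theorem ofReal_integral_abs_toC (f : BC true) :
    ENNReal.ofReal (∫ x, |toC f x| ∂(meas true)) = eLpNorm (toC f) 1 (volume.restrict (Ici 0)) := by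
  rw [eLpNorm_one_eq_lintegral_enorm, ← ofReal_integral_norm_eq_lintegral_enorm (integrableOn_toC f)]
  rfl

theorem tendsto_toBC_false {l : Filter ℝ} {F : ℝ → ℝ → ℝ} {G : ℝ → ℝ}
    (hF : ∀ᶠ s in l, Admissible false (F s)) (hG : Admissible false G)
    (h : TendstoUniformlyOn F G l (Ici 0)) :
    Tendsto (fun s => toBC false (F s)) l (𝓝 (toBC false G)) := by
  refine Metric.tendsto_nhds.2 fun ε hε => ?_
  filter_upwards [hF, (Metric.tendstoUniformlyOn_iff.1 h) (ε / 2) (by positivity)] with s hs h1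
  rw [dist_eq_norm]
  refine (norm_BC_le (C := ε / 2) (by positivity) (fun x => ?_) ?_).trans_lt (by linarith)
  · rw [toC_sub_apply, isExt_toBC _ x, isExt_toBC G x, toC_toBC hs (le_max_right x 0),
      toC_toBC hG (le_max_right x 0), abs_sub_comm]
    exact (h1 _ (le_max_right x 0)).le
  · simp only [meas, integral_zero_measure]; positivity

theorem tendsto_toBC_true {l : Filter ℝ} {F : ℝ → ℝ → ℝ} {G : ℝ → ℝ}
    (hF : ∀ᶠ s in l, Admissible true (F s)) (hG : Admissible true G)
    (h : TendstoUniformlyOn F G l (Ici 0))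
    (h' : Tendsto (fun s => eLpNorm (fun y => F s y - G y) 1 (volume.restrict (Ici 0))) l (𝓝 0)) :
    Tendsto (fun s => toBC true (F s)) l (𝓝 (toBC true G)) := by
  refine Metric.tendsto_nhds.2 fun ε hε => ?_
  have hε2 : (0 : ℝ≥0∞) < ENNReal.ofReal (ε / 2) := ENNReal.ofReal_pos.2 (by positivity)
  filter_upwards [hF, (Metric.tendstoUniformlyOn_iff.1 h) (ε / 2) (by positivity),
    h'.eventually (gt_mem_nhds hε2)] with s hs h1 h2
  rw [dist_eq_norm]
  refine (norm_BC_le (C := ε / 2) (by positivity) (fun x => ?_) ?_).trans_lt (by linarith)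
  · rw [toC_sub_apply, isExt_toBC _ x, isExt_toBC G x, toC_toBC hs (le_max_right x 0),
      toC_toBC hG (le_max_right x 0), abs_sub_comm]
    exact (h1 _ (le_max_right x 0)).le
  · rw [← ENNReal.ofReal_le_ofReal_iff (by positivity), ofReal_integral_abs_toC]
    refine le_trans (le_of_eq ?_) h2.le
    refine eLpNorm_congr_Ici fun y hy => ?_
    rw [toC_sub_apply, toC_toBC hs hy, toC_toBC hG hy]

/-- The space derivatives of a solution as elements of `BC`. -/
def curve (β : Bool) (a : ℝ → ℝ → ℝ) (k : ℕ) (t : ℝ) : BC β := toBC β (D k (a t))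

/-- The pair `(a, a_y)`. -/
def pair (a : ℝ → ℝ → ℝ) (t : ℝ) : BC true × BC true := (curve true a 0 t, curve true a 1 t)

/-- The right-hand side of the equation. -/
def rate (a : ℝ → ℝ → ℝ) (t : ℝ) : BC true := nonlin (pair a t) (pair a t) - curve true a 4 t

/-- The space derivative of the right-hand side of the equation. -/
def rate' (a : ℝ → ℝ → ℝ) (t : ℝ) : BC false :=
  mulBC (toC (curve true a 0 t)) (curve false a 1 t) -
    mulBC (prim (curve true a 0 t)) (curve false a 2 t) - curve false a 5 t

theorem continuous_comp_clampTime {E : Type*} [TopologicalSpace E] {f : ℝ → E} {T S : ℝ}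
    (hf : ContinuousOn f (Ico 0 T)) (hS0 : 0 ≤ S) (hS : S < T) :
    Continuous fun t => f (clampTime S t) :=
  hf.comp_continuous (by unfold clampTime; fun_prop) fun t =>
    ⟨(clampTime_mem hS0 t).1, (clampTime_mem hS0 t).2.trans_lt hS⟩

namespace IsSolution

variable {a₀ : ℝ → ℝ} {T : ℝ} {a b : ℝ → ℝ → ℝ} {t : ℝ}

theorem admissible (h : IsSolution a₀ T a) (ht : t ∈ Ico 0 T) {k : ℕ} (hk : k ≤ 4) :
    Admissible true (D k (a t)) := (h.memC t ht).admissible_true (h.memW t ht) (by omega) hk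

theorem admissible_false (h : IsSolution a₀ T a) (ht : t ∈ Ico 0 T) {k : ℕ} (hk : k ≤ 6) :
    Admissible false (D k (a t)) := (h.memC t ht).admissible hk

theorem toC_curve (h : IsSolution a₀ T a) (ht : t ∈ Ico 0 T) {k : ℕ} (hk : k ≤ 4) {y : ℝ}
    (hy : 0 ≤ y) : toC (curve true a k t) y = D k (a t) y := toC_toBC (h.admissible ht hk) hy

theorem toC_curve_false (h : IsSolution a₀ T a) (ht : t ∈ Ico 0 T) {k : ℕ} (hk : k ≤ 6) {y : ℝ}
    (hy : 0 ≤ y) : toC (curve false a k t) y = D k (a t) y :=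
  toC_toBC (h.admissible_false ht hk) hy

theorem isDer (h : IsSolution a₀ T a) (ht : t ∈ Ico 0 T) {k : ℕ} (hk : k ≤ 3) :
    IsDer (toC (curve true a k t)) (toC (curve true a (k + 1) t)) :=
  isDer_toBC (h.admissible ht (by omega)) (h.admissible ht (by omega))
    ((h.memC t ht).isDer (by omega))

theorem isDer_mixed (h : IsSolution a₀ T a) (ht : t ∈ Ico 0 T) {k : ℕ} (hk : k ≤ 4) :
    IsDer (toC (curve true a k t)) (toC (curve false a (k + 1) t)) :=
  isDer_toBC (h.admissible ht (by omega)) (h.admissible_false ht (by omega))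
    ((h.memC t ht).isDer (by omega))

theorem continuousOn_curve (h : IsSolution a₀ T a) {k : ℕ} (hk : k ≤ 4) :
    ContinuousOn (curve true a k) (Ico 0 T) := fun t ht =>
  tendsto_toBC_true (eventually_mem_nhdsWithin.mono fun _ hs => h.admissible hs hk)
    (h.admissible ht hk) (h.continuous_C5 k (by omega) t ht) (h.continuous_W k hk t ht)

theorem continuousOn_curve_false (h : IsSolution a₀ T a) {k : ℕ} (hk : k ≤ 5) :
    ContinuousOn (curve false a k) (Ico 0 T) := fun t ht =>
  tendsto_toBC_false (eventually_mem_nhdsWithin.mono fun _ hs => h.admissible_false hs (by omega))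
    (h.admissible_false ht (by omega)) (h.continuous_C5 k hk t ht)

theorem toC_curve_zero (h : IsSolution a₀ T a) (ht : t ∈ Ico 0 T) : toC (curve true a 0 t) 0 = 0 := by
  rw [h.toC_curve ht (by norm_num) le_rfl, D_zero, h.boundary0 t ht]

theorem toC_curve_one (h : IsSolution a₀ T a) (ht : t ∈ Ico 0 T) : toC (curve true a 1 t) 0 = 0 := by
  rw [h.toC_curve ht (by norm_num) le_rfl, h.boundary1 t ht]

theorem continuousOn_pair (h : IsSolution a₀ T a) : ContinuousOn (pair a) (Ico 0 T) :=
  (h.continuousOn_curve (by norm_num)).prodMk (h.continuousOn_curve (by norm_num))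

theorem continuousOn_rate (h : IsSolution a₀ T a) : ContinuousOn (rate a) (Ico 0 T) :=
  ((nonlin.continuous.comp_continuousOn h.continuousOn_pair).clm_apply h.continuousOn_pair).sub
    (h.continuousOn_curve (by norm_num))

theorem continuousOn_rate' (h : IsSolution a₀ T a) : ContinuousOn (rate' a) (Ico 0 T) := by
  have c0 := h.continuousOn_curve (k := 0) (by norm_num)
  exact (((mulBC.continuous.comp_continuousOn (toC.continuous.comp_continuousOn c0)).clm_apply
    (h.continuousOn_curve_false (by norm_num))).sub
    ((mulBC.continuous.comp_continuousOn (prim.continuous.comp_continuousOn c0)).clm_apply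
    (h.continuousOn_curve_false (by norm_num)))).sub (h.continuousOn_curve_false (by norm_num))

end IsSolution

theorem toC_rate (a : ℝ → ℝ → ℝ) (t y : ℝ) : toC (rate a t) y =
    toC (curve true a 0 t) y * toC (curve true a 0 t) y -
      prim (curve true a 0 t) y * toC (curve true a 1 t) y - toC (curve true a 4 t) y := by
  rw [rate, nonlin_apply, toC_sub_apply, toC_sub_apply, toC_mulBC, toC_mulBC]
  rfl

theorem isExt_curve (β : Bool) (a : ℝ → ℝ → ℝ) (k : ℕ) (t : ℝ) : IsExt (toC (curve β a k t)) :=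
  isExt_toBC _

theorem isExt_rate (a : ℝ → ℝ → ℝ) (t : ℝ) : IsExt (toC (rate a t)) := fun x => by
  rw [toC_rate, toC_rate, isExt_curve true a 0 t x, isExt_curve true a 1 t x,
    isExt_curve true a 4 t x, isExt_prim _ x]

theorem isExt_rate' (a : ℝ → ℝ → ℝ) (t : ℝ) : IsExt (toC (rate' a t)) := fun x => by
  simp only [rate', toC_sub_apply, toC_mulBC]
  rw [isExt_curve true a 0 t x, isExt_curve false a 1 t x, isExt_curve false a 2 t x,
    isExt_curve false a 5 t x, isExt_prim _ x]

namespace IsSolution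

variable {a₀ : ℝ → ℝ} {T : ℝ} {a b : ℝ → ℝ → ℝ} {t : ℝ}

theorem isDer_rate (h : IsSolution a₀ T a) (ht : t ∈ Ico 0 T) :
    IsDer (toC (rate a t)) (toC (rate' a t)) := by
  intro y hy
  have e : ∀ k ≤ 4, toC (curve false a k t) y = toC (curve true a k t) y := fun k hk => by
    rw [h.toC_curve ht hk hy.le, h.toC_curve_false ht (by omega) hy.le]
  have d0 := h.isDer ht (k := 0) (by norm_num) y hy
  have d1 := h.isDer ht (k := 1) (by norm_num) y hy
  have d4 := h.isDer_mixed ht (k := 4) (by norm_num) y hy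
  have := ((d0.mul d0).sub ((hasDerivAt_prim (curve true a 0 t) hy).mul d1)).sub d4
  rw [show (toC (rate a t) : ℝ → ℝ) = _ from funext fun x => toC_rate a t x]
  refine this.congr_deriv ?_
  simp only [rate', toC_sub_apply, toC_mulBC, e 1 (by norm_num), e 2 (by norm_num)]
  ring

theorem hasDerivAt_toC_curve (h : IsSolution a₀ T a) (ht : t ∈ Ioo 0 T) {y : ℝ} (hy : 0 < y) :
    HasDerivAt (fun s => toC (curve true a 0 s) y) (toC (rate a t) y) t := by
  have ht' := Ioo_subset_Ico_self ht
  refine ((h.equation t ht y hy).congr_of_eventuallyEq ?_).congr_deriv ?_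
  · filter_upwards [Ioo_mem_nhds ht.1 ht.2] with s hs
    rw [h.toC_curve (Ioo_subset_Ico_self hs) (by norm_num) hy.le, D_zero]
  · rw [toC_rate, h.toC_curve ht' (by norm_num) hy.le, h.toC_curve ht' (by norm_num) hy.le,
      h.toC_curve ht' (by norm_num) hy.le, prim_apply _ hy.le, D_zero,
      integral_congr_nonneg (fun z hz => (h.toC_curve ht' (k := 0) (by norm_num) hz).trans
        (congrFun (D_zero _) z)) hy.le]
    ring

/-- The equation is assumed pointwise in `y > 0`. Integrated in time it becomes an identity in `BC
true`, because the right-hand side is a continuous curve there. Differentiability in norm follows.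
-/
theorem curve_sub_eq_integral (h : IsSolution a₀ T a) (ht : t ∈ Ico 0 T) :
    curve true a 0 t - curve true a 0 0 = ∫ s in (0 : ℝ)..t, rate a s := by
  have hsub : Icc 0 t ⊆ Ico 0 T := fun s hs => ⟨hs.1, hs.2.trans_lt ht.2⟩
  have hi : IntervalIntegrable (rate a) volume 0 t :=
    (h.continuousOn_rate.mono hsub).intervalIntegrable_of_Icc ht.1
  refine BC.ext_pos (fun x => ?_) (isExt_intervalIntegral ht.1 hi fun s _ => isExt_rate a s) ?_
  · rw [toC_sub_apply, toC_sub_apply, isExt_curve true a 0 t x, isExt_curve true a 0 0 x]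
  · intro x hx
    have e2 : toC (∫ s in (0 : ℝ)..t, rate a s) x = ∫ s in (0 : ℝ)..t, toC (rate a s) x :=
      ((evalBC x).intervalIntegral_comp_comm hi).symm
    rw [e2, toC_sub_apply]
    refine (intervalIntegral.integral_eq_sub_of_hasDerivAt_of_le ht.1 ?_
      (fun s hs => h.hasDerivAt_toC_curve ⟨hs.1, hs.2.trans ht.2⟩ hx)
      ⟨(evalBC x).integrable_comp hi.1, (evalBC x).integrable_comp hi.2⟩).symm
    exact (evalBC x).continuous.comp_continuousOn ((h.continuousOn_curve (by norm_num)).mono hsub)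

/-- The previous identity differentiated in `y`. It holds in the uniform norm only, since the fifth
derivative need not be integrable. -/
theorem curve_one_sub_eq_integral (h : IsSolution a₀ T a) (ht : t ∈ Ico 0 T) :
    curve false a 1 t - curve false a 1 0 = ∫ s in (0 : ℝ)..t, rate' a s := by
  have hsub : Icc 0 t ⊆ Ico 0 T := fun s hs => ⟨hs.1, hs.2.trans_lt ht.2⟩
  have h0 : (0 : ℝ) ∈ Ico 0 T := hsub ⟨le_rfl, ht.1⟩
  have hi : IntervalIntegrable (fun s => forget (rate a s)) volume 0 t :=
    (forget.continuous.comp_continuousOn (h.continuousOn_rate.mono hsub)).intervalIntegrable_of_Icc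
      ht.1
  have hi' : IntervalIntegrable (rate' a) volume 0 t :=
    (h.continuousOn_rate'.mono hsub).intervalIntegrable_of_Icc ht.1
  refine BC.ext_pos (fun x => ?_) (isExt_intervalIntegral ht.1 hi' fun s _ => isExt_rate' a s) ?_
  · rw [toC_sub_apply, toC_sub_apply, isExt_curve false a 1 t x, isExt_curve false a 1 0 x]
  · intro x hx
    have d1 := isDer_intervalIntegral ht.1 hi hi' (fun s hs => by
      rw [toC_forget]
      exact h.isDer_rate (hsub (Ioc_subset_Icc_self hs))) x hx
    have e : ∫ s in (0 : ℝ)..t, forget (rate a s) =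
        forget (curve true a 0 t - curve true a 0 0) := by
      rw [h.curve_sub_eq_integral ht]
      exact forget.intervalIntegral_comp_comm
        ((h.continuousOn_rate.mono hsub).intervalIntegrable_of_Icc ht.1)
    rw [e, toC_forget, map_sub] at d1
    have d2 := (h.isDer_mixed ht (k := 0) (by norm_num) x hx).sub
      (h.isDer_mixed h0 (k := 0) (by norm_num) x hx)
    rw [toC_sub_apply]
    exact d2.unique d1

theorem hasDerivAt_of_integral {E : Type*} [NormedAddCommGroup E] [NormedSpace ℝ E]
    [CompleteSpace E] {f g : ℝ → E} (hg : ContinuousOn g (Ico 0 T))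
    (hfg : ∀ t ∈ Ico 0 T, f t - f 0 = ∫ s in (0 : ℝ)..t, g s) (ht : t ∈ Ioo 0 T) :
    HasDerivAt f (g t) t := by
  obtain ⟨S, hS1, hS2⟩ := exists_between ht.2
  have hS0 : 0 ≤ S := (ht.1.trans hS1).le
  have hc := continuous_comp_clampTime hg hS0 hS2
  have h1 := ((hc.integral_hasStrictDerivAt 0 t).hasDerivAt).add_const (f 0)
  simp only [clampTime_of_mem (⟨ht.1.le, hS1.le⟩ : t ∈ Icc 0 S)] at h1
  refine h1.congr_of_eventuallyEq ?_
  filter_upwards [Ioo_mem_nhds ht.1 hS1] with s hs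
  have e : ∫ r in (0 : ℝ)..s, g (clampTime S r) = ∫ r in (0 : ℝ)..s, g r := by
    refine intervalIntegral.integral_congr fun r hr => ?_
    rw [uIcc_of_le hs.1.le] at hr
    rw [clampTime_of_mem ⟨hr.1, hr.2.trans hs.2.le⟩]
  rw [e, ← hfg s ⟨hs.1.le, hs.2.trans hS2⟩, sub_add_cancel]

theorem hasDerivAt_curve (h : IsSolution a₀ T a) (ht : t ∈ Ioo 0 T) :
    HasDerivAt (curve true a 0) (rate a t) t :=
  hasDerivAt_of_integral h.continuousOn_rate (fun _ => h.curve_sub_eq_integral) ht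

theorem hasDerivAt_curve_one (h : IsSolution a₀ T a) (ht : t ∈ Ioo 0 T) :
    HasDerivAt (curve false a 1) (rate' a t) t :=
  hasDerivAt_of_integral h.continuousOn_rate' (fun _ => h.curve_one_sub_eq_integral) ht

/-- As `a` and `a_y` vanish at the boundary for all times, so do their time derivatives. Reading the
equation and its `y`-derivative at `y = 0` gives the conditions of orders four and five, so a
solution may be restarted at any positive time. -/
theorem isDatum (h : IsSolution a₀ T a) (ht : t ∈ Ioo 0 T) : IsDatum (a t) := by
  have ht' := Ioo_subset_Ico_self ht
  refine ⟨h.memC t ht', h.memW t ht', h.boundary0 t ht', h.boundary1 t ht', ?_, ?_⟩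
  · have h1 : HasDerivAt (fun s => evalBC 0 (curve true a 0 s)) (evalBC 0 (rate a t)) t :=
      (evalBC (β := true) 0).hasFDerivAt.comp_hasDerivAt t (h.hasDerivAt_curve ht)
    have h2 : HasDerivAt (fun s => evalBC 0 (curve true a 0 s)) 0 t := by
      refine (hasDerivAt_const t (0 : ℝ)).congr_of_eventuallyEq ?_
      filter_upwards [Ioo_mem_nhds ht.1 ht.2] with s hs
      exact h.toC_curve_zero (Ioo_subset_Ico_self hs)
    have h3 := h1.unique h2
    rw [evalBC_apply, toC_rate, h.toC_curve_zero ht', h.toC_curve_one ht',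
      h.toC_curve ht' (k := 4) le_rfl le_rfl] at h3
    linarith
  · have h1 : HasDerivAt (fun s => evalBC 0 (curve false a 1 s)) (evalBC 0 (rate' a t)) t :=
      (evalBC (β := false) 0).hasFDerivAt.comp_hasDerivAt t (h.hasDerivAt_curve_one ht)
    have h2 : HasDerivAt (fun s => evalBC 0 (curve false a 1 s)) 0 t := by
      refine (hasDerivAt_const t (0 : ℝ)).congr_of_eventuallyEq ?_
      filter_upwards [Ioo_mem_nhds ht.1 ht.2] with s hs
      rw [evalBC_apply, h.toC_curve_false (Ioo_subset_Ico_self hs) (by norm_num) le_rfl,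
        h.boundary1 s (Ioo_subset_Ico_self hs)]
    have h3 := h1.unique h2
    simp only [evalBC_apply, rate', toC_sub_apply, toC_mulBC] at h3
    rw [h.toC_curve_zero ht', prim_zero, h.toC_curve_false ht' (k := 5) (by norm_num) le_rfl] at h3
    linarith

end IsSolution

end

section

variable {β : Bool}

/-! ### Classical solutions are mild solutions, and uniqueness -/

/-- A product rule that needs norm continuity of `L` but its derivative only on the fixed vector `v
s`. For the semigroup the time derivative is available in this pointwise sense. -/
theorem hasDerivAt_clm_apply_of_pointwise {E : Type*} [NormedAddCommGroup E] [NormedSpace ℝ E]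
    {L : ℝ → E →L[ℝ] ℝ} {v : ℝ → E} {v' : E} {d s : ℝ} (hL : ContinuousAt L s)
    (hd : HasDerivAt (fun r => L r (v s)) d s) (hv : HasDerivAt v v' s) :
    HasDerivAt (fun r => L r (v r)) (d + L s v') s := by
  rw [hasDerivAt_iff_tendsto_slope] at hd hv ⊢
  have h0 : Tendsto L (𝓝[≠] s) (𝓝 (L s)) := hL.tendsto.mono_left nhdsWithin_le_nhds
  have h1 : Tendsto (fun r => L r (slope v s r)) (𝓝[≠] s) (𝓝 (L s v')) :=
    (isBoundedBilinearMap_apply.continuous.tendsto (L s, v')).comp (h0.prodMk_nhds hv)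
  refine (hd.add h1).congr fun r => ?_
  simp only [slope_def_module, map_smul, map_sub, smul_eq_mul]
  ring

theorem toC_T_four (r : ℝ) (hr : 0 < r) (f : BC β) (x : ℝ) :
    toC (T β 4 0 r f) x = toC (T β 0 0 r f) x := by
  rw [toC_T hr, toC_T hr, opFun, opFun]
  refine integral_congr_ae (Eventually.of_forall fun y => ?_)
  have e : kT 4 0 r (max x 0) y = kT 0 0 r (max x 0) y := by
    rw [kT, kT, show 4 + 0 = 0 + 4 by rfl, show 3 * 4 = 0 + 4 + 4 + 4 by rfl, ker_add_four_left,
      ker_add_four_right, ker_add_four_right, ker_add_four_right]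
    norm_num
  change kT 4 0 r (max x 0) y * _ = kT 0 0 r (max x 0) y * _
  rw [e]

namespace IsSolution

variable {a₀ : ℝ → ℝ} {T : ℝ} {a b : ℝ → ℝ → ℝ} {t : ℝ}

/-- All four derivatives are moved onto the solution: the first two use its boundary values, the
last two the trace of the kernel. The resulting operator of order four is the original one, by
periodicity. -/
theorem toC_T_curve (h : IsSolution a₀ T a) (ht : t ∈ Ico 0 T) {r : ℝ} (hr : 0 < r) (x : ℝ) :
    toC (Prandtl4.T true 0 4 r (curve true a 0 t)) x =
      toC (Prandtl4.T true 0 0 r (curve true a 4 t)) x := by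
  rw [toC_T_succ 0 3 hr _ _ (h.isDer ht (k := 0) (by norm_num)) (Or.inl (h.toC_curve_zero ht)),
    toC_T_succ 1 2 hr _ _ (h.isDer ht (k := 1) (by norm_num)) (Or.inl (h.toC_curve_one ht)),
    toC_T_succ 2 1 hr _ _ (h.isDer ht (k := 2) (by norm_num))
      (Or.inr (mode_eq_zero_of_mod (by norm_num))),
    toC_T_succ 3 0 hr _ _ (h.isDer ht (k := 3) (by norm_num))
      (Or.inr (mode_eq_zero_of_mod (by norm_num))), toC_T_four r hr]

/-- The function `s ↦ T (t - s) a(s)` is differentiated at a point `x`. The fourth-order terms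
cancel and the nonlinearity remains; integrating from `0` to `t` gives Duhamel's formula. -/
theorem mild_zero (h : IsSolution a₀ T a) (ht0 : 0 < t) (ht1 : t ≤ 1) (htT : t < T)
    {q : ℝ → BC true} (hq : Continuous q)
    (hqa : ∀ s ∈ Icc 0 t, q s = nonlin (pair a s) (pair a s)) :
    curve true a 0 t = free true 0 (curve true a 0 0) t + conv (Prandtl4.T true 0 0) q t := by
  have hsub : Icc 0 t ⊆ Ico 0 T := fun s hs => ⟨hs.1, hs.2.trans_lt htT⟩
  refine BC.ext_pos (isExt_curve _ _ _ _) (fun x => ?_) fun x hx => ?_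
  · rw [toC_add_apply, toC_add_apply, isExt_free 0 (isExt_curve _ _ _ _) t x,
      isExt_conv_T 0 0 (by norm_num) hq ht0.le ht1 x]
  obtain ⟨C, hC, hTb⟩ := exists_norm_T_le true 0 0
  let φ : ℝ → ℝ := fun s =>
    if s < t then toC (Prandtl4.T true 0 0 (t - s) (curve true a 0 s)) x
    else toC (curve true a 0 t) x
  have hφ : ∀ s, s < t → φ s = toC (Prandtl4.T true 0 0 (t - s) (curve true a 0 s)) x :=
    fun s hs => if_pos hs
  have hφt : φ t = toC (curve true a 0 t) x := if_neg (lt_irrefl t)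
  have hTc : ∀ s, s < t → ContinuousAt (fun s => Prandtl4.T true 0 0 (t - s)) s := fun s hs =>
    ContinuousAt.comp (f := fun s => t - s)
      ((continuousOn_T true 0 0).continuousAt (Ioi_mem_nhds (sub_pos.2 hs))) (by fun_prop)
  have hd : ∀ s ∈ Ioo 0 t, HasDerivAt φ (toC (Prandtl4.T true 0 0 (t - s) (q s)) x) s := by
    intro s hs
    have hts : 0 < t - s := sub_pos.2 hs.2
    have hs' := hsub (Ioo_subset_Icc_self hs)
    have h1 : HasDerivAt (fun r => toC (Prandtl4.T true 0 0 (t - r) (curve true a 0 s)) x)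
        (toC (Prandtl4.T true 0 0 (t - s) (curve true a 4 s)) x) s := by
      have := (hasDerivAt_T_time (β := true) 0 0 hts (curve true a 0 s) x).comp_const_sub t s
      rwa [zero_add, h.toC_T_curve hs' hts, neg_neg] at this
    have h2 := hasDerivAt_clm_apply_of_pointwise
      (L := fun r => (evalBC x).comp (Prandtl4.T true 0 0 (t - r)))
      (continuousAt_const.clm_comp (hTc s hs.2)) h1 (h.hasDerivAt_curve ⟨hs.1, hs.2.trans htT⟩)
    refine (h2.congr_of_eventuallyEq ?_).congr_deriv ?_
    · filter_upwards [Iio_mem_nhds hs.2] with r hr using hφ r hr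
    · change _ + toC (Prandtl4.T true 0 0 (t - s) (rate a s)) x = _
      rw [hqa s (Ioo_subset_Icc_self hs), rate, map_sub, toC_sub_apply]
      ring
  have hcont : ContinuousOn φ (Icc 0 t) := by
    intro s hs
    rcases hs.2.eq_or_lt with rfl | hst
    -- The endpoint is now called `s`. The vector is frozen at its final value, where pointwise
    -- convergence of the semigroup applies, and the error is absorbed by its uniform bound.
    · have h1 : Tendsto (fun r => toC (Prandtl4.T true 0 0 (s - r) (curve true a 0 s)) x) (𝓝[<] s)
          (𝓝 (toC (curve true a 0 s) x)) := by
        refine (tendsto_T_zero 0 (curve true a 0 s) hx).comp (tendsto_nhdsWithin_iff.2 ⟨?_, ?_⟩)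
        · have : Continuous fun r : ℝ => s - r := by fun_prop
          have := (this.tendsto s).mono_left (nhdsWithin_le_nhds (s := Iio s))
          rwa [sub_self] at this
        · filter_upwards [self_mem_nhdsWithin] with r hr using sub_pos.2 (show r < s from hr)
      have h2 : Tendsto (fun r => C * ‖curve true a 0 r - curve true a 0 s‖) (𝓝[Ico 0 s] s) (𝓝 0) := by
        have h3 := (h.continuousOn_curve (k := 0) (by norm_num)) s (hsub hs)
        have h4 := tendsto_iff_norm_sub_tendsto_zero.1
          (h3.mono_left (nhdsWithin_mono s (Ico_subset_Ico_right htT.le)))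
        simpa using h4.const_mul C
      have h5 : Tendsto (fun r => toC (Prandtl4.T true 0 0 (s - r)
          (curve true a 0 r - curve true a 0 s)) x) (𝓝[Ico 0 s] s) (𝓝 0) := by
        refine squeeze_zero_norm' ?_ h2
        filter_upwards [self_mem_nhdsWithin] with r hr
        refine (abs_toC_le _ x).trans (ContinuousLinearMap.le_of_opNorm_le _ ?_ _)
        refine (hTb _ (sub_pos.2 hr.2)).trans_eq ?_
        simp
      have h6 := (h1.mono_left (nhdsWithin_mono s fun r hr => hr.2)).add h5
      rw [add_zero] at h6
      have h7 : ContinuousWithinAt φ (Ico 0 s) s := by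
        rw [ContinuousWithinAt, hφt]
        refine h6.congr' ?_
        filter_upwards [self_mem_nhdsWithin] with r hr
        rw [hφ r hr.2, map_sub, toC_sub_apply]
        ring
      have h8 := h7.insert
      rwa [← Ico_insert_right ht0.le]
    · have h1 : ContinuousWithinAt (fun r => toC (Prandtl4.T true 0 0 (t - r) (curve true a 0 r)) x)
          (Icc 0 t) s := by
        refine (evalBC x).continuous.continuousAt.comp_continuousWithinAt
          ((hTc s hst).continuousWithinAt.clm_apply ?_)
        exact (h.continuousOn_curve (by norm_num) s (hsub hs)).mono hsub
      refine h1.congr_of_eventuallyEq ?_ (hφ s hst)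
      filter_upwards [nhdsWithin_le_nhds (Iio_mem_nhds hst)] with r hr using hφ r hr
  obtain ⟨C', hV⟩ := exists_singOp_T true 0 0 (by norm_num)
  have hi : IntervalIntegrable (fun s => toC (Prandtl4.T true 0 0 s (q (t - s))) x) volume 0 t :=
    ⟨(evalBC x).integrable_comp (hV.intervalIntegrable hq ht0.le ht1).1,
      (evalBC x).integrable_comp (hV.intervalIntegrable hq ht0.le ht1).2⟩
  have hi' : IntervalIntegrable (fun s => toC (Prandtl4.T true 0 0 (t - s) (q s)) x) volume 0 t := by
    have := hi.comp_sub_left t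
    rw [sub_zero, sub_self] at this
    simpa only [sub_sub_cancel] using this.symm
  have key := intervalIntegral.integral_eq_sub_of_hasDerivAt_of_le ht0.le hcont hd hi'
  have e : ∫ s in (0 : ℝ)..t, toC (Prandtl4.T true 0 0 (t - s) (q s)) x =
      ∫ s in (0 : ℝ)..t, toC (Prandtl4.T true 0 0 s (q (t - s))) x := by
    have := intervalIntegral.integral_comp_sub_left
      (fun s => toC (Prandtl4.T true 0 0 s (q (t - s))) x) (a := 0) (b := t) t
    rw [sub_zero, sub_self] at this
    rw [← this]
    simp only [sub_sub_cancel]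
  rw [toC_add_apply, toC_conv_T 0 0 (by norm_num) hq ht0.le ht1, ← e, key, hφt, hφ 0 ht0, sub_zero,
    free_of_pos 0 _ ht0]
  ring

theorem mild (h : IsSolution a₀ T a) {S : ℝ} (hS0 : 0 ≤ S) (hS1 : S ≤ 1) (hST : S < T)
    (ht : t ∈ Icc 0 S) :
    pair a t = (free true 0 (curve true a 0 0) t, free true 1 (curve true a 1 0) t) +
      conv duhamelOp (fun s => nonlin (pair a (clampTime S s)) (pair a (clampTime S s))) t := by
  have hc := continuous_comp_clampTime h.continuousOn_pair hS0 hST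
  have hq : Continuous fun s => nonlin (pair a (clampTime S s)) (pair a (clampTime S s)) :=
    (nonlin.continuous.comp hc).clm_apply hc
  have hqa : ∀ s ∈ Icc 0 t, nonlin (pair a (clampTime S s)) (pair a (clampTime S s)) =
      nonlin (pair a s) (pair a s) := fun s hs => by
    rw [clampTime_of_mem ⟨hs.1, hs.2.trans ht.2⟩]
  have h0 : (0 : ℝ) ∈ Ico 0 T := ⟨le_rfl, hS0.trans_lt hST⟩
  have ht' : t ∈ Ico 0 T := ⟨ht.1, ht.2.trans_lt hST⟩
  have ht1 := ht.2.trans hS1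
  rw [conv_duhamelOp hq ht.1 ht1]
  rcases ht.1.eq_or_lt with rfl | htpos
  · rw [conv_zero, conv_zero, free_zero, free_zero, Prod.mk_add_mk, add_zero, add_zero]
    rfl
  have e0 := h.mild_zero htpos ht1 ht'.2 hq hqa
  refine Prod.ext e0 ?_
  -- The second component is the `y`-derivative of the identity just proved for the first.
  refine BC.ext_pos (isExt_curve _ _ _ _) (fun x => ?_) fun x hx => ?_
  · change toC (free true 1 (curve true a 1 0) t + conv (Prandtl4.T true 0 1) _ t) x =
      toC (free true 1 (curve true a 1 0) t + conv (Prandtl4.T true 0 1) _ t) (max x 0)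
    rw [toC_add_apply, toC_add_apply, isExt_free 1 (isExt_curve _ _ _ _) t x,
      isExt_conv_T 0 1 (by norm_num) hq ht.1 ht1 x]
  · have d1 := h.isDer ht' (k := 0) (by norm_num) x hx
    rw [e0] at d1
    exact d1.unique (isDer_toC_add (isDer_free 0 (h.isDer h0 (k := 0) (by norm_num))
      (Or.inl (h.toC_curve_zero h0)) t) (isDer_conv_T 0 0 (by norm_num) hq ht.1 ht1) x hx)

theorem pair_eq_of_small (R : ℝ) : ∃ δ : ℝ, 0 < δ ∧ ∀ {a₀ : ℝ → ℝ} {T T' S : ℝ} {a b : ℝ → ℝ → ℝ},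
    IsSolution a₀ T a → IsSolution a₀ T' b → 0 ≤ S → S < T → S < T' → S ≤ δ →
    (∀ t ∈ Icc 0 S, ‖pair a t‖ ≤ R) → (∀ t ∈ Icc 0 S, ‖pair b t‖ ≤ R) →
    ∀ t ∈ Icc 0 S, pair a t = pair b t := by
  obtain ⟨C, hV⟩ := exists_singOp_duhamelOp
  obtain ⟨δ, hδ, hδ1, hu⟩ := hV.mild_unique nonlin R
  refine ⟨δ, hδ, fun {a₀ T T' S a b} ha hb hS0 hST hST' hSδ haR hbR t ht => ?_⟩
  have e : ∀ k, curve true b k 0 = curve true a k 0 := fun k =>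
    toBC_congr true (D_congr k fun y hy => by rw [hb.initial y hy, ha.initial y hy])
  have key := hu (fun t => (free true 0 (curve true a 0 0) t, free true 1 (curve true a 1 0) t))
    (fun t => pair a (clampTime S t)) (fun t => pair b (clampTime S t)) S hS0 hSδ
    (continuous_comp_clampTime ha.continuousOn_pair hS0 hST)
    (continuous_comp_clampTime hb.continuousOn_pair hS0 hST')
    (fun t _ => haR _ (clampTime_mem hS0 t)) (fun t _ => hbR _ (clampTime_mem hS0 t))
    (fun t ht => by
      simp only [clampTime_of_mem ht]
      exact ha.mild hS0 (hSδ.trans hδ1) hST ht)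
    (fun t ht => by
      simp only [clampTime_of_mem ht, ← e]
      exact hb.mild hS0 (hSδ.trans hδ1) hST' ht) t ht
  simpa only [clampTime_of_mem ht] using key

theorem eq_of_pair_eq (ha : IsSolution a₀ T a) {a₁ : ℝ → ℝ} {T' : ℝ} (hb : IsSolution a₁ T' b)
    (ht : t ∈ Ico 0 T) {s : ℝ} (hs : s ∈ Ico 0 T') (hp : pair a t = pair b s) {y : ℝ}
    (hy : 0 ≤ y) : a t y = b s y := by
  have h1 := congrArg (fun p => toC p.1 y) hp
  simpa only [pair, ha.toC_curve ht (k := 0) (by norm_num) hy, D_zero,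
    hb.toC_curve hs (k := 0) (by norm_num) hy] using h1

theorem congr_initial {a₁ : ℝ → ℝ} (h : IsSolution a₀ T a) (h01 : ∀ y, 0 ≤ y → a₀ y = a₁ y) :
    IsSolution a₁ T a :=
  { h with initial := fun y hy => (h.initial y hy).trans (h01 y hy) }

theorem shift_nonneg (h : IsSolution a₀ T a) {t₀ : ℝ} (ht₀ : 0 ≤ t₀) :
    IsSolution (a t₀) (T - t₀) fun t => a (t₀ + t) := by
  rcases ht₀.eq_or_lt with rfl | h1
  · simp only [zero_add, sub_zero]
    exact h.congr_initial fun y hy => (h.initial y hy).symm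
  · exact h.shift h1

/-- Both solutions are bounded on `[0, S]`, and the length `δ` on which they must agree depends on
that bound alone. Hence finitely many steps of length `δ` cover the interval. -/
theorem unique {T' : ℝ} (ha : IsSolution a₀ T a) (hb : IsSolution a₀ T' b) {S : ℝ} (hS : S < T)
    (hS' : S < T') : ∀ t ∈ Icc 0 S, ∀ y, 0 ≤ y → a t y = b t y := by
  rcases lt_or_ge S 0 with hS0 | hS0
  · intro t ht; linarith [ht.1, ht.2]
  have hsub : Icc 0 S ⊆ Ico 0 T := fun s hs => ⟨hs.1, hs.2.trans_lt hS⟩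
  have hsub' : Icc 0 S ⊆ Ico 0 T' := fun s hs => ⟨hs.1, hs.2.trans_lt hS'⟩
  obtain ⟨R1, h1⟩ := isCompact_Icc.exists_bound_of_continuousOn (ha.continuousOn_pair.mono hsub)
  obtain ⟨R2, h2⟩ := isCompact_Icc.exists_bound_of_continuousOn (hb.continuousOn_pair.mono hsub')
  obtain ⟨δ, hδ, hu⟩ := pair_eq_of_small (max R1 R2)
  have key : ∀ n : ℕ, ∀ t ∈ Icc 0 S, t ≤ n * δ → pair a t = pair b t := by
    intro n
    induction n with
    | zero =>
      intro t ht htn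
      rw [Nat.cast_zero, zero_mul] at htn
      obtain rfl : t = 0 := le_antisymm htn ht.1
      refine Prod.ext ?_ ?_
      · exact toBC_congr true (D_congr 0 fun y hy => by rw [ha.initial y hy, hb.initial y hy])
      · exact toBC_congr true (D_congr 1 fun y hy => by rw [ha.initial y hy, hb.initial y hy])
    | succ n ih =>
      intro t ht htn
      rcases le_or_gt t (n * δ) with h3 | h3
      · exact ih t ht h3
      push_cast at htn
      have hn : 0 ≤ n * δ := by positivity
      have ht0 : n * δ ∈ Icc 0 S := ⟨hn, h3.le.trans ht.2⟩
      have e := ih _ ht0 le_rfl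
      have sa := ha.shift_nonneg hn
      have sb := (hb.shift_nonneg hn).congr_initial (a₁ := a (n * δ)) fun y hy =>
        hb.eq_of_pair_eq ha (hsub' ht0) (hsub ht0) e.symm hy
      have hmem : ∀ s ∈ Icc 0 (t - n * δ), n * δ + s ∈ Icc 0 S := fun s hs =>
        ⟨by linarith [hs.1], by linarith [hs.2, ht.2]⟩
      have h4 := hu sa sb (S := t - n * δ) (by linarith) (by linarith [ht.2]) (by linarith [ht.2])
        (by linarith) (fun s hs => (h1 _ (hmem s hs)).trans (le_max_left _ _))
        (fun s hs => (h2 _ (hmem s hs)).trans (le_max_right _ _)) (t - n * δ)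
        ⟨by linarith, le_rfl⟩
      simpa only [pair, curve, add_sub_cancel] using h4
  intro t ht y hy
  obtain ⟨n, hn⟩ := exists_nat_ge (t / δ)
  exact ha.eq_of_pair_eq hb (hsub ht) (hsub' ht) (key n t ht ((div_le_iff₀ hδ).1 hn)) hy

end IsSolution

end

/-! ### A differential inequality -/

theorem monotoneOn_Ico_of_hasDerivAt {f f' : ℝ → ℝ} {T : ℝ} (hc : ContinuousOn f (Ico 0 T))
    (hd : ∀ t ∈ Ioo 0 T, HasDerivAt f (f' t) t) (h : ∀ t ∈ Ioo 0 T, 0 ≤ f' t) :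
    MonotoneOn f (Ico 0 T) := by
  refine monotoneOn_of_hasDerivWithinAt_nonneg (f' := f') (convex_Ico 0 T) hc ?_ ?_
  · intro t ht
    rw [interior_Ico] at ht ⊢
    exact (hd t ht).hasDerivWithinAt
  · intro t ht
    rw [interior_Ico] at ht
    exact h t ht

/-- From `36 F y' ≤ y'² ≤ 28 y F'` the logarithmic derivative of `F` is at least `9/7` of that of
`y`. So `F y ^ (-9/7)` stays above its initial value `c`, whence `y' ≥ 36 c y ^ (9/7)`. The positive
quantity `y ^ (-2/7)` then decreases at a rate of at least `(2/7) * 36 c = (72/7) c`. -/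
theorem lifespan_le {y F y' F' : ℝ → ℝ} {T : ℝ} (hyc : ContinuousOn y (Ico 0 T))
    (hFc : ContinuousOn F (Ico 0 T)) (hy : ∀ t ∈ Ioo 0 T, HasDerivAt y (y' t) t)
    (hF : ∀ t ∈ Ioo 0 T, HasDerivAt F (F' t) t) (hy0 : 0 < y 0) (hF0 : 0 < F 0)
    (h1 : ∀ t ∈ Ioo 0 T, 36 * F t ≤ y' t) (h2 : ∀ t ∈ Ioo 0 T, 0 ≤ F' t)
    (h3 : ∀ t ∈ Ioo 0 T, y' t ^ 2 ≤ 28 * (y t * F' t)) :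
    T ≤ y 0 ^ (-(2 / 7) : ℝ) / (72 / 7 * (F 0 * y 0 ^ (-(9 / 7) : ℝ))) := by
  set c := F 0 * y 0 ^ (-(9 / 7) : ℝ) with hc
  have hcpos : 0 < c := mul_pos hF0 (Real.rpow_pos_of_pos hy0 _)
  have hsub : ∀ t ∈ Ioo 0 T, t ∈ Ico 0 T := fun t ht => Ioo_subset_Ico_self ht
  have h00 : ∀ t ∈ Ico 0 T, (0 : ℝ) ∈ Ico 0 T := fun t ht => ⟨le_rfl, ht.1.trans_lt ht.2⟩
  have hFm := monotoneOn_Ico_of_hasDerivAt hFc hF h2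
  have hFpos : ∀ t ∈ Ico 0 T, 0 < F t := fun t ht => hF0.trans_le (hFm (h00 t ht) ht ht.1)
  have hym := monotoneOn_Ico_of_hasDerivAt hyc hy fun t ht => by
    linarith [h1 t ht, hFpos t (hsub t ht)]
  have hypos : ∀ t ∈ Ico 0 T, 0 < y t := fun t ht => hy0.trans_le (hym (h00 t ht) ht ht.1)
  have hrp : ∀ p : ℝ, ∀ t ∈ Ioo 0 T, HasDerivAt (fun t => y t ^ p) (y' t * p * y t ^ (p - 1)) t :=
    fun p t ht => (hy t ht).rpow_const (Or.inl (hypos t (hsub t ht)).ne')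
  have hrc : ∀ p : ℝ, ContinuousOn (fun t => y t ^ p) (Ico 0 T) := fun p =>
    hyc.rpow_const fun t ht => Or.inl (hypos t ht).ne'
  have hGm := monotoneOn_Ico_of_hasDerivAt (hFc.mul (hrc (-(9 / 7))))
    (fun t ht => (hF t ht).mul (hrp (-(9 / 7)) t ht)) fun t ht => by
      have hyt := hypos t (hsub t ht)
      have e : y t ^ (-(9 / 7) : ℝ) = y t * y t ^ (-(9 / 7) - 1 : ℝ) := by
        rw [Real.rpow_sub_one hyt.ne']; field_simp
      rw [e]
      have hp := Real.rpow_pos_of_pos hyt (-(9 / 7) - 1 : ℝ)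
      have hFt := hFpos t (hsub t ht)
      have k1 := h1 t ht
      have k3 := h3 t ht
      have k4 : 9 / 7 * (F t * y' t) ≤ y t * F' t := by nlinarith
      have k5 : 0 ≤ (y t * F' t - 9 / 7 * (F t * y' t)) * y t ^ (-(9 / 7) - 1 : ℝ) :=
        mul_nonneg (by linarith) hp.le
      linarith
  have hG : ∀ t ∈ Ico 0 T, c ≤ F t * y t ^ (-(9 / 7) : ℝ) := fun t ht => hGm (h00 t ht) ht ht.1
  have hzm := monotoneOn_Ico_of_hasDerivAt (f := fun t => -(y t ^ (-(2 / 7) : ℝ)) - 72 / 7 * c * t)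
    ((hrc _).neg.sub (by fun_prop))
    (fun t ht => (hrp (-(2 / 7)) t ht).fun_neg.sub ((hasDerivAt_id t).const_mul (72 / 7 * c)))
    fun t ht => by
      have hyt := hypos t (hsub t ht)
      rw [show (-(2 / 7) - 1 : ℝ) = -(9 / 7) by norm_num]
      have hp := Real.rpow_pos_of_pos hyt (-(9 / 7) : ℝ)
      have k1 := mul_le_mul_of_nonneg_right (h1 t ht) hp.le
      have k2 := hG t (hsub t ht)
      linarith
  have hlt : ∀ t ∈ Ico 0 T, t ≤ y 0 ^ (-(2 / 7) : ℝ) / (72 / 7 * c) := by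
    intro t ht
    have k1 := hzm (h00 t ht) ht ht.1
    have k2 := Real.rpow_pos_of_pos (hypos t ht) (-(2 / 7) : ℝ)
    simp only [mul_zero, sub_zero] at k1
    rw [le_div_iff₀ (by positivity)]
    linarith
  refine le_of_forall_lt fun t ht => ?_
  rcases lt_or_ge t 0 with h0 | h0
  · exact h0.trans (by have := Real.rpow_pos_of_pos hy0 (-(2 / 7) : ℝ); positivity)
  · obtain ⟨s, hs1, hs2⟩ := exists_between ht
    exact hs1.trans_le (hlt s ⟨h0.trans hs1.le, hs2⟩)

section

/-! ### Integral identities -/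

/-- The integral over the half-line. -/
def intBC : BC true →L[ℝ] ℝ :=
  LinearMap.mkContinuous
    { toFun := fun f => ∫ x in Ici 0, toC f x
      map_add' := fun f g => by
        simp only [toC_add_apply]
        exact integral_add (integrableOn_toC f) (integrableOn_toC g)
      map_smul' := fun c f => by
        simp only [map_smul]
        exact integral_const_mul c _ } 1 (by
    intro f
    rw [one_mul]
    exact (norm_integral_le_integral_norm _).trans (integral_abs_toC_le f))

/-- The bilinear form `∫ f g` over the half-line. -/
def pairing : BC true →L[ℝ] BC true →L[ℝ] ℝ :=
  (ContinuousLinearMap.compL ℝ (BC true) (BC true) ℝ intBC).comp (mulBC.comp toC)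

theorem pairing_apply (f g : BC true) : pairing f g = ∫ x in Ici 0, toC f x * toC g x := rfl

theorem pairing_comm (f g : BC true) : pairing f g = pairing g f := by
  simp only [pairing_apply, mul_comm]

theorem pairing_self_nonneg (f : BC true) : 0 ≤ pairing f f :=
  integral_nonneg fun _ => mul_self_nonneg _

theorem pairing_sq_le (f g : BC true) : pairing f g ^ 2 ≤ pairing f f * pairing g g := by
  have h : ∀ c : ℝ, 0 ≤ pairing g g * (c * c) + 2 * pairing f g * c + pairing f f := fun c => by
    have := pairing_self_nonneg (f + c • g)
    simp only [map_add, map_smul, _root_.add_apply, _root_.smul_apply, smul_eq_mul] at this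
    rw [pairing_comm g f] at this
    linarith
  have := discrim_le_zero h
  rw [discrim] at this
  linarith

theorem mulBC_pairing (f g h : BC true) : pairing (mulBC (toC f) g) h = pairing g (mulBC (toC f) h) := by
  simp only [pairing_apply, toC_mulBC]
  congr 1
  ext x
  ring

/-- Each integral identity below is obtained by exhibiting a primitive of the difference of its two
sides that vanishes at `0` and at infinity. -/
theorem intBC_eq_zero {g : BC true} {F : ℝ → ℝ} (hF : IsDer F (toC g)) (hc : ContinuousOn F (Ici 0))
    (h0 : F 0 = 0) (hlim : Tendsto F atTop (𝓝 0)) : intBC g = 0 := by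
  change ∫ x in Ici 0, toC g x = 0
  rw [integral_Ici_eq_integral_Ioi, integral_Ioi_of_hasDerivAt_of_tendsto (hc 0 self_mem_Ici)
    (fun x hx => hF x hx) ((integrableOn_toC g).mono_set Ioi_subset_Ici_self) hlim, h0, sub_zero]

theorem tendsto_prim (f : BC true) : Tendsto (prim f) atTop (𝓝 (∫ x in Ioi 0, toC f x)) := by
  refine (intervalIntegral_tendsto_integral_Ioi 0
    ((integrableOn_toC f).mono_set Ioi_subset_Ici_self) tendsto_id).congr' ?_
  filter_upwards [eventually_ge_atTop 0] with x hx using (prim_apply f hx).symm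

/-- A function and its first four derivatives, with clamped boundary conditions. -/
structure Clamped (f : ℕ → BC true) : Prop where
  der : ∀ k ≤ 3, IsDer (toC (f k)) (toC (f (k + 1)))
  zero : toC (f 0) 0 = 0
  one : toC (f 1) 0 = 0

namespace Clamped

variable {f g : ℕ → BC true}

theorem tendsto (hf : Clamped f) {k : ℕ} (hk : k ≤ 3) : Tendsto (toC (f k)) atTop (𝓝 0) :=
  tendsto_zero_of_isDer _ _ (hf.der k hk)

theorem pairing_four (hf : Clamped f) (hg : Clamped g) :
    pairing (f 0) (g 4) = pairing (f 2) (g 2) := by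
  have h : intBC (mulBC (toC (f 0)) (g 4) - mulBC (toC (f 2)) (g 2)) = 0 := by
    refine intBC_eq_zero (F := fun x => toC (f 0) x * toC (g 3) x - toC (f 1) x * toC (g 2) x)
      (fun y hy => ?_) (by fun_prop) (by rw [hf.zero, hf.one]; ring) ?_
    · refine (((hf.der 0 (by norm_num) y hy).mul (hg.der 3 (by norm_num) y hy)).sub
        ((hf.der 1 (by norm_num) y hy).mul (hg.der 2 (by norm_num) y hy))).congr_deriv ?_
      rw [toC_sub_apply, toC_mulBC, toC_mulBC]
      ring
    · have := ((hf.tendsto (k := 0) (by norm_num)).mul (hg.tendsto (k := 3) (by norm_num))).sub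
        ((hf.tendsto (k := 1) (by norm_num)).mul (hg.tendsto (k := 2) (by norm_num)))
      simpa using this
  rw [map_sub] at h
  exact sub_eq_zero.1 h

theorem pairing_four_comm (hf : Clamped f) (hg : Clamped g) :
    pairing (f 0) (g 4) = pairing (g 0) (f 4) := by
  rw [hf.pairing_four hg, hg.pairing_four hf, pairing_comm]

/-- The integrand is `½ (a²)_y b` with `b_y = a`. -/
theorem pairing_transport (hf : Clamped f) :
    pairing (f 0) (mulBC (prim (f 0)) (f 1)) = -(1 / 2) * pairing (f 0) (mulBC (toC (f 0)) (f 0)) := by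
  have h : intBC (mulBC (toC (f 0)) (mulBC (prim (f 0)) (f 1)) +
      (1 / 2 : ℝ) • mulBC (toC (f 0)) (mulBC (toC (f 0)) (f 0))) = 0 := by
    refine intBC_eq_zero (F := fun x => 1 / 2 * (toC (f 0) x * toC (f 0) x * prim (f 0) x))
      (fun y hy => ?_) (by fun_prop) (by rw [hf.zero]; ring) ?_
    · have d0 := hf.der 0 (by norm_num) y hy
      refine (((d0.mul d0).mul (hasDerivAt_prim (f 0) hy)).const_mul (1 / 2)).congr_deriv ?_
      simp only [toC_add_apply, toC_smul_apply, toC_mulBC, Pi.mul_apply]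
      ring
    · have t0 := hf.tendsto (k := 0) (by norm_num)
      have := ((t0.mul t0).mul (tendsto_prim (f 0))).const_mul (1 / 2)
      simpa using this
  rw [map_add, map_smul, smul_eq_mul] at h
  change pairing (f 0) (mulBC (prim (f 0)) (f 1)) +
    1 / 2 * pairing (f 0) (mulBC (toC (f 0)) (f 0)) = 0 at h
  linarith

/-- The integrand is `⅓ (a³)_y b` with `b_y = a`. -/
theorem pairing_sq_transport (hf : Clamped f) :
    pairing (mulBC (toC (f 0)) (f 0)) (mulBC (prim (f 0)) (f 1)) =
      -(1 / 3) * pairing (mulBC (toC (f 0)) (f 0)) (mulBC (toC (f 0)) (f 0)) := by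
  have h : intBC (mulBC (toC (mulBC (toC (f 0)) (f 0))) (mulBC (prim (f 0)) (f 1)) +
      (1 / 3 : ℝ) • mulBC (toC (mulBC (toC (f 0)) (f 0))) (mulBC (toC (f 0)) (f 0))) = 0 := by
    refine intBC_eq_zero
      (F := fun x => 1 / 3 * (toC (f 0) x * toC (f 0) x * toC (f 0) x * prim (f 0) x))
      (fun y hy => ?_) (by fun_prop) (by rw [hf.zero]; ring) ?_
    · have d0 := hf.der 0 (by norm_num) y hy
      refine ((((d0.mul d0).mul d0).mul (hasDerivAt_prim (f 0) hy)).const_mul (1 / 3)).congr_deriv ?_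
      simp only [toC_add_apply, toC_smul_apply, toC_mulBC, Pi.mul_apply]
      ring
    · have t0 := hf.tendsto (k := 0) (by norm_num)
      have := (((t0.mul t0).mul t0).mul (tendsto_prim (f 0))).const_mul (1 / 3)
      simpa using this
  rw [map_add, map_smul, smul_eq_mul] at h
  change pairing (mulBC (toC (f 0)) (f 0)) (mulBC (prim (f 0)) (f 1)) +
    1 / 3 * pairing (mulBC (toC (f 0)) (f 0)) (mulBC (toC (f 0)) (f 0)) = 0 at h
  linarith

/-- One integration by parts gives `-∫ a a_y a_yyy - ∫ b a_yy a_yyy`. The first term is `½ ∫ a²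
a_yyyy`. The second is `½ ∫ a a_yy² = -½ ∫ a a_y a_yyy = ¼ ∫ a² a_yyyy`, because `a_y² a_yy`
integrates to zero. -/
theorem pairing_transport_four (hf : Clamped f) :
    pairing (mulBC (prim (f 0)) (f 1)) (f 4) =
      3 / 4 * pairing (mulBC (toC (f 0)) (f 0)) (f 4) := by
  have h : intBC (mulBC (toC (mulBC (prim (f 0)) (f 1))) (f 4) -
      (3 / 4 : ℝ) • mulBC (toC (mulBC (toC (f 0)) (f 0))) (f 4)) = 0 := by
    have t0 := hf.tendsto (k := 0) (by norm_num)
    have t1 := hf.tendsto (k := 1) (by norm_num)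
    have t2 := hf.tendsto (k := 2) (by norm_num)
    have t3 := hf.tendsto (k := 3) (by norm_num)
    have tb := tendsto_prim (f 0)
    refine intBC_eq_zero (F := fun x =>
      prim (f 0) x * (toC (f 1) x * toC (f 3) x) - 1 / 2 * (prim (f 0) x * (toC (f 2) x * toC (f 2) x))
      + 1 / 2 * (toC (f 0) x * (toC (f 1) x * toC (f 2) x))
      - 1 / 6 * (toC (f 1) x * (toC (f 1) x * toC (f 1) x))
      - 3 / 4 * (toC (f 0) x * (toC (f 0) x * toC (f 3) x)))
      (fun y hy => ?_) (by fun_prop) (by simp only [hf.zero, hf.one, prim_zero]; ring) ?_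
    · have d0 := hf.der 0 (by norm_num) y hy
      have d1 := hf.der 1 (by norm_num) y hy
      have d2 := hf.der 2 (by norm_num) y hy
      have d3 := hf.der 3 (by norm_num) y hy
      have db := hasDerivAt_prim (f 0) hy
      refine (((((db.mul (d1.mul d3)).sub ((db.mul (d2.mul d2)).const_mul (1 / 2))).add
        ((d0.mul (d1.mul d2)).const_mul (1 / 2))).sub
        ((d1.mul (d1.mul d1)).const_mul (1 / 6))).sub
        ((d0.mul (d0.mul d3)).const_mul (3 / 4))).congr_deriv ?_
      simp only [toC_sub_apply, toC_smul_apply, toC_mulBC, Pi.mul_apply]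
      ring
    · have := ((((tb.mul (t1.mul t3)).sub ((tb.mul (t2.mul t2)).const_mul (1 / 2))).add
        ((t0.mul (t1.mul t2)).const_mul (1 / 2))).sub
        ((t1.mul (t1.mul t1)).const_mul (1 / 6))).sub
        ((t0.mul (t0.mul t3)).const_mul (3 / 4))
      simpa using this
  rw [map_sub, map_smul, smul_eq_mul] at h
  change pairing (mulBC (prim (f 0)) (f 1)) (f 4) -
    3 / 4 * pairing (mulBC (toC (f 0)) (f 0)) (f 4) = 0 at h
  linarith

end Clamped

/-! ### The energy along a solution -/

namespace IsSolution

variable {a₀ : ℝ → ℝ} {T : ℝ} {a : ℝ → ℝ → ℝ} {t : ℝ}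

theorem clamped (h : IsSolution a₀ T a) (ht : t ∈ Ico 0 T) :
    Clamped fun k => curve true a k t :=
  ⟨fun _ hk => h.isDer ht hk, h.toC_curve_zero ht, h.toC_curve_one ht⟩

end IsSolution

/-- The square of the `L²` norm of `a(t)`. -/
def massSq (a : ℝ → ℝ → ℝ) (t : ℝ) : ℝ := pairing (curve true a 0 t) (curve true a 0 t)

/-- The negative of the energy of `a(t)`. -/
def negEnergy (a : ℝ → ℝ → ℝ) (t : ℝ) : ℝ :=
  1 / 12 * pairing (curve true a 0 t) (mulBC (toC (curve true a 0 t)) (curve true a 0 t)) -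
    1 / 2 * pairing (curve true a 0 t) (curve true a 4 t)

namespace IsSolution

variable {a₀ : ℝ → ℝ} {T : ℝ} {a : ℝ → ℝ → ℝ} {t : ℝ}

theorem negEnergy_eq (h : IsSolution a₀ T a) (ht : t ∈ Ico 0 T) : negEnergy a t = -energy (a t) := by
  rw [negEnergy, (h.clamped ht).pairing_four (h.clamped ht)]
  have e : ∀ y ∈ Ici (0 : ℝ), (1 / 2) * (D 2 (a t) y) ^ 2 - (1 / 12) * (a t y) ^ 3 =
      toC ((1 / 2 : ℝ) • mulBC (toC (curve true a 2 t)) (curve true a 2 t) - (1 / 12 : ℝ) •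
        mulBC (toC (curve true a 0 t)) (mulBC (toC (curve true a 0 t)) (curve true a 0 t))) y := by
    intro y hy
    simp only [toC_sub_apply, toC_smul_apply, toC_mulBC]
    rw [h.toC_curve ht (by norm_num) hy, h.toC_curve ht (by norm_num) hy, D_zero]
    ring
  have e2 : energy (a t) = intBC ((1 / 2 : ℝ) • mulBC (toC (curve true a 2 t)) (curve true a 2 t) -
      (1 / 12 : ℝ) • mulBC (toC (curve true a 0 t))
        (mulBC (toC (curve true a 0 t)) (curve true a 0 t))) :=
    setIntegral_congr_fun measurableSet_Ici e
  rw [e2, map_sub, map_smul, map_smul, smul_eq_mul, smul_eq_mul]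
  change _ = -(1 / 2 * pairing (curve true a 2 t) (curve true a 2 t) - 1 / 12 *
    pairing (curve true a 0 t) (mulBC (toC (curve true a 0 t)) (curve true a 0 t)))
  ring

theorem continuousOn_massSq (h : IsSolution a₀ T a) : ContinuousOn (massSq a) (Ico 0 T) := by
  have c0 := h.continuousOn_curve (k := 0) (by norm_num)
  exact (pairing.continuous.comp_continuousOn c0).clm_apply c0

theorem continuousOn_negEnergy (h : IsSolution a₀ T a) : ContinuousOn (negEnergy a) (Ico 0 T) := by
  have c0 := h.continuousOn_curve (k := 0) (by norm_num)
  have c4 := h.continuousOn_curve (k := 4) (by norm_num)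
  exact (((pairing.continuous.comp_continuousOn c0).clm_apply
    ((mulBC.continuous.comp_continuousOn (toC.continuous.comp_continuousOn c0)).clm_apply
    c0)).const_mul _).sub (((pairing.continuous.comp_continuousOn c0).clm_apply c4).const_mul _)

theorem hasDerivAt_massSq (h : IsSolution a₀ T a) (ht : t ∈ Ioo 0 T) :
    HasDerivAt (massSq a) (2 * pairing (curve true a 0 t) (rate a t)) t := by
  have d0 := h.hasDerivAt_curve ht
  have := pairing.hasDerivAt_of_bilinear (fun _ => d0) (fun _ => d0)
  refine this.congr_deriv ?_
  rw [pairing_comm (rate a t)]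
  ring

/-- No time derivative of the fourth space derivative is available. By symmetry of the form the
increment equals `⟨a(s) - a(t), a_yyyy(s) + a_yyyy(t)⟩`, so differentiability of `a` and continuity
of `a_yyyy` suffice. -/
theorem hasDerivAt_pairing_four (h : IsSolution a₀ T a) (ht : t ∈ Ioo 0 T) :
    HasDerivAt (fun s => pairing (curve true a 0 s) (curve true a 4 s))
      (2 * pairing (rate a t) (curve true a 4 t)) t := by
  have d0 := h.hasDerivAt_curve ht
  have c4 : ContinuousAt (curve true a 4) t :=
    (h.continuousOn_curve (k := 4) le_rfl).continuousAt (Ico_mem_nhds ht.1 ht.2)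
  rw [hasDerivAt_iff_tendsto_slope] at d0 ⊢
  have h1 : Tendsto (fun s => curve true a 4 s + curve true a 4 t) (𝓝[≠] t)
      (𝓝 (curve true a 4 t + curve true a 4 t)) :=
    (c4.tendsto.mono_left nhdsWithin_le_nhds).add tendsto_const_nhds
  have h2 : Tendsto (fun s => pairing (slope (curve true a 0) t s)
      (curve true a 4 s + curve true a 4 t)) (𝓝[≠] t)
      (𝓝 (pairing (rate a t) (curve true a 4 t + curve true a 4 t))) :=
    (isBoundedBilinearMap_apply.continuous.tendsto (pairing (rate a t), _)).comp
      (((pairing.continuous.tendsto _).comp d0).prodMk_nhds h1)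
  rw [map_add, ← two_mul] at h2
  refine h2.congr' ?_
  filter_upwards [nhdsWithin_le_nhds (Ioo_mem_nhds ht.1 ht.2)] with s hs
  have e := (h.clamped (Ioo_subset_Ico_self hs)).pairing_four_comm
    (h.clamped (Ioo_subset_Ico_self ht))
  simp only [slope_def_module, map_smul, map_sub, map_add, _root_.smul_apply, _root_.sub_apply,
    smul_eq_mul]
  rw [e]
  ring

theorem hasDerivAt_negEnergy (h : IsSolution a₀ T a) (ht : t ∈ Ioo 0 T) :
    HasDerivAt (negEnergy a) (1 / 4 * pairing (mulBC (toC (curve true a 0 t)) (curve true a 0 t))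
      (rate a t) - pairing (rate a t) (curve true a 4 t)) t := by
  have d0 := h.hasDerivAt_curve ht
  have dC : HasDerivAt (fun s => toC (curve true a 0 s)) (toC (rate a t)) t :=
    (toC (β := true)).hasFDerivAt.comp_hasDerivAt t d0
  have d1 := mulBC.hasDerivAt_of_bilinear (fun _ => dC) (fun _ => d0)
  have d2 := pairing.hasDerivAt_of_bilinear (fun _ => d0) (fun _ => d1)
  refine ((d2.const_mul (1 / 12)).sub
    ((h.hasDerivAt_pairing_four ht).const_mul (1 / 2))).congr_deriv ?_
  have e : ∀ f g : BC true, pairing f (mulBC (toC g) f) = pairing (mulBC (toC f) f) g := by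
    intro f g
    simp only [pairing_apply, toC_mulBC]
    congr 1
    ext x
    ring
  rw [map_add, e, ← mulBC_pairing, pairing_comm (rate a t) (mulBC _ _)]
  ring

/-- The three transport identities reduce everything to the quadratic form spanned by `a²` and
`a_yyyy`. The first inequality has the slack `16 ‖a_yy‖²`. -/
theorem energy_inequalities (h : IsSolution a₀ T a) (ht : t ∈ Ioo 0 T) :
    36 * negEnergy a t ≤ 2 * pairing (curve true a 0 t) (rate a t) ∧
    0 ≤ 1 / 4 * pairing (mulBC (toC (curve true a 0 t)) (curve true a 0 t)) (rate a t) -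
      pairing (rate a t) (curve true a 4 t) ∧
    (2 * pairing (curve true a 0 t) (rate a t)) ^ 2 ≤ 28 * (massSq a t *
      (1 / 4 * pairing (mulBC (toC (curve true a 0 t)) (curve true a 0 t)) (rate a t) -
      pairing (rate a t) (curve true a 4 t))) := by
  have hc := h.clamped (Ioo_subset_Ico_self ht)
  have i1 := hc.pairing_transport
  have i2 := hc.pairing_sq_transport
  have i3 := hc.pairing_transport_four
  have i4 := hc.pairing_four hc
  have eR : rate a t = mulBC (toC (curve true a 0 t)) (curve true a 0 t) -
    mulBC (prim (curve true a 0 t)) (curve true a 1 t) - curve true a 4 t := rfl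
  rw [massSq, negEnergy, eR]
  -- What remains is bilinear algebra in `f = a`, `f4 = a_yyyy`, `n = a_y ∫₀^y a` and `q = a²`.
  generalize curve true a 0 t = f at *
  generalize curve true a 1 t = f1 at *
  generalize curve true a 2 t = f2 at *
  generalize curve true a 4 t = f4 at *
  generalize mulBC (prim f) f1 = n at *
  generalize mulBC (toC f) f = q at *
  have hn2 := pairing_self_nonneg f2
  have hq : 0 ≤ pairing q q := pairing_self_nonneg q
  have hc1 := pairing_comm f4 q
  have hc2 := pairing_comm n q
  have h0 := pairing_self_nonneg (q - (3 / 2 : ℝ) • f4)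
  have h5 := pairing_sq_le f ((3 : ℝ) • q - (2 : ℝ) • f4)
  have h6 := pairing_self_nonneg f
  have h7 := pairing_self_nonneg ((1 / 24 : ℝ) • q - f4)
  simp only [map_sub, map_smul, _root_.sub_apply, _root_.smul_apply, smul_eq_mul] at *
  rw [hc1] at h0 h5 h7
  have e1 : 2 * (pairing f q - pairing f n - pairing f f4) = pairing f q * 3 - pairing f f4 * 2 := by
    rw [i1]; ring
  have e2 : 1 / 4 * (pairing q q - pairing q n - pairing q f4) -
      (pairing q f4 - pairing n f4 - pairing f4 f4) =
      pairing f4 f4 - 1 / 2 * pairing q f4 + 1 / 3 * pairing q q := by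
    rw [i2, i3]; ring
  rw [e1, e2]
  -- The form is positive definite: `(1/2)² < 4 * (1/3)`. The squares `h0` and `h7`, with the
  -- nonnegativity of `pairing q q`, certify it.
  have e3 : 0 ≤ pairing f4 f4 - 1 / 2 * pairing q f4 + 1 / 3 * pairing q q := by nlinarith
  refine ⟨by linarith, e3, ?_⟩
  -- The right side exceeds the left by `24 ‖f4 - q / 24‖² + (7 / 24) ‖q‖²`, which is why `h7` was
  -- prepared.
  have e4 : 9 * pairing q q - 12 * pairing q f4 + 4 * pairing f4 f4 ≤
      28 * (pairing f4 f4 - 1 / 2 * pairing q f4 + 1 / 3 * pairing q q) := by nlinarith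
  have e5 := mul_le_mul_of_nonneg_left e4 h6
  nlinarith

/-- The cubic term is at most the uniform norm times the mass. With zero mass it would be
nonpositive, and so would the negative energy. -/
theorem massSq_pos (h : IsSolution a₀ T a) (ht : t ∈ Ico 0 T) (hE : 0 < negEnergy a t) :
    0 < massSq a t := by
  have hc := h.clamped ht
  have h1 := pairing_self_nonneg (curve true a 2 t)
  have h2 : pairing (curve true a 0 t) (mulBC (toC (curve true a 0 t)) (curve true a 0 t)) ≤
      ‖curve true a 0 t‖ * massSq a t := by
    rw [massSq, pairing_apply, pairing_apply, ← integral_const_mul]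
    refine integral_mono (integrableOn_toC (mulBC (toC (curve true a 0 t)) (mulBC _ _)))
      ((integrableOn_toC (mulBC (toC (curve true a 0 t)) (curve true a 0 t))).const_mul _) fun x => ?_
    change toC (curve true a 0 t) x * (toC (curve true a 0 t) x * toC (curve true a 0 t) x) ≤ _
    exact mul_le_mul_of_nonneg_right ((le_abs_self _).trans (abs_toC_le _ x)) (mul_self_nonneg _)
  rw [negEnergy, hc.pairing_four hc] at hE
  have h3 := norm_nonneg (curve true a 0 t)
  have h4 : 0 ≤ massSq a t := pairing_self_nonneg _
  by_contra h5
  have h6 : massSq a t = 0 := le_antisymm (not_lt.1 h5) h4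
  rw [h6] at h2
  linarith

end IsSolution

theorem exists_lifespan_bound (a₀ : ℝ → ℝ) (hE : energy a₀ < 0) :
    ∃ B : ℝ, ∀ (T : ℝ) (a : ℝ → ℝ → ℝ), IsSolution a₀ T a → T ≤ B := by
  -- A constant curve evaluates the mass and the energy on the datum itself, so the bound does not
  -- refer to any solution. The maximum with `0` covers intervals with `T ≤ 0`, where there is no
  -- initial time to use.
  let c : ℝ → ℝ → ℝ := fun _ => a₀
  refine ⟨max 0 (massSq c 0 ^ (-(2 / 7) : ℝ) /
    (72 / 7 * (negEnergy c 0 * massSq c 0 ^ (-(9 / 7) : ℝ)))), fun T a h => ?_⟩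
  rcases le_or_gt T 0 with hT | hT
  · exact hT.trans (le_max_left _ _)
  have h0 : (0 : ℝ) ∈ Ico 0 T := ⟨le_rfl, hT⟩
  have e : ∀ k, curve true a k 0 = curve true c k 0 := fun k =>
    toBC_congr true (D_congr k h.initial)
  have e1 : massSq a 0 = massSq c 0 := by rw [massSq, massSq, e]
  have e2 : negEnergy a 0 = negEnergy c 0 := by rw [negEnergy, negEnergy, e, e]
  have hEa : energy (a 0) = energy a₀ := by
    refine setIntegral_congr_fun measurableSet_Ici fun y hy => ?_
    change 1 / 2 * D 2 (a 0) y ^ 2 - 1 / 12 * a 0 y ^ 3 = 1 / 2 * D 2 a₀ y ^ 2 - 1 / 12 * a₀ y ^ 3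
    rw [D_congr 2 h.initial y hy, h.initial y hy]
  have hpos : 0 < negEnergy a 0 := by rw [h.negEnergy_eq h0, hEa]; linarith
  rw [← e1, ← e2]
  refine le_trans ?_ (le_max_right _ _)
  exact lifespan_le h.continuousOn_massSq h.continuousOn_negEnergy
    (fun t ht => h.hasDerivAt_massSq ht) (fun t ht => h.hasDerivAt_negEnergy ht)
    (h.massSq_pos h0 hpos) hpos (fun t ht => (h.energy_inequalities ht).1)
    (fun t ht => (h.energy_inequalities ht).2.1) (fun t ht => (h.energy_inequalities ht).2.2)

end

section

/-! ### The maximal solution and its blow-up -/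

variable {a₀ : ℝ → ℝ} {T : ℝ} {a b : ℝ → ℝ → ℝ} {t : ℝ}

theorem abs_le_of_isDer {f f' : BC true} (h : IsDer (toC f) (toC f')) (h0 : toC f 0 = 0) {x : ℝ}
    (hx : 0 ≤ x) : |toC f x| ≤ ∫ z, |toC f' z| ∂(meas true) := by
  have e := h.integral_eq (toC f).continuous.continuousOn (toC f').continuous hx
  rw [h0, sub_zero] at e
  rw [← e, intervalIntegral.integral_of_le hx]
  refine (norm_integral_le_integral_norm (toC f')).trans ?_
  refine setIntegral_mono_set (integrableOn_toC f').abs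
    (Eventually.of_forall fun x => abs_nonneg _) ?_
  exact (Ioc_subset_Ioi_self.trans Ioi_subset_Ici_self).eventuallyLE

/-- Since `a` and `a_y` vanish at `0`, their uniform norms are bounded by the L¹ norms of their
derivatives. Only the L¹ part of the X-norm is used. -/
theorem IsSolution.norm_curve_le (h : IsSolution a₀ T a) (ht : t ∈ Ico 0 T) {M : ℝ} (hM : 0 ≤ M)
    (hx : xNorm (a t) ≤ ENNReal.ofReal M) :
    ‖curve true a 0 t‖ ≤ M ∧ ‖curve true a 1 t‖ ≤ M := by
  have h1 : ∀ k ≤ 4, ∫ z, |toC (curve true a k t) z| ∂(meas true) ≤ M := by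
    intro k hk
    rw [← ENNReal.ofReal_le_ofReal_iff hM, ofReal_integral_abs_toC,
      eLpNorm_congr_Ici fun y hy => h.toC_curve ht hk hy]
    refine le_trans ?_ hx
    have h2 := Finset.single_le_sum
      (f := fun k => eLpNorm (D k (a t)) 1 (volume.restrict (Ici 0))) (fun _ _ => zero_le)
      (Finset.mem_range.2 (by omega : k < 5))
    exact h2.trans le_add_self
  constructor
  · refine norm_BC_le hM (fun x => ?_) (h1 0 (by norm_num))
    rw [isExt_curve true a 0 t x]
    exact (abs_le_of_isDer (h.isDer ht (k := 0) (by norm_num)) (h.toC_curve_zero ht)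
      (le_max_right x 0)).trans (h1 1 (by norm_num))
  · refine norm_BC_le hM (fun x => ?_) (h1 1 (by norm_num))
    rw [isExt_curve true a 1 t x]
    exact (abs_le_of_isDer (h.isDer ht (k := 1) (by norm_num)) (h.toC_curve_one ht)
      (le_max_right x 0)).trans (h1 2 (by norm_num))

/-- A bounded lifespan yields a maximal solution, of which all others are restrictions. -/
theorem exists_maximal (h₀ : IsDatum a₀)
    (hB : ∃ B : ℝ, ∀ (T : ℝ) (a : ℝ → ℝ → ℝ), IsSolution a₀ T a → T ≤ B) :
    ∃ T : ℝ, 0 < T ∧ ∃ a, IsSolution a₀ T a ∧ ∀ S b, IsSolution a₀ S b →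
      S ≤ T ∧ ∀ t ∈ Ico 0 S, ∀ y, 0 ≤ y → b t y = a t y := by
  obtain ⟨B, hB⟩ := hB
  let 𝒮 : Set ℝ := {S | 0 < S ∧ ∃ a, IsSolution a₀ S a}
  have hbdd : BddAbove 𝒮 := ⟨B, fun S hS => hB S _ hS.2.choose_spec⟩
  obtain ⟨τ, hτ, hloc⟩ := exists_local (max ‖toBC true (D 0 a₀)‖ ‖toBC true (D 1 a₀)‖)
  have hτS : τ ∈ 𝒮 := ⟨hτ, hloc a₀ h₀ (le_max_left _ _) (le_max_right _ _)⟩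
  have hT : 0 < sSup 𝒮 := hτ.trans_le (le_csSup hbdd hτS)
  -- For each `t` below the supremum a solution living past `t` is chosen. Uniqueness makes the
  -- diagonal `t ↦ α t t` coherent, and its values from the supremum on are irrelevant.
  have hex : ∀ t, ∃ (S : ℝ) (b : ℝ → ℝ → ℝ), t < sSup 𝒮 → t < S ∧ 0 < S ∧ IsSolution a₀ S b := by
    intro t
    by_cases ht : t < sSup 𝒮
    · obtain ⟨S, ⟨hS, b, hb⟩, htS⟩ := exists_lt_of_lt_csSup ⟨τ, hτS⟩ ht
      exact ⟨S, b, fun _ => ⟨htS, hS, hb⟩⟩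
    · exact ⟨0, fun _ _ => 0, fun h => absurd h ht⟩
  choose σ α hα using hex
  have hagree : ∀ S b, IsSolution a₀ S b → ∀ t ∈ Ico 0 S, t < sSup 𝒮 → ∀ y, 0 ≤ y →
      α t t y = b t y := fun S b hb t ht htT y hy =>
    (hα t htT).2.2.unique hb (hα t htT).1 ht.2 t ⟨ht.1, le_rfl⟩ y hy
  have hle : ∀ S b, IsSolution a₀ S b → S ≤ sSup 𝒮 := by
    intro S b hb
    rcases le_or_gt S 0 with hS | hS
    · exact hS.trans hT.le
    · exact le_csSup hbdd ⟨hS, b, hb⟩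
  have hagree' : ∀ S b, IsSolution a₀ S b → ∀ t ∈ Ico 0 S, ∀ y, 0 ≤ y → α t t y = b t y :=
    fun S b hb t ht => hagree S b hb t ht (ht.2.trans_le (hle S b hb))
  refine ⟨sSup 𝒮, hT, fun t => α t t, ?_, fun S b hb => ⟨hle S b hb, fun t ht y hy =>
    (hagree' S b hb t ht y hy).symm⟩⟩
  refine IsSolution.extend (hα 0 hT).2.1 (hα 0 hT).2.2 (hagree' _ _ (hα 0 hT).2.2)
    (fun t ht => ?_) fun S hS => ?_
  · have hs := hα t ht.2
    refine (hs.2.2.regAt ⟨ht.1, hs.1⟩).congr ?_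
    filter_upwards [Ioo_mem_nhds ht.1 hs.1] with s hs'
    exact hagree' _ _ hs.2.2 s (Ioo_subset_Ico_self hs')
  · have hs := hα S hS
    obtain ⟨C, hC⟩ := hs.2.2.bounded_D6 S hs.1
    refine ⟨C, fun t ht y hy => ?_⟩
    rw [D_congr 6 (hagree' _ _ hs.2.2 t ⟨ht.1, ht.2.trans_lt hs.1⟩) y hy]
    exact hC t ht y hy

/-- Gluing a solution with one that starts from its value at a positive time. -/
theorem IsSolution.glue (ha : IsSolution a₀ T a) {t₀ τ : ℝ} (ht₀ : t₀ ∈ Ioo 0 T)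
    {c : ℝ → ℝ → ℝ} (hc : IsSolution (a t₀) τ c) (hτ : T < t₀ + τ) :
    ∃ b, IsSolution a₀ (t₀ + τ) b := by
  let b : ℝ → ℝ → ℝ := fun t => if t < t₀ then a t else c (t - t₀)
  have hb1 : ∀ t, t < t₀ → b t = a t := fun t ht => if_pos ht
  have hb2 : ∀ t, t₀ ≤ t → b t = c (t - t₀) := fun t ht => if_neg (not_lt.2 ht)
  -- By uniqueness `c` continues `a` up to time `T`, so no regularity has to be checked at the seam
  -- `t₀`: near it the glued function is `a`.
  have hab : ∀ t ∈ Ico 0 T, ∀ y, 0 ≤ y → b t y = a t y := by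
    intro t ht y hy
    rcases lt_or_ge t t₀ with h1 | h1
    · rw [hb1 t h1]
    · have := (ha.shift ht₀.1).unique hc (S := t - t₀) (by linarith [ht.2]) (by linarith [ht.2])
        (t - t₀) ⟨by linarith, le_rfl⟩ y hy
      rw [hb2 t h1, ← this, add_sub_cancel]
  refine ⟨b, ha.extend (ht₀.1.trans ht₀.2) hab (fun t ht => ?_) fun S hS => ?_⟩
  · rcases lt_or_ge t T with h1 | h1
    · refine (ha.regAt ⟨ht.1, h1⟩).congr ?_
      filter_upwards [Ioo_mem_nhds ht.1 h1] with s hs using hab s (Ioo_subset_Ico_self hs)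
    · have h2 : t₀ < t := ht₀.2.trans_le h1
      have h3 : RegAt (fun s => b (t₀ + s)) (t - t₀) := by
        refine (hc.regAt ⟨by linarith, by linarith [ht.2]⟩).congr ?_
        filter_upwards [Ioi_mem_nhds (show 0 < t - t₀ by linarith)] with s hs y _
        rw [hb2 _ (by linarith [mem_Ioi.1 hs]), add_sub_cancel_left]
      have := h3.of_shift
      rwa [add_sub_cancel] at this
  · obtain ⟨C1, h1⟩ := ha.bounded_D6 t₀ ht₀.2
    obtain ⟨C2, h2⟩ := hc.bounded_D6 (S - t₀) (by linarith)
    refine ⟨max C1 C2, fun t ht y hy => ?_⟩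
    rcases lt_or_ge t t₀ with h3 | h3
    · rw [hb1 t h3]
      exact (h1 t ⟨ht.1, h3.le⟩ y hy).trans (le_max_left _ _)
    · rw [hb2 t h3]
      exact (h2 _ ⟨by linarith, by linarith [ht.2]⟩ y hy).trans (le_max_right _ _)

/-- Otherwise the norm is at most some `M` at times arbitrarily close to `T`. The local existence
time attached to `M` is the same for all of them, so a late restart reaches beyond `T`, against
maximality. -/
theorem tendsto_xNorm_of_maximal (hT : 0 < T) (ha : IsSolution a₀ T a)
    (hmax : ∀ S b, IsSolution a₀ S b → S ≤ T) :
    Tendsto (fun t => xNorm (a t)) (𝓝[<] T) (𝓝 ∞) := by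
  rw [ENNReal.tendsto_nhds_top_iff_nnreal]
  intro M
  by_contra hM
  obtain ⟨τ, hτ, hloc⟩ := exists_local M
  have h1 : ∃ᶠ t in 𝓝[<] T, ¬(M : ℝ≥0∞) < xNorm (a t) := not_eventually.1 hM
  have h2 : ∀ᶠ t in 𝓝[<] T, t ∈ Ioo (max 0 (T - τ)) T :=
    Ioo_mem_nhdsLT (max_lt hT (by linarith))
  obtain ⟨t₀, h3, h4⟩ := (h1.and_eventually h2).exists
  have h5 : (0 : ℝ) < t₀ := (le_max_left _ _).trans_lt h4.1
  have h6 : T - τ < t₀ := (le_max_right _ _).trans_lt h4.1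
  have ht₀ : t₀ ∈ Ioo 0 T := ⟨h5, h4.2⟩
  obtain ⟨n0, n1⟩ := ha.norm_curve_le (Ioo_subset_Ico_self ht₀) M.coe_nonneg (by
    rw [ENNReal.ofReal_coe_nnreal]; exact not_lt.1 h3)
  obtain ⟨c, hc⟩ := hloc (a t₀) (ha.isDatum ht₀) n0 n1
  obtain ⟨b, hb⟩ := ha.glue ht₀ hc (by linarith)
  have := hmax _ b hb
  linarith

end

end

end Prandtl4

/-! ### The blow-up theorem -/

theorem theorem4 (a₀ : ℝ → ℝ) (h₀ : Prandtl4.IsDatum a₀) (hE : Prandtl4.energy a₀ < 0) :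
    ∃ T : ℝ, 0 < T ∧ ∃ a : ℝ → ℝ → ℝ,
      Prandtl4.IsSolution a₀ T a ∧
      (∀ (S : ℝ) (b : ℝ → ℝ → ℝ), Prandtl4.IsSolution a₀ S b →
        S ≤ T ∧ ∀ t ∈ Ico 0 S, ∀ y, 0 ≤ y → b t y = a t y) ∧
      Tendsto (fun t => Prandtl4.xNorm (a t)) (𝓝[<] T) (𝓝 ∞) := by
  obtain ⟨T, hT, a, ha, hmax⟩ :=
    Prandtl4.exists_maximal h₀ (Prandtl4.exists_lifespan_bound a₀ hE)
  exact ⟨T, hT, a, ha, hmax,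
    Prandtl4.tendsto_xNorm_of_maximal hT ha fun S b hb => (hmax S b hb).1⟩
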